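/- For a nonzero rational number $n$, let $E_n$ be the elliptic curve over $\mathbb{Q}$ defined by the projective equation $x^3+y^3=nz^3$ with origin $(1:-1:0)$; it has the Weierstrass equation $y^2=x^3-2^4\cdot 3^3\cdot n^2$. Let $$\mathrm{Sel}_3(E_n)=\ker\Bigl(H^1(\mathbb{Q},E_n[3])\longrightarrow\prod_v H^1(\mathbb{Q}_v,E_n)\Bigr)$$ be its $3$-Selmer group, where $v$ runs over all places of $\mathbb{Q}$ (including the real one) and $H^1$ denotes continuous Galois cohomology; it is a vector space over $\mathbb{F}_3$. Let $p$ be an odd prime with $p\equiv 2$ or $5 \pmod 9$. Then $$\dim_{\mathbb{F}_3}\mathrm{Sel}_3(E_{3p})=1,\qquad \dim_{\mathbb{F}_3}\mathrm{Sel}_3(E_{9p^2})=0,$$ $$\dim_{\mathbb{F}_3}\mathrm{Sel}_3(E_{3p^2})=1,\qquad \dim_{\mathbb{F}_3}\mathrm{Sel}_3(E_{9p})=0.$$ -/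

import Mathlib

noncomputable section

namespace CubeSum

/-! ### First continuous cohomology of a topological group with discrete coefficients -/

section Cohomology

variable (G M : Type*) [Group G] [TopologicalSpace G] [AddCommGroup M] [DistribMulAction G M]

/-- Continuous 1-cocycles `G → M`, where `M` carries the discrete topology
(so that continuous means locally constant). -/
def cocycles : AddSubgroup (G → M) where
  carrier := {c | IsLocallyConstant c ∧ ∀ σ τ : G, c (σ * τ) = c σ + σ • c τ}
  zero_mem' := ⟨IsLocallyConstant.const 0, fun σ τ => by simp⟩
  add_mem' := by
    rintro a b ⟨ha, ha'⟩ ⟨hb, hb'⟩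
    refine ⟨ha.add hb, fun σ τ => ?_⟩
    simp only [Pi.add_apply, ha', hb', smul_add]
    abel
  neg_mem' := by
    rintro a ⟨ha, ha'⟩
    refine ⟨ha.neg, fun σ τ => ?_⟩
    simp only [Pi.neg_apply, ha', smul_neg]
    abel

/-- 1-coboundaries `σ ↦ σ • m - m`. -/
def coboundaries : AddSubgroup (G → M) where
  carrier := {c | ∃ m : M, ∀ σ : G, c σ = σ • m - m}
  zero_mem' := ⟨0, fun σ => by simp⟩
  add_mem' := by
    rintro a b ⟨m, hm⟩ ⟨n, hn⟩
    refine ⟨m + n, fun σ => ?_⟩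
    simp only [Pi.add_apply, hm, hn, smul_add]
    abel
  neg_mem' := by
    rintro a ⟨m, hm⟩
    refine ⟨-m, fun σ => ?_⟩
    simp only [Pi.neg_apply, hm, smul_neg]
    abel

/-- The first continuous cohomology group `H¹(G, M)`: continuous cocycles modulo coboundaries. -/
abbrev H1 : Type _ := cocycles G M ⧸ (coboundaries G M).addSubgroupOf (cocycles G M)

variable {G M} {G' M' : Type*} [Group G'] [TopologicalSpace G'] [AddCommGroup M']
  [DistribMulAction G' M']

/-- The map on cocycles induced by a continuous homomorphism `φ : G' → G` and a homomorphism
`f : M → M'` compatible with `φ`. -/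
def cocyclesMap (φ : G' →ₜ* G) (f : M →+ M') (hf : ∀ (σ : G') (m : M), f (φ σ • m) = σ • f m) :
    cocycles G M →+ cocycles G' M' where
  toFun c := ⟨fun σ => f (c.1 (φ σ)),
    (c.2.1.comp_continuous φ.continuous_toFun).comp f, fun σ τ => by
      change f (c.1 (φ (σ * τ))) = _
      rw [map_mul, c.2.2, map_add, hf]⟩
  map_zero' := by ext; simp
  map_add' a b := by ext; simp

/-- The map `H¹(G, M) → H¹(G', M')` induced by a continuous homomorphism `φ : G' → G` and a
homomorphism `f : M → M'` compatible with `φ`. -/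
def H1.map (φ : G' →ₜ* G) (f : M →+ M') (hf : ∀ (σ : G') (m : M), f (φ σ • m) = σ • f m) :
    H1 G M →+ H1 G' M' :=
  QuotientAddGroup.map _ _ (cocyclesMap φ f hf) <| by
    rintro c ⟨m, hm⟩
    refine ⟨f m, fun σ => ?_⟩
    change f (c.1 (φ σ)) = _
    rw [← hf, ← map_sub]
    exact congrArg f (hm (φ σ))

theorem H1.nsmul_eq_zero {m : ℕ} (hM : ∀ x : M, m • x = 0) (x : H1 G M) : m • x = 0 := by
  induction x using QuotientAddGroup.induction_on with
  | H c =>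
    rw [← QuotientAddGroup.mk_nsmul]
    have : m • c = 0 := by
      ext σ
      simpa using hM (c.1 σ)
    rw [this]
    rfl

end Cohomology

/-! ### Galois action on the points of a Weierstrass curve -/

section Galois

open WeierstrassCurve.Affine

variable {K : Type*} [Field K] (W : WeierstrassCurve K)

/-- The coordinatewise action of `Gal(F/L)` on the `F`-points of a curve over `K`, for `F/L/K`. -/
instance galoisAction (L F : Type*) [Field L] [Field F] [Algebra K L] [Algebra L F] [Algebra K F]
    [IsScalarTower K L F] [DecidableEq F] :
    DistribMulAction Gal(F/L) (W.baseChange F).toAffine.Point where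
  smul σ P := Point.map (W' := W) σ.toAlgHom P
  one_smul P := by cases P <;> rfl
  mul_smul σ τ P := by cases P <;> rfl
  smul_zero σ := rfl
  smul_add σ P Q := map_add (Point.map (W' := W) σ.toAlgHom) P Q

end Galois

/-- The action of `G` on the `m`-torsion subgroup `M[m]` of a `G`-module `M`. -/
instance torsionAction (G M : Type*) [Group G] [AddCommGroup M] [DistribMulAction G M] (m : ℤ) :
    DistribMulAction G (AddSubgroup.torsionBy M m) where
  smul σ x := ⟨σ • (x : M), by
    change m • σ • (x : M) = 0
    rw [← smul_comm σ m (x : M), show m • (x : M) = 0 from x.2, smul_zero]⟩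
  one_smul x := Subtype.ext (one_smul G (x : M))
  mul_smul σ τ x := Subtype.ext (mul_smul σ τ (x : M))
  smul_zero σ := Subtype.ext (smul_zero σ)
  smul_add σ x y := Subtype.ext (smul_add σ (x : M) (y : M))

/-! ### Restriction to a decomposition group -/

section Localization

variable (K L : Type*) [Field K] [Field L] [Algebra K L]

/-- A fixed `K`-embedding of an algebraic closure of `K` into an algebraic closure of `L`. -/
def closureEmbedding : AlgebraicClosure K →ₐ[K] AlgebraicClosure L :=
  IsAlgClosed.lift

/-- Restriction of automorphisms `Gal(L̄/L) → Gal(K̄/K)` along the fixed embedding `K̄ → L̄`. -/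
def galoisRestrictionHom :
    Gal(AlgebraicClosure L/L) →* Gal(AlgebraicClosure K/K) :=
  letI : Algebra (AlgebraicClosure K) (AlgebraicClosure L) :=
    (closureEmbedding K L).toRingHom.toAlgebra
  haveI : IsScalarTower K (AlgebraicClosure K) (AlgebraicClosure L) :=
    IsScalarTower.of_algebraMap_eq fun x => ((closureEmbedding K L).commutes x).symm
  IntermediateField.restrictRestrictAlgEquivMapHom K (AlgebraicClosure K) L (AlgebraicClosure L)

theorem closureEmbedding_restriction (σ : Gal(AlgebraicClosure L/L)) (x : AlgebraicClosure K) :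
    closureEmbedding K L (galoisRestrictionHom K L σ x) = σ (closureEmbedding K L x) := by
  let : Algebra (AlgebraicClosure K) (AlgebraicClosure L) :=
    (closureEmbedding K L).toRingHom.toAlgebra
  have : IsScalarTower K (AlgebraicClosure K) (AlgebraicClosure L) :=
    IsScalarTower.of_algebraMap_eq fun x => ((closureEmbedding K L).commutes x).symm
  exact AlgEquiv.restrictNormal_commutes
    (MulSemiringAction.toAlgAut Gal(AlgebraicClosure L/L) K (AlgebraicClosure L) σ)
    (AlgebraicClosure K) x

theorem continuous_galoisRestrictionHom : Continuous (galoisRestrictionHom K L) := by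
  apply continuous_of_continuousAt_one _ (continuousAt_def.mpr _)
  intro U hU
  rw [map_one, krullTopology_mem_nhds_one_iff] at hU
  obtain ⟨E, hE, hEU⟩ := hU
  obtain ⟨S, rfl⟩ := IntermediateField.essFiniteType_iff.mp (inferInstance : Algebra.EssFiniteType K E)
  have hopen : IsOpen (⋂ x ∈ S, (MulAction.stabilizer Gal(AlgebraicClosure L/L)
      (closureEmbedding K L x) : Set Gal(AlgebraicClosure L/L))) :=
    isOpen_biInter_finset fun x _ => stabilizer_isOpen_of_isIntegral _
  refine Filter.mem_of_superset (hopen.mem_nhds ?_) fun σ hσ => hEU ?_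
  · simp only [Set.mem_iInter]
    exact fun x _ => one_mem _
  · have hle : IntermediateField.adjoin K (S : Set (AlgebraicClosure K)) ≤
        IntermediateField.fixedField (Subgroup.zpowers (galoisRestrictionHom K L σ)) := by
      rw [IntermediateField.adjoin_le_iff]
      intro x hx
      have hx' : galoisRestrictionHom K L σ ∈
          MulAction.stabilizer Gal(AlgebraicClosure K/K) x := by
        apply (closureEmbedding K L).injective
        have := Set.mem_iInter₂.mp hσ x hx
        exact (closureEmbedding_restriction K L σ x).trans this
      rintro ⟨g, hg⟩
      exact (Subgroup.zpowers_le.mpr hx') hg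
    exact (IntermediateField.le_iff_le _ _).mp hle (Subgroup.mem_zpowers _)

/-- The restriction homomorphism `Gal(L̄/L) → Gal(K̄/K)` as a continuous homomorphism. -/
def galoisRestriction : Gal(AlgebraicClosure L/L) →ₜ* Gal(AlgebraicClosure K/K) where
  toMonoidHom := galoisRestrictionHom K L
  continuous_toFun := continuous_galoisRestrictionHom K L

end Localization

/-! ### Selmer groups -/

section Selmer

open WeierstrassCurve.Affine

variable {K : Type*} [Field K] (W : WeierstrassCurve K)

open scoped Classical

/-- `H¹(Gal(K̄/K), W[m])`, with `W[m]` the `m`-torsion of `W(K̄)`. -/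
abbrev torsionH1 (m : ℕ) : Type _ :=
  H1 Gal(AlgebraicClosure K/K)
    (AddSubgroup.torsionBy (W.baseChange (AlgebraicClosure K)).toAffine.Point (m : ℤ))

/-- The localization map `H¹(Gal(K̄/K), W[m]) → H¹(Gal(L̄/L), W(L̄))` for a field extension `L/K`:
restriction to `Gal(L̄/L)` followed by the map induced by `W[m] ⊆ W(K̄) → W(L̄)`. -/
def localization (m : ℕ) (L : Type*) [Field L] [Algebra K L] :
    torsionH1 W m →+
      H1 Gal(AlgebraicClosure L/L) (W.baseChange (AlgebraicClosure L)).toAffine.Point :=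
  H1.map (galoisRestriction K L)
    ((Point.map (W' := W) (closureEmbedding K L)).comp
      (AddSubgroup.torsionBy (W.baseChange (AlgebraicClosure K)).toAffine.Point (m : ℤ)).subtype)
    (by
      rintro σ ⟨P, hP⟩
      change Point.map (W' := W) (closureEmbedding K L)
          (Point.map (W' := W) (galoisRestrictionHom K L σ).toAlgHom P) =
        Point.map (W' := W) σ.toAlgHom (Point.map (W' := W) (closureEmbedding K L) P)
      cases P with
      | zero => rfl
      | some x y h =>
        simp only [Point.map_some, Point.some.injEq]
        exact ⟨closureEmbedding_restriction K L σ x, closureEmbedding_restriction K L σ y⟩)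

/-- The `m`-Selmer group of a Weierstrass curve `W` over `ℚ`: the classes in `H¹(Gal(ℚ̄/ℚ), W[m])`
that become trivial in `H¹(Gal(ℚ̄ᵥ/ℚᵥ), W(ℚ̄ᵥ))` for every place `v` of `ℚ`, i.e. for `ℚᵥ = ℚ_ℓ` with
`ℓ` any prime number and for `ℚᵥ = ℝ`. -/
def selmerGroup (W : WeierstrassCurve ℚ) (m : ℕ) : AddSubgroup (torsionH1 W m) :=
  (⨅ (ℓ : ℕ) (_ : Fact ℓ.Prime), (localization W m ℚ_[ℓ]).ker) ⊓ (localization W m ℝ).ker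

/-- The `m`-Selmer group is killed by `m`, hence is a `ℤ/m`-module. -/
instance selmerModule (W : WeierstrassCurve ℚ) (m : ℕ) : Module (ZMod m) (selmerGroup W m) :=
  AddCommGroup.zmodModule fun x =>
    Subtype.ext (H1.nsmul_eq_zero (fun y => AddSubgroup.torsionBy.nsmul y) (x : torsionH1 W m))

end Selmer

/-! ### The curves `x³ + y³ = n z³` -/

/-- The elliptic curve `Eₙ : x³ + y³ = n z³` over `ℚ` with origin `(1 : -1 : 0)`, in its Weierstrass
form `Y² = X³ - 2⁴ · 3³ · n²`. -/
def cubeSumCurve (n : ℚ) : WeierstrassCurve ℚ where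
  a₁ := 0
  a₂ := 0
  a₃ := 0
  a₄ := 0
  a₆ := -(2 ^ 4 * 3 ^ 3 * n ^ 2)

theorem cubeSumCurve_isElliptic {n : ℚ} (hn : n ≠ 0) : (cubeSumCurve n).IsElliptic := by
  refine ⟨isUnit_iff_ne_zero.mpr ?_⟩
  simp only [cubeSumCurve, WeierstrassCurve.Δ, WeierstrassCurve.b₂, WeierstrassCurve.b₄,
    WeierstrassCurve.b₆, WeierstrassCurve.b₈]
  ring_nf
  simpa using hn

/-- The change of coordinates `X = 12 n / (x + y)`, `Y = 36 n (x - y) / (x + y)` between the cubic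
`x³ + y³ = n` and its Weierstrass form, with inverse `x = (36 n + Y) / (6 X)`,
`y = (36 n - Y) / (6 X)`, valid over every extension `F` of `ℚ`. -/
theorem cubeSumCurve_equation_iff {F : Type*} [Field F] [Algebra ℚ F] {n : ℚ} (hn : n ≠ 0)
    {x y X Y : F} (hX : X * (x + y) = 12 * algebraMap ℚ F n)
    (hY : Y * (x + y) = 36 * algebraMap ℚ F n * (x - y)) :
    x ^ 3 + y ^ 3 = algebraMap ℚ F n ↔
      ((cubeSumCurve n).baseChange F).toAffine.Equation X Y := by
  have : CharZero F := algebraRat.charZero F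
  have hn' : algebraMap ℚ F n ≠ 0 := by simpa using hn
  have hs : x + y ≠ 0 := by
    intro h
    rw [h, mul_zero] at hX
    exact mul_ne_zero (by norm_num) hn' hX.symm
  obtain rfl : X = 12 * algebraMap ℚ F n / (x + y) := by rw [eq_div_iff hs, hX]
  obtain rfl : Y = 36 * algebraMap ℚ F n * (x - y) / (x + y) := by rw [eq_div_iff hs, hY]
  rw [WeierstrassCurve.Affine.equation_iff]
  simp only [cubeSumCurve, WeierstrassCurve.baseChange, WeierstrassCurve.map, map_zero, map_neg,
    map_mul, map_pow, map_ofNat]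
  generalize algebraMap ℚ F n = t at *
  field_simp
  constructor
  · rintro rfl
    ring
  · intro h
    have h2 : (1728 * t : F) ≠ 0 := mul_ne_zero (by norm_num) hn'
    apply mul_left_cancel₀ h2
    linear_combination h

end CubeSum

end

/-!
The curve `Eₙ` has complex multiplication by `√-3`, whose square is `-3`, and `ker √-3` is
isomorphic to `μ₃` over `ℚ`. By Kummer theory, classes with values in `ker √-3` over a field `L`
are elements `D` of `Lˣ/Lˣ³`, and such a class dies in `H¹(L, Eₙ)` exactly if `D` is a cube or the
covering `D r³ + D² s³ = n` has a point over `L`.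

Let `c` be a Selmer cocycle. Over `ℚ(ζ₃)` its image under `√-3` is the Kummer class of some `β`
whose norm to `ℚ` is a cube. Local triviality at the primes `ℓ ≡ 1 mod 3` makes the valuation of
`β` divisible by `3` at one of the two primes over `ℓ`, hence at both. So `β` is a root of unity
up to cubes, and triviality at `p` leaves only `β = 1`. Thus `c` is the Kummer class of some `d ∈
ℚˣ`. The local conditions force `3 ∣ v_ℓ(d)` for `ℓ ≠ 3, p`, and `n` itself gives the trivial
class, so the Selmer group is spanned by the class of `3`. This class is nonzero and locally
trivial for `n = 3 p ^ B`, but not trivial at `3` for `n = 9 p ^ B`.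
-/

noncomputable section

namespace CubeSum

open WeierstrassCurve.Affine IntermediateField NumberField

/-! ### Cube roots of unity -/

section CubeRoots

theorem cube_eq_one_of_sq_add {R : Type*} [CommRing R] {w : R} (hw : w ^ 2 + w + 1 = 0) :
    w ^ 3 = 1 := by
  linear_combination (w - 1) * hw

theorem sq_cube_eq_one {R : Type*} [CommMonoid R] {w : R} (hw : w ^ 3 = 1) : (w ^ 2) ^ 3 = 1 := by
  rw [← pow_mul, mul_comm, pow_mul, hw, one_pow]

theorem map_cube_eq_one {R S G : Type*} [CommMonoid R] [CommMonoid S] [FunLike G R S]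
    [MonoidHomClass G R S] (f : G) {w : R} (hw : w ^ 3 = 1) : f w ^ 3 = 1 := by
  rw [← map_pow, hw, map_one]

theorem map_sq_add {R S G : Type*} [CommRing R] [CommRing S] [FunLike G R S] [RingHomClass G R S]
    (f : G) {w : R} (hw : w ^ 2 + w + 1 = 0) : f w ^ 2 + f w + 1 = 0 := by
  simpa only [map_add, map_pow, map_one, map_zero] using congrArg f hw

variable {F : Type*} [Field F]

theorem ne_zero_of_cube_eq_one {w : F} (hw : w ^ 3 = 1) : w ≠ 0 := by
  rintro rfl
  norm_num at hw

theorem ne_one_of_sq_add (h3 : (3 : F) ≠ 0) {w : F} (hw : w ^ 2 + w + 1 = 0) : w ≠ 1 := by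
  rintro rfl
  exact h3 (by linear_combination hw)

theorem sq_add_of_cube_eq_one {R : Type*} [CommRing R] [IsDomain R] {w : R} (hw : w ^ 3 = 1)
    (h1 : w ≠ 1) : w ^ 2 + w + 1 = 0 :=
  (mul_eq_zero.mp (by linear_combination hw : (w - 1) * (w ^ 2 + w + 1) = 0)).resolve_left
    (sub_ne_zero.mpr h1)

theorem eq_of_cube_eq_one {w : F} (hw : w ^ 2 + w + 1 = 0) {z : F} (hz : z ^ 3 = 1) :
    z = 1 ∨ z = w ∨ z = w ^ 2 := by
  have h : (z - 1) * ((z - w) * (z - w ^ 2)) = 0 := by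
    linear_combination hz + (z - 1) * (-z + w - 1) * hw
  simpa only [mul_eq_zero, sub_eq_zero] using h

theorem cube_add_cube_rotate {w u v a : F} (hw : w ^ 3 = 1) (h : u ^ 3 + v ^ 3 = a) :
    (w * u) ^ 3 + (w ^ 2 * v) ^ 3 = a := by
  rw [mul_pow, mul_pow, hw, sq_cube_eq_one hw, one_mul, one_mul, h]

theorem addition_trichotomy {x₁ y₁ x₂ y₂ a : F} (h₁ : y₁ ^ 2 = x₁ ^ 3 - a)
    (h₂ : y₂ ^ 2 = x₂ ^ 3 - a) :
    x₁ ≠ x₂ ∨ (x₁ = x₂ ∧ y₁ = -y₂) ∨ (x₁ = x₂ ∧ y₁ = y₂ ∧ y₁ ≠ 0) := by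
  by_cases hx : x₁ = x₂
  · subst hx
    rcases sq_eq_sq_iff_eq_or_eq_neg.mp (h₁.trans h₂.symm) with rfl | h
    · by_cases hy : y₁ = 0
      · exact .inr (.inl ⟨rfl, by rw [hy, neg_zero]⟩)
      · exact .inr (.inr ⟨rfl, rfl, hy⟩)
    · exact .inr (.inl ⟨rfl, h⟩)
  · exact .inl hx

end CubeRoots

/-! ### The curves `Y² = X³ - 432 n²` -/

section Curve

/-- The group `Eₙ(F)`, on the Weierstrass model `Y² = X³ - 432 n²`. -/
abbrev EPoint (n : ℚ) (F : Type*) [Field F] [Algebra ℚ F] : Type _ :=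
  ((cubeSumCurve n).baseChange F).toAffine.Point

variable {n : ℚ} {F : Type*} [Field F] [Algebra ℚ F]

theorem equation_iff_sq {x y : F} :
    ((cubeSumCurve n).baseChange F).toAffine.Equation x y ↔
      y ^ 2 = x ^ 3 - 432 * algebraMap ℚ F n ^ 2 := by
  rw [equation_iff]
  simp only [cubeSumCurve, WeierstrassCurve.baseChange, WeierstrassCurve.map, map_zero, map_neg,
    map_mul, map_pow, map_ofNat]
  ring_nf

theorem negY_eq {x y : F} : ((cubeSumCurve n).baseChange F).toAffine.negY x y = -y := by
  simp [negY, cubeSumCurve, WeierstrassCurve.baseChange, WeierstrassCurve.map]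

theorem addX_eq {x₁ x₂ m : F} :
    ((cubeSumCurve n).baseChange F).toAffine.addX x₁ x₂ m = m ^ 2 - x₁ - x₂ := by
  simp [addX, cubeSumCurve, WeierstrassCurve.baseChange, WeierstrassCurve.map]

theorem addY_eq {x₁ x₂ y₁ m : F} :
    ((cubeSumCurve n).baseChange F).toAffine.addY x₁ x₂ y₁ m =
      -(m * (m ^ 2 - x₁ - x₂ - x₁) + y₁) := by
  rw [addY, negAddY, negY_eq, addX_eq]

theorem sq_mul_cube_root {w x y : F} (hw : w ^ 3 = 1)
    (h : y ^ 2 = x ^ 3 - 432 * algebraMap ℚ F n ^ 2) :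
    y ^ 2 = (w * x) ^ 3 - 432 * algebraMap ℚ F n ^ 2 := by
  rw [mul_pow, hw, one_mul, h]

theorem sq_kernelPoint {w : F} (hw : w ^ 2 + w + 1 = 0) :
    (12 * algebraMap ℚ F n * (w - w ^ 2)) ^ 2 = 0 ^ 3 - 432 * algebraMap ℚ F n ^ 2 := by
  linear_combination (144 * algebraMap ℚ F n ^ 2 * (w ^ 2 - 3 * w + 3)) * hw

variable [NeZero n]

theorem algebraMap_rat_ne_zero : algebraMap ℚ F n ≠ 0 := by
  simpa only [ne_eq, map_eq_zero] using NeZero.ne n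

theorem nonsingular_of_sq {x y : F} (h : y ^ 2 = x ^ 3 - 432 * algebraMap ℚ F n ^ 2) :
    ((cubeSumCurve n).baseChange F).toAffine.Nonsingular x y := by
  have : (cubeSumCurve n).IsElliptic := cubeSumCurve_isElliptic (NeZero.ne n)
  have : ((cubeSumCurve n).baseChange F).IsElliptic :=
    inferInstanceAs ((cubeSumCurve n).map _).IsElliptic
  exact (equation_iff_nonsingular (W := (cubeSumCurve n).baseChange F)).mp (equation_iff_sq.mpr h)

theorem y_ne_zero_of_x_eq_zero {y : F} (h : y ^ 2 = 0 ^ 3 - 432 * algebraMap ℚ F n ^ 2) :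
    y ≠ 0 := by
  have : CharZero F := algebraRat.charZero F
  rintro rfl
  have h' : (432 : F) * algebraMap ℚ F n ^ 2 = 0 := by linear_combination h
  exact mul_ne_zero (by norm_num) (pow_ne_zero 2 algebraMap_rat_ne_zero) h'

theorem add_ne_zero_of_cube_add_cube {u v : F} (h : u ^ 3 + v ^ 3 = algebraMap ℚ F n) :
    u + v ≠ 0 := by
  intro h0
  refine (algebraMap_rat_ne_zero : algebraMap ℚ F n ≠ 0) ?_
  linear_combination -h + (u ^ 2 - u * v + v ^ 2) * h0

theorem sq_cubicPoint {u v : F} (h : u ^ 3 + v ^ 3 = algebraMap ℚ F n) :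
    (36 * algebraMap ℚ F n * (u - v) / (u + v)) ^ 2 =
      (12 * algebraMap ℚ F n / (u + v)) ^ 3 - 432 * algebraMap ℚ F n ^ 2 := by
  have h0 := add_ne_zero_of_cube_add_cube h
  field_simp
  linear_combination (1728 * algebraMap ℚ F n ^ 2) * h

/-- The affine point `(x, y)` of `Eₙ`. -/
def mkPoint (x y : F) (h : y ^ 2 = x ^ 3 - 432 * algebraMap ℚ F n ^ 2) : EPoint n F :=
  .some x y (nonsingular_of_sq h)

theorem mkPoint_inj {x y x' y' : F} {h : y ^ 2 = x ^ 3 - 432 * algebraMap ℚ F n ^ 2}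
    {h' : y' ^ 2 = x' ^ 3 - 432 * algebraMap ℚ F n ^ 2} :
    mkPoint x y h = mkPoint x' y' h' ↔ x = x' ∧ y = y' := by
  simp only [mkPoint, Point.some.injEq]

theorem mkPoint_ne_zero {x y : F} {h : y ^ 2 = x ^ 3 - 432 * algebraMap ℚ F n ^ 2} :
    mkPoint x y h ≠ 0 := Point.some_ne_zero _

theorem EPoint.eq_zero_or_eq_mkPoint (P : EPoint n F) : P = 0 ∨ ∃ x y h, P = mkPoint x y h := by
  cases P with
  | zero => exact .inl rfl
  | some x y h => exact .inr ⟨x, y, equation_iff_sq.mp h.1, rfl⟩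

theorem neg_mkPoint {x y : F} (h : y ^ 2 = x ^ 3 - 432 * algebraMap ℚ F n ^ 2) :
    -mkPoint x y h = mkPoint x (-y) (by rw [neg_sq, h]) := by
  simp only [mkPoint, Point.neg_some, negY_eq]

/-- The point of the Weierstrass model of `Eₙ` corresponding to the point `(u, v)` of the cubic
`u³ + v³ = n`. -/
def cubicPoint (u v : F) (h : u ^ 3 + v ^ 3 = algebraMap ℚ F n) : EPoint n F :=
  mkPoint _ _ (sq_cubicPoint h)

theorem cubicPoint_inj {u v u' v' : F} {h : u ^ 3 + v ^ 3 = algebraMap ℚ F n}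
    {h' : u' ^ 3 + v' ^ 3 = algebraMap ℚ F n} :
    cubicPoint u v h = cubicPoint u' v' h' ↔ u = u' ∧ v = v' := by
  have : CharZero F := algebraRat.charZero F
  refine ⟨fun e => ?_, fun ⟨h₁, h₂⟩ => by subst h₁ h₂; rfl⟩
  have h0 := add_ne_zero_of_cube_add_cube h
  have h0' := add_ne_zero_of_cube_add_cube h'
  have hn : algebraMap ℚ F n ≠ 0 := algebraMap_rat_ne_zero
  rw [cubicPoint, cubicPoint, mkPoint_inj] at e
  obtain ⟨e₁, e₂⟩ := e
  have hadd : u + v = u' + v' := by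
    field_simp at e₁
    exact e₁.symm
  rw [hadd] at e₂
  have hsub : u - v = u' - v' := by
    field_simp at e₂
    exact e₂
  exact ⟨by linear_combination (hadd + hsub) / 2, by linear_combination (hadd - hsub) / 2⟩

/-- Over a field containing `μ₃`, the denominator `u + v` divides
`n = (u + v) (w u + w² v) (w² u + w v)`. -/
theorem cubicPoint_eq_mkPoint {w u v : F} (hw : w ^ 2 + w + 1 = 0)
    (h : u ^ 3 + v ^ 3 = algebraMap ℚ F n) :
    ∃ h', cubicPoint u v h = mkPoint (12 * (w * u + w ^ 2 * v) * (w ^ 2 * u + w * v))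
      (36 * (u - v) * (w * u + w ^ 2 * v) * (w ^ 2 * u + w * v)) h' := by
  have h0 := add_ne_zero_of_cube_add_cube h
  have hn : algebraMap ℚ F n = (u + v) * (w * u + w ^ 2 * v) * (w ^ 2 * u + w * v) := by
    linear_combination -h + (-(w - 1) * (u ^ 3 + v ^ 3) - w * (u * v * (u + v)) * w) * hw
  have hx : 12 * algebraMap ℚ F n / (u + v) =
      12 * (w * u + w ^ 2 * v) * (w ^ 2 * u + w * v) := by
    rw [div_eq_iff h0, hn]; ring
  have hy : 36 * algebraMap ℚ F n * (u - v) / (u + v) =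
      36 * (u - v) * (w * u + w ^ 2 * v) * (w ^ 2 * u + w * v) := by
    rw [div_eq_iff h0, hn]; ring
  exact ⟨hx ▸ hy ▸ sq_cubicPoint h, mkPoint_inj.mpr ⟨hx, hy⟩⟩

variable [DecidableEq F]

theorem mkPoint_add_of_ne {x₁ y₁ x₂ y₂ : F} {h₁ h₂} (m : F) (hx : x₁ ≠ x₂)
    (hm : m * (x₁ - x₂) = y₁ - y₂) :
    ∃ h₃, mkPoint (n := n) x₁ y₁ h₁ + mkPoint x₂ y₂ h₂ =
      mkPoint (m ^ 2 - x₁ - x₂) (-(m * (m ^ 2 - x₁ - x₂ - x₁) + y₁)) h₃ := by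
  have hs : ((cubeSumCurve n).baseChange F).toAffine.slope x₁ x₂ y₁ y₂ = m := by
    rw [slope_of_X_ne hx, div_eq_iff (sub_ne_zero.mpr hx), hm]
  have hadd := Point.add_of_X_ne hx (h₁ := nonsingular_of_sq h₁) (h₂ := nonsingular_of_sq h₂)
  have h₃ := nonsingular_add (nonsingular_of_sq h₁) (nonsingular_of_sq h₂) fun h => hx h.1
  simp only [hs, addX_eq, addY_eq] at hadd h₃
  exact ⟨equation_iff_sq.mp h₃.1, hadd⟩

theorem mkPoint_add_self {x y : F} {h} (m : F) (hy : y ≠ 0) (hm : m * (2 * y) = 3 * x ^ 2) :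
    ∃ h₃, mkPoint (n := n) x y h + mkPoint x y h =
      mkPoint (m ^ 2 - x - x) (-(m * (m ^ 2 - x - x - x) + y)) h₃ := by
  have : CharZero F := algebraRat.charZero F
  have hy' : y ≠ ((cubeSumCurve n).baseChange F).toAffine.negY x y := by
    rw [negY_eq]
    exact fun h => hy (by linear_combination h / 2)
  have hs : ((cubeSumCurve n).baseChange F).toAffine.slope x x y y = m := by
    rw [slope_of_Y_ne rfl hy', negY_eq, div_eq_iff (by simpa [← two_mul] using hy)]
    simp only [cubeSumCurve, WeierstrassCurve.baseChange, WeierstrassCurve.map, map_zero]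
    linear_combination -hm
  have hadd := Point.add_self_of_Y_ne hy' (h₁ := nonsingular_of_sq h)
  have h₃ := nonsingular_add (nonsingular_of_sq h) (nonsingular_of_sq h) fun h => hy' h.2
  simp only [hs, addX_eq, addY_eq] at hadd h₃
  exact ⟨equation_iff_sq.mp h₃.1, hadd⟩

theorem mkPoint_add_neg {x₁ y₁ x₂ y₂ : F} {h₁ h₂} (hx : x₁ = x₂) (hy : y₁ = -y₂) :
    mkPoint (n := n) x₁ y₁ h₁ + mkPoint x₂ y₂ h₂ = 0 :=
  Point.add_of_Y_eq hx (by rw [negY_eq, hy])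

/-- `3 x (x³ - 1728 n²)` is the third division polynomial of `Eₙ`. -/
theorem three_zsmul_mkPoint_eq_zero_iff {x y : F} {h} :
    (3 : ℤ) • mkPoint (n := n) x y h = 0 ↔ x * (x ^ 3 - 1728 * algebraMap ℚ F n ^ 2) = 0 := by
  have : CharZero F := algebraRat.charZero F
  have hn : algebraMap ℚ F n ^ 2 ≠ 0 := pow_ne_zero 2 algebraMap_rat_ne_zero
  rw [show (3 : ℤ) = 2 + 1 by norm_num, add_zsmul, two_zsmul, one_zsmul]
  by_cases hy : y = 0
  · rw [mkPoint_add_neg rfl (by rw [hy, neg_zero]), zero_add, iff_false_left mkPoint_ne_zero]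
    have hx : x ^ 3 = 432 * algebraMap ℚ F n ^ 2 := by rw [hy] at h; linear_combination -h
    refine mul_ne_zero ?_ ?_
    · rintro rfl
      exact hn (by linear_combination -hx / 432)
    · rw [hx]
      exact fun h0 => hn (by linear_combination -h0 / 1296)
  · obtain ⟨m, hm⟩ : ∃ m, m * (2 * y) = 3 * x ^ 2 :=
      ⟨3 * x ^ 2 / (2 * y), div_mul_cancel₀ _ (by simpa using hy)⟩
    obtain ⟨h₃, hadd⟩ := mkPoint_add_self (h := h) m hy hm
    rw [hadd, ← eq_neg_iff_add_eq_zero, neg_mkPoint, mkPoint_inj]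
    have hdiv : 4 * y ^ 2 * (m ^ 2 - 3 * x) =
        -3 * (x * (x ^ 3 - 1728 * algebraMap ℚ F n ^ 2)) := by
      linear_combination -12 * x * h + (2 * y * m + 3 * x ^ 2) * hm
    constructor
    · rintro ⟨hx, -⟩
      linear_combination hdiv / 3 - 4 * y ^ 2 / 3 * hx
    · intro hx
      have hmx : m ^ 2 - 3 * x = 0 := by
        rw [hx, mul_zero] at hdiv
        exact (mul_eq_zero.mp hdiv).resolve_left (by simpa using hy)
      exact ⟨by linear_combination hmx, by linear_combination -m * hmx⟩

/-! ### The endomorphism `√-3` and its kernel -/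

/-- The automorphism `(x, y) ↦ (w x, y)` of `Eₙ`, where `w` is a cube root of unity. -/
def scale (w : F) (hw : w ^ 3 = 1) : EPoint n F →+ EPoint n F where
  toFun P := match P with
    | .zero => 0
    | .some x y h => mkPoint (w * x) y (sq_mul_cube_root hw (equation_iff_sq.mp h.1))
  map_zero' := rfl
  map_add' P Q := by
    rcases P.eq_zero_or_eq_mkPoint with rfl | ⟨x₁, y₁, h₁, rfl⟩
    · rw [zero_add]; exact (zero_add _).symm
    rcases Q.eq_zero_or_eq_mkPoint with rfl | ⟨x₂, y₂, h₂, rfl⟩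
    · rw [add_zero]; exact (add_zero _).symm
    change _ = mkPoint _ _ (sq_mul_cube_root hw h₁) + mkPoint _ _ (sq_mul_cube_root hw h₂)
    rcases addition_trichotomy h₁ h₂ with hx | ⟨hx, hy⟩ | ⟨rfl, rfl, hy⟩
    · obtain ⟨m, hm⟩ : ∃ m, m * (x₁ - x₂) = y₁ - y₂ :=
        ⟨(y₁ - y₂) / (x₁ - x₂), div_mul_cancel₀ _ (sub_ne_zero.mpr hx)⟩
      obtain ⟨h₃, e⟩ := mkPoint_add_of_ne (h₁ := h₁) (h₂ := h₂) m hx hm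
      obtain ⟨h₃', e'⟩ := mkPoint_add_of_ne (h₁ := sq_mul_cube_root hw h₁)
        (h₂ := sq_mul_cube_root hw h₂) (m * w ^ 2)
        (mul_right_injective₀ (ne_zero_of_cube_eq_one hw) |>.ne hx)
        (by linear_combination m * (x₁ - x₂) * hw + hm)
      rw [e, e']
      exact mkPoint_inj.mpr ⟨by linear_combination -(m ^ 2 * w) * hw, by
        linear_combination m * (w ^ 3 * m ^ 2 + m ^ 2 - 2 * x₁ - x₂) * hw⟩
    · rw [mkPoint_add_neg hx hy, mkPoint_add_neg (by rw [hx]) hy]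
    · obtain ⟨m, hm⟩ : ∃ m, m * (2 * y₁) = 3 * x₁ ^ 2 := by
        have : CharZero F := algebraRat.charZero F
        exact ⟨3 * x₁ ^ 2 / (2 * y₁), div_mul_cancel₀ _ (by simpa using hy)⟩
      obtain ⟨h₃, e⟩ := mkPoint_add_self (h := h₁) m hy hm
      obtain ⟨h₃', e'⟩ := mkPoint_add_self (h := sq_mul_cube_root hw h₁) (m * w ^ 2) hy
        (by linear_combination w ^ 2 * hm)
      rw [e, e']
      exact mkPoint_inj.mpr ⟨by linear_combination -(m ^ 2 * w) * hw, by
        linear_combination m * (w ^ 3 * m ^ 2 + m ^ 2 - 3 * x₁) * hw⟩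

theorem scale_mkPoint {w x y : F} (hw : w ^ 3 = 1)
    (h : y ^ 2 = x ^ 3 - 432 * algebraMap ℚ F n ^ 2) :
    scale w hw (mkPoint x y h) = mkPoint (w * x) y (sq_mul_cube_root hw h) := rfl

theorem scale_scale {w w' : F} (hw : w ^ 3 = 1) (hw' : w' ^ 3 = 1) (P : EPoint n F) :
    scale w hw (scale w' hw' P) = scale (w * w') (by rw [mul_pow, hw, hw', one_mul]) P := by
  rcases P.eq_zero_or_eq_mkPoint with rfl | ⟨x, y, h, rfl⟩
  · rfl
  · simp only [scale_mkPoint, mul_assoc]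

theorem scale_one (P : EPoint n F) : scale 1 (one_pow 3) P = P := by
  rcases P.eq_zero_or_eq_mkPoint with rfl | ⟨x, y, h, rfl⟩
  · rfl
  · simp only [scale_mkPoint, one_mul]

theorem add_scale_add_scale {w : F} (hw : w ^ 2 + w + 1 = 0) (P : EPoint n F) :
    P + scale w (cube_eq_one_of_sq_add hw) P +
      scale (w ^ 2) (sq_cube_eq_one (cube_eq_one_of_sq_add hw)) P = 0 := by
  have : CharZero F := algebraRat.charZero F
  have hw3 := cube_eq_one_of_sq_add hw
  rcases P.eq_zero_or_eq_mkPoint with rfl | ⟨x, y, h, rfl⟩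
  · simp only [map_zero, add_zero]
  -- The three points lie on the horizontal line through `P`.
  have hadd : mkPoint x y h + mkPoint (w * x) y (sq_mul_cube_root hw3 h) =
      -mkPoint (w ^ 2 * x) y (sq_mul_cube_root (sq_cube_eq_one hw3) h) := by
    rw [neg_mkPoint]
    by_cases hx : x = 0
    · subst hx
      obtain ⟨_, e⟩ := mkPoint_add_self (h := h) 0 (y_ne_zero_of_x_eq_zero h) (by ring)
      simp only [mul_zero]
      rw [e, mkPoint_inj]
      constructor <;> ring
    · obtain ⟨_, e⟩ := mkPoint_add_of_ne (h₁ := h) (h₂ := sq_mul_cube_root hw3 h) 0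
        (fun e => ne_one_of_sq_add three_ne_zero hw
          (mul_right_cancel₀ hx (e.symm.trans (one_mul x).symm))) (by ring)
      rw [e, mkPoint_inj]
      exact ⟨by linear_combination -x * hw, by ring⟩
  rw [scale_mkPoint, scale_mkPoint, hadd, neg_add_cancel]

/-- The endomorphism `[w] - [w²]` of `Eₙ`, for a primitive cube root of unity `w`: the square root
`√-3 = w - w²` in the endomorphism ring `ℤ[w]`. -/
def sqrtNegThree (w : F) (hw : w ^ 2 + w + 1 = 0) : EPoint n F →+ EPoint n F :=
  scale w (cube_eq_one_of_sq_add hw) - scale (w ^ 2) (sq_cube_eq_one (cube_eq_one_of_sq_add hw))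

theorem sqrtNegThree_apply {w : F} (hw : w ^ 2 + w + 1 = 0) (P : EPoint n F) :
    sqrtNegThree w hw P = scale w (cube_eq_one_of_sq_add hw) P -
      scale (w ^ 2) (sq_cube_eq_one (cube_eq_one_of_sq_add hw)) P := rfl

theorem sqrtNegThree_sqrtNegThree {w : F} (hw : w ^ 2 + w + 1 = 0) (P : EPoint n F) :
    sqrtNegThree w hw (sqrtNegThree w hw P) = -((3 : ℤ) • P) := by
  have hw3 := cube_eq_one_of_sq_add hw
  simp only [sqrtNegThree_apply, map_sub, scale_scale, show w * w ^ 2 = 1 by rw [← hw3]; ring,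
    show w ^ 2 * w = 1 by rw [← hw3]; ring, show w ^ 2 * w ^ 2 = w by linear_combination w * hw3,
    ← sq, scale_one]
  have h : scale (w ^ 2) (sq_cube_eq_one hw3) P = -P - scale w hw3 P := by
    rw [← sub_eq_zero, ← add_scale_add_scale hw P]
    abel
  rw [h]
  abel

/-- The isomorphism `μ₃ ≅ ker √-3`: it sends `1` to `0` and a primitive cube root of unity `w` to
`(0, 12 n (w - w²))`. (Elements `w` that are no cube roots of unity are sent to `0`.) -/
def kernelPoint (n : ℚ) [NeZero n] (w : F) : EPoint n F :=
  if h : w ^ 2 + w + 1 = 0 then mkPoint 0 _ (sq_kernelPoint h) else 0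

theorem kernelPoint_of_sq_add {w : F} (hw : w ^ 2 + w + 1 = 0) :
    kernelPoint n w = mkPoint 0 _ (sq_kernelPoint hw) := dif_pos hw

theorem kernelPoint_one : kernelPoint n (1 : F) = 0 := by
  have : CharZero F := algebraRat.charZero F
  exact dif_neg (by norm_num)

theorem kernelPoint_eq_zero_iff {w : F} (hw : w ^ 3 = 1) : kernelPoint n w = 0 ↔ w = 1 := by
  refine ⟨fun h => ?_, fun h => h ▸ kernelPoint_one⟩
  by_contra h1
  rw [kernelPoint_of_sq_add (sq_add_of_cube_eq_one hw h1)] at h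
  exact mkPoint_ne_zero h

theorem kernelPoint_mul {w w' : F} (hw : w ^ 3 = 1) (hw' : w' ^ 3 = 1) :
    kernelPoint n (w * w') = kernelPoint n w + kernelPoint n w' := by
  by_cases h1 : w = 1
  · rw [h1, one_mul, kernelPoint_one, zero_add]
  have e := sq_add_of_cube_eq_one hw h1
  rcases eq_of_cube_eq_one e hw' with rfl | rfl | rfl
  · rw [mul_one, kernelPoint_one, add_zero]
  · have e2 : (w' * w') ^ 2 + w' * w' + 1 = 0 := by linear_combination (w' ^ 2 - w' + 1) * e
    obtain ⟨_, hadd⟩ := mkPoint_add_self (h := sq_kernelPoint (n := n) e) 0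
      (y_ne_zero_of_x_eq_zero (sq_kernelPoint e)) (by ring)
    rw [kernelPoint_of_sq_add e, kernelPoint_of_sq_add e2, hadd, mkPoint_inj]
    exact ⟨by ring, by linear_combination -12 * algebraMap ℚ F n * w' * hw⟩
  · have e2 : (w ^ 2) ^ 2 + w ^ 2 + 1 = 0 := by linear_combination (w ^ 2 - w + 1) * e
    rw [show w * w ^ 2 = 1 by rw [← hw]; ring, kernelPoint_one, kernelPoint_of_sq_add e,
      kernelPoint_of_sq_add e2, mkPoint_add_neg rfl]
    linear_combination -12 * algebraMap ℚ F n * w * hw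

theorem kernelPoint_sq {w : F} (hw : w ^ 3 = 1) : kernelPoint n (w ^ 2) = -kernelPoint n w := by
  rw [eq_neg_iff_add_eq_zero, ← kernelPoint_mul (sq_cube_eq_one hw) hw,
    show w ^ 2 * w = 1 by rw [← hw]; ring, kernelPoint_one]

theorem kernelPoint_injective {w w' : F} (hw : w ^ 3 = 1) (hw' : w' ^ 3 = 1)
    (h : kernelPoint n w = kernelPoint n w') : w = w' := by
  have h1 : w * w' ^ 2 = 1 := by
    rw [← kernelPoint_eq_zero_iff (n := n) (by rw [mul_pow, hw, sq_cube_eq_one hw', one_mul]),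
      kernelPoint_mul hw (sq_cube_eq_one hw'), kernelPoint_sq hw', h, add_neg_cancel]
  linear_combination w' * h1 - w * hw'

theorem exists_kernelPoint_of_x_eq_zero {w : F} (hw : w ^ 2 + w + 1 = 0) {y : F}
    (h : y ^ 2 = 0 ^ 3 - 432 * algebraMap ℚ F n ^ 2) :
    ∃ z : F, z ^ 3 = 1 ∧ mkPoint 0 y h = kernelPoint n z := by
  have hw3 := cube_eq_one_of_sq_add hw
  rcases sq_eq_sq_iff_eq_or_eq_neg.mp (h.trans (sq_kernelPoint hw).symm) with rfl | rfl
  · exact ⟨w, hw3, (kernelPoint_of_sq_add hw).symm⟩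
  · exact ⟨w ^ 2, sq_cube_eq_one hw3, by
      rw [kernelPoint_sq hw3, kernelPoint_of_sq_add hw, neg_mkPoint]⟩

theorem exists_kernelPoint_of_sqrtNegThree_eq_zero {w : F} (hw : w ^ 2 + w + 1 = 0)
    {P : EPoint n F} (hP : sqrtNegThree w hw P = 0) :
    ∃ z : F, z ^ 3 = 1 ∧ P = kernelPoint n z := by
  have : CharZero F := algebraRat.charZero F
  rcases P.eq_zero_or_eq_mkPoint with rfl | ⟨x, y, h, rfl⟩
  · exact ⟨1, one_pow _, kernelPoint_one.symm⟩
  rw [sqrtNegThree_apply, sub_eq_zero, scale_mkPoint, scale_mkPoint, mkPoint_inj] at hP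
  have hx : w * (1 - w) * x = 0 := by linear_combination hP.1
  obtain rfl := (mul_eq_zero.mp hx).resolve_left (mul_ne_zero
    (ne_zero_of_cube_eq_one (cube_eq_one_of_sq_add hw))
    (sub_ne_zero.mpr (ne_one_of_sq_add three_ne_zero hw).symm))
  exact exists_kernelPoint_of_x_eq_zero hw h

theorem exists_kernelPoint_or_cubicPoint {w : F} (hw : w ^ 2 + w + 1 = 0) (P : EPoint n F) :
    (∃ z : F, z ^ 3 = 1 ∧ P = kernelPoint n z) ∨ ∃ u v h, P = cubicPoint u v h := by
  have : CharZero F := algebraRat.charZero F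
  have hn : algebraMap ℚ F n ≠ 0 := algebraMap_rat_ne_zero
  rcases P.eq_zero_or_eq_mkPoint with rfl | ⟨x, y, h, rfl⟩
  · exact .inl ⟨1, one_pow _, kernelPoint_one.symm⟩
  by_cases hx : x = 0
  · subst hx
    exact .inl (exists_kernelPoint_of_x_eq_zero hw h)
  refine .inr ⟨(36 * algebraMap ℚ F n + y) / (6 * x), (36 * algebraMap ℚ F n - y) / (6 * x), ?_, ?_⟩
  · field_simp
    linear_combination (216 * algebraMap ℚ F n) * h
  · have hadd : (36 * algebraMap ℚ F n + y) / (6 * x) + (36 * algebraMap ℚ F n - y) / (6 * x) =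
        12 * algebraMap ℚ F n / x := by field_simp; ring
    have hsub : (36 * algebraMap ℚ F n + y) / (6 * x) - (36 * algebraMap ℚ F n - y) / (6 * x) =
        y / (3 * x) := by field_simp; ring
    rw [cubicPoint, mkPoint_inj, hadd, hsub]
    constructor <;> field_simp
    ring

theorem cubicPoint_add_kernelPoint {w u v : F} (hw : w ^ 3 = 1)
    (h : u ^ 3 + v ^ 3 = algebraMap ℚ F n) :
    cubicPoint u v h + kernelPoint n w =
      cubicPoint (w * u) (w ^ 2 * v) (cube_add_cube_rotate hw h) := by
  have : CharZero F := algebraRat.charZero F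
  by_cases h1 : w = 1
  · subst h1
    rw [kernelPoint_one, add_zero, cubicPoint_inj]
    simp only [one_mul, one_pow, and_self]
  have e := sq_add_of_cube_eq_one hw h1
  have hx : 12 * (w * u + w ^ 2 * v) * (w ^ 2 * u + w * v) ≠ 0 := by
    have hn : algebraMap ℚ F n ≠ 0 := algebraMap_rat_ne_zero
    rw [← h] at hn
    rintro h0
    exact hn (by grind)
  have hrot : w * (w * u) + w ^ 2 * (w ^ 2 * v) = w ^ 2 * u + w * v := by grind
  have hrot' : w ^ 2 * (w * u) + w * (w ^ 2 * v) = u + v := by grind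
  obtain ⟨h₁, e₁⟩ := cubicPoint_eq_mkPoint e h
  obtain ⟨h₂, e₂⟩ := cubicPoint_eq_mkPoint e (cube_add_cube_rotate hw h)
  obtain ⟨_, hadd⟩ := mkPoint_add_of_ne (h₁ := h₁) (h₂ := sq_kernelPoint e)
    (3 * (u - v) - (w - w ^ 2) * (u + v)) hx (by grind)
  rw [e₁, e₂, kernelPoint_of_sq_add e, hadd, mkPoint_inj, hrot, hrot']
  constructor <;> grind

theorem three_zsmul_cubicPoint_eq_zero_iff {u v : F} (h : u ^ 3 + v ^ 3 = algebraMap ℚ F n) :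
    (3 : ℤ) • cubicPoint u v h = 0 ↔ u = 0 ∨ v = 0 := by
  have : CharZero F := algebraRat.charZero F
  have hn : algebraMap ℚ F n ≠ 0 := algebraMap_rat_ne_zero
  have h0 := add_ne_zero_of_cube_add_cube h
  rw [cubicPoint, three_zsmul_mkPoint_eq_zero_iff, ← mul_eq_zero]
  have hdiv : 12 * algebraMap ℚ F n / (u + v) * ((12 * algebraMap ℚ F n / (u + v)) ^ 3 -
      1728 * algebraMap ℚ F n ^ 2) =
        -3 * (12 ^ 4 * algebraMap ℚ F n ^ 3) / (u + v) ^ 3 * (u * v) := by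
    field_simp
    linear_combination -1728 * h
  rw [hdiv, mul_eq_zero, or_iff_right]
  exact div_ne_zero (by simpa using hn) (pow_ne_zero 3 h0)

end Curve

/-! ### Functoriality and the Galois action -/

section Galois

variable {n : ℚ} {F : Type*} [Field F] [Algebra ℚ F] [DecidableEq F]
  {L : Type*} [Field L] [Algebra ℚ L] [Algebra L F] [IsScalarTower ℚ L F]

theorem smul_eq_map (σ : Gal(F/L)) (P : EPoint n F) :
    σ • P = Point.map (W' := cubeSumCurve n) (σ.toAlgHom.restrictScalars ℚ) P := by
  cases P <;> rfl

variable [NeZero n] {F' : Type*} [Field F'] [Algebra ℚ F'] [DecidableEq F']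

theorem map_mkPoint (ι : F →ₐ[ℚ] F') {x y : F} (h : y ^ 2 = x ^ 3 - 432 * algebraMap ℚ F n ^ 2) :
    Point.map (W' := cubeSumCurve n) ι (mkPoint x y h) =
      mkPoint (ι x) (ι y) (by
        rw [← map_pow, h, map_sub, map_mul, map_pow, map_pow, ι.commutes, map_ofNat]) := rfl

theorem map_scale (ι : F →ₐ[ℚ] F') {w : F} (hw : w ^ 3 = 1) (P : EPoint n F) :
    Point.map (W' := cubeSumCurve n) ι (scale w hw P) =
      scale (ι w) (map_cube_eq_one ι hw) (Point.map (W' := cubeSumCurve n) ι P) := by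
  rcases P.eq_zero_or_eq_mkPoint with rfl | ⟨x, y, h, rfl⟩
  · rfl
  · simp only [scale_mkPoint, map_mkPoint, map_mul]

theorem map_sqrtNegThree (ι : F →ₐ[ℚ] F') {w : F} (hw : w ^ 2 + w + 1 = 0) {w' : F'}
    (hw' : w' ^ 2 + w' + 1 = 0) (hι : ι w = w') (P : EPoint n F) :
    Point.map (W' := cubeSumCurve n) ι (sqrtNegThree w hw P) =
      sqrtNegThree w' hw' (Point.map (W' := cubeSumCurve n) ι P) := by
  subst hι
  simp only [sqrtNegThree_apply, map_sub, map_scale, map_pow]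

theorem map_sqrtNegThree_of_conj (ι : F →ₐ[ℚ] F') {w : F} (hw : w ^ 2 + w + 1 = 0) {w' : F'}
    (hw' : w' ^ 2 + w' + 1 = 0) (hι : ι w = w' ^ 2) (P : EPoint n F) :
    Point.map (W' := cubeSumCurve n) ι (sqrtNegThree w hw P) =
      -sqrtNegThree w' hw' (Point.map (W' := cubeSumCurve n) ι P) := by
  have e : (w' ^ 2) ^ 2 = w' := by linear_combination w' * cube_eq_one_of_sq_add hw'
  simp only [sqrtNegThree_apply, map_sub, map_scale, map_pow, hι, e, neg_sub]

theorem map_kernelPoint (ι : F →ₐ[ℚ] F') {w : F} (hw : w ^ 3 = 1) :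
    Point.map (W' := cubeSumCurve n) ι (kernelPoint n w) = kernelPoint n (ι w) := by
  by_cases h1 : w = 1
  · rw [h1, map_one, kernelPoint_one, kernelPoint_one, map_zero]
  · have h := sq_add_of_cube_eq_one hw h1
    rw [kernelPoint_of_sq_add h, kernelPoint_of_sq_add (map_sq_add ι h), map_mkPoint, mkPoint_inj]
    simp only [map_zero, map_mul, map_sub, map_pow, AlgHom.commutes, map_ofNat, true_and]

theorem map_cubicPoint (ι : F →ₐ[ℚ] F') {u v : F} (h : u ^ 3 + v ^ 3 = algebraMap ℚ F n) :
    Point.map (W' := cubeSumCurve n) ι (cubicPoint u v h) =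
      cubicPoint (ι u) (ι v) (by rw [← map_pow, ← map_pow, ← map_add, h, ι.commutes]) := by
  rw [cubicPoint, cubicPoint, map_mkPoint, mkPoint_inj]
  simp only [map_div₀, map_mul, map_add, map_sub, map_ofNat, AlgHom.commutes, and_self]

theorem smul_kernelPoint (σ : Gal(F/L)) {w : F} (hw : w ^ 3 = 1) :
    σ • kernelPoint n w = kernelPoint n (σ w) := by
  rw [smul_eq_map, map_kernelPoint _ hw]
  rfl

theorem smul_cubicPoint (σ : Gal(F/L)) {u v : F} (h : u ^ 3 + v ^ 3 = algebraMap ℚ F n) :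
    ∃ h', σ • cubicPoint u v h = cubicPoint (σ u) (σ v) h' := by
  rw [smul_eq_map, map_cubicPoint]
  exact ⟨_, rfl⟩

theorem smul_sqrtNegThree {σ : Gal(F/L)} {w : F} (hw : w ^ 2 + w + 1 = 0) (hσ : σ w = w)
    (P : EPoint n F) : σ • sqrtNegThree w hw P = sqrtNegThree w hw (σ • P) := by
  rw [smul_eq_map, smul_eq_map]
  exact map_sqrtNegThree _ hw hw hσ P

theorem smul_sqrtNegThree_of_conj {σ : Gal(F/L)} {w : F} (hw : w ^ 2 + w + 1 = 0)
    (hσ : σ w = w ^ 2) (P : EPoint n F) :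
    σ • sqrtNegThree w hw P = -sqrtNegThree w hw (σ • P) := by
  rw [smul_eq_map, smul_eq_map]
  exact map_sqrtNegThree_of_conj _ hw hw hσ P

end Galois

/-! ### Points of `ker √-3` attached to cube roots -/

section KummerPoint

variable {n : ℚ} [NeZero n] {F : Type*} [Field F] [Algebra ℚ F] [DecidableEq F]

/-- `θ' / θ` is a cube root of unity, and `T` corresponds to it under `μ₃ ≅ ker √-3`. For `θ' = σ θ`
this says that `T` is the value at `σ` of the Kummer cocycle of the class of `θ³`. -/
def IsKummerPoint (T : EPoint n F) (θ θ' : F) : Prop :=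
  ∃ z : F, z ^ 3 = 1 ∧ T = kernelPoint n z ∧ θ' = z * θ

theorem isKummerPoint_zero (θ : F) : IsKummerPoint (0 : EPoint n F) θ θ :=
  ⟨1, one_pow 3, kernelPoint_one.symm, (one_mul θ).symm⟩

theorem isKummerPoint_kernelPoint {θ θ' : F} (hθ : θ ≠ 0) (h : θ' ^ 3 = θ ^ 3) :
    IsKummerPoint (kernelPoint n (θ' / θ)) θ θ' :=
  ⟨θ' / θ, by rw [div_pow, h, div_self (pow_ne_zero 3 hθ)], rfl, (div_mul_cancel₀ _ hθ).symm⟩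

namespace IsKummerPoint

variable {T T' : EPoint n F} {θ θ' φ φ' : F}

theorem eq (h : IsKummerPoint T θ θ') (hθ : θ ≠ 0) (h' : IsKummerPoint T' θ θ') : T = T' := by
  obtain ⟨z, -, rfl, rfl⟩ := h
  obtain ⟨z', -, rfl, e⟩ := h'
  rw [mul_right_cancel₀ hθ e]

theorem cube_eq (h : IsKummerPoint T θ θ') : θ' ^ 3 = θ ^ 3 := by
  obtain ⟨z, hz, -, rfl⟩ := h
  rw [mul_pow, hz, one_mul]

theorem mul_eq_mul (h : IsKummerPoint T θ θ') (h' : IsKummerPoint T φ φ') : θ' * φ = φ' * θ := by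
  obtain ⟨z, hz, rfl, rfl⟩ := h
  obtain ⟨z', hz', e, rfl⟩ := h'
  rw [kernelPoint_injective hz hz' e]
  ring

theorem add (h : IsKummerPoint T θ θ') (h' : IsKummerPoint T' φ φ') :
    IsKummerPoint (T + T') (θ * φ) (θ' * φ') := by
  obtain ⟨z, hz, rfl, rfl⟩ := h
  obtain ⟨z', hz', rfl, rfl⟩ := h'
  exact ⟨z * z', by rw [mul_pow, hz, hz', one_mul], (kernelPoint_mul hz hz').symm, by ring⟩

theorem mul_right (h : IsKummerPoint T θ θ') (a : F) : IsKummerPoint T (θ * a) (θ' * a) := by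
  obtain ⟨z, hz, hT, rfl⟩ := h
  exact ⟨z, hz, hT, mul_assoc z θ a⟩

theorem nsmul (h : IsKummerPoint T θ θ') (m : ℕ) : IsKummerPoint (m • T) (θ ^ m) (θ' ^ m) := by
  induction m with
  | zero => simpa only [zero_smul, pow_zero] using isKummerPoint_zero 1
  | succ m ih => simpa only [succ_nsmul, pow_succ] using ih.add h

theorem map {F' : Type*} [Field F'] [Algebra ℚ F'] [DecidableEq F'] (ι : F →ₐ[ℚ] F')
    (h : IsKummerPoint T θ θ') :
    IsKummerPoint (Point.map (W' := cubeSumCurve n) ι T) (ι θ) (ι θ') := by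
  obtain ⟨z, hz, rfl, rfl⟩ := h
  exact ⟨ι z, map_cube_eq_one ι hz, map_kernelPoint ι hz, map_mul ι z θ⟩

end IsKummerPoint

variable {L : Type*} [Field L] [Algebra ℚ L] [Algebra L F] [IsScalarTower ℚ L F]

theorem isKummerPoint_smul_kernelPoint_sub {e : F} (he : e ^ 3 = 1) (σ : Gal(F/L)) :
    IsKummerPoint (σ • kernelPoint n e - kernelPoint n e) e (σ e) := by
  have hσe : σ e ^ 3 = 1 := by rw [← map_pow, he, map_one]
  refine ⟨σ e * e ^ 2, by rw [mul_pow, hσe, sq_cube_eq_one he, one_mul], ?_, ?_⟩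
  · rw [smul_kernelPoint σ he, kernelPoint_mul hσe (sq_cube_eq_one he), kernelPoint_sq he,
      sub_eq_add_neg]
  · linear_combination -σ e * he

theorem isKummerPoint_smul_cubicPoint_sub {θ r s : F} (hθ : θ ≠ 0)
    (e : (θ * r) ^ 3 + (θ ^ 2 * s) ^ 3 = algebraMap ℚ F n) {σ : Gal(F/L)}
    (hσ : σ θ ^ 3 = θ ^ 3) (hr : σ r = r) (hs : σ s = s) :
    IsKummerPoint (σ • cubicPoint _ _ e - cubicPoint _ _ e) θ (σ θ) := by
  obtain ⟨z, hz, -, hσθ⟩ := isKummerPoint_kernelPoint (n := n) hθ hσ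
  obtain ⟨_, hσe⟩ := smul_cubicPoint σ e
  refine ⟨z, hz, ?_, hσθ⟩
  rw [sub_eq_iff_eq_add', hσe, cubicPoint_add_kernelPoint hz, cubicPoint_inj, map_mul, map_mul,
    map_pow, hσθ, hr, hs]
  constructor <;> ring

theorem smul_div_eq_of_isKummerPoint {u v θ : F} (hθ : θ ≠ 0)
    (huv : u ^ 3 + v ^ 3 = algebraMap ℚ F n) {σ : Gal(F/L)}
    (h : IsKummerPoint (σ • cubicPoint u v huv - cubicPoint u v huv) θ (σ θ)) :
    σ (u / θ) = u / θ ∧ σ (v / θ ^ 2) = v / θ ^ 2 := by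
  obtain ⟨z, hz, e, hσθ⟩ := h
  have hz0 := ne_zero_of_cube_eq_one hz
  obtain ⟨_, hσ⟩ := smul_cubicPoint σ huv
  rw [sub_eq_iff_eq_add', hσ, cubicPoint_add_kernelPoint hz, cubicPoint_inj] at e
  rw [map_div₀, map_div₀, map_pow, e.1, e.2, hσθ]
  constructor <;> field_simp

end KummerPoint

/-! ### Infinite Galois theory -/

section InfiniteGalois

variable {k F : Type*} [Field k] [Field F] [Algebra k F]

theorem exists_algebraMap_of_fixed [IsGalois k F] {x : F} (h : ∀ σ : Gal(F/k), σ x = x) :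
    ∃ y : k, algebraMap k F y = x :=
  (InfiniteGalois.mem_bot_iff_fixed (k := k) x).mpr h

theorem apply_eq_self_of_mem_adjoin {S : Set F} {σ : Gal(F/k)} (hσ : ∀ y ∈ S, σ y = y) {x : F}
    (hx : x ∈ adjoin k S) : σ x = x :=
  adjoin_le_iff.mpr (show S ⊆ fixedField (Subgroup.zpowers σ) from fun y hy =>
    mem_fixedField_iff _ _ |>.mpr fun _ hτ =>
      (Subgroup.zpowers_le (H := MulAction.stabilizer Gal(F/k) y)).mpr (hσ y hy) hτ) hx
    ⟨σ, Subgroup.mem_zpowers σ⟩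

theorem exists_finset_of_mem_nhds_one {U : Set Gal(F/k)} (hU : U ∈ nhds 1) :
    ∃ S : Finset F, ∀ σ : Gal(F/k), (∀ x ∈ S, σ x = x) → σ ∈ U := by
  rw [krullTopology_mem_nhds_one_iff] at hU
  obtain ⟨E, hE, hEU⟩ := hU
  obtain ⟨S, rfl⟩ :=
    IntermediateField.essFiniteType_iff.mp (inferInstance : Algebra.EssFiniteType k E)
  exact ⟨S, fun σ hσ => hEU ((IntermediateField.mem_fixingSubgroup_iff _ _).mpr fun _ hx =>
    apply_eq_self_of_mem_adjoin hσ hx)⟩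

theorem apply_eq_or_of_sq_add {w : F} (hw : w ^ 2 + w + 1 = 0) (σ : Gal(F/k)) :
    σ w = w ∨ σ w = w ^ 2 := by
  have h := map_sq_add σ hw
  have h' : (σ w - w) * (σ w - w ^ 2) = 0 := by linear_combination h + (-σ w + w - 1) * hw
  simpa only [mul_eq_zero, sub_eq_zero] using h'

theorem mem_adjoin_of_fixed [IsGalois k F] {w x : F} (h : ∀ σ : Gal(F/k), σ w = w → σ x = x) :
    x ∈ k⟮w⟯ := by
  rw [← InfiniteGalois.fixedField_fixingSubgroup k⟮w⟯, mem_fixedField_iff]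
  exact fun σ hσ => h σ ((mem_fixingSubgroup_iff _ _).mp hσ w (mem_adjoin_simple_self k w))

theorem exists_eq_add_mul_of_mem_adjoin {w : F} (hw : w ^ 2 + w + 1 = 0) {x : F}
    (hx : x ∈ k⟮w⟯) : ∃ a b : k, x = algebraMap k F a + algebraMap k F b * w := by
  have hint : IsIntegral k w :=
    ⟨Polynomial.X ^ 2 + Polynomial.X + 1, by monicity!, by simpa using hw⟩
  rw [← mem_toSubalgebra, adjoin_simple_toSubalgebra_of_isAlgebraic hint.isAlgebraic] at hx
  induction hx using Algebra.adjoin_induction with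
  | mem x hx => exact ⟨0, 1, by simpa using hx⟩
  | algebraMap a => exact ⟨a, 0, by simp⟩
  | add x y _ _ hx hy =>
    obtain ⟨a, b, rfl⟩ := hx
    obtain ⟨c, d, rfl⟩ := hy
    exact ⟨a + c, b + d, by simp only [map_add]; ring⟩
  | mul x y _ _ hx hy =>
    obtain ⟨a, b, rfl⟩ := hx
    obtain ⟨c, d, rfl⟩ := hy
    refine ⟨a * c - b * d, a * d + b * c - b * d, ?_⟩
    simp only [map_add, map_sub, map_mul]
    linear_combination algebraMap k F b * algebraMap k F d * hw

end InfiniteGalois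

section Hilbert90

variable {k F : Type*} [Field k] [Field F] [Algebra k F]

theorem exists_lift_algHom [IsGalois k F] {E : IntermediateField k F} (φ : E →ₐ[k] F) :
    ∃ σ : Gal(F/k), ∀ x : E, σ x = φ x :=
  ⟨AlgEquiv.ofBijective (φ.liftNormal F) (Algebra.IsAlgebraic.algHom_bijective _),
    φ.liftNormal_commutes F⟩

/-- Over a finite extension `E` on which `f` is determined, `β` is the inverse of a nonzero value of
the Lagrange resolvent `∑ f(φ) φ` over the embeddings `φ : E → F`. -/
theorem hilbert90 [IsGalois k F] (f : Gal(F/k) → F) (hf : ∀ σ τ, f (σ * τ) = f σ * σ (f τ))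
    (hf0 : ∀ σ, f σ ≠ 0) (S : Finset F) (hS : ∀ σ : Gal(F/k), (∀ x ∈ S, σ x = x) → f σ = 1) :
    ∃ β : F, β ≠ 0 ∧ ∀ σ, σ β = f σ * β := by
  let E := IntermediateField.adjoin k (S : Set F)
  have : FiniteDimensional k E := IntermediateField.finiteDimensional_adjoin fun x _ =>
    Algebra.IsIntegral.isIntegral x
  have f_congr {σ τ : Gal(F/k)} (h : ∀ x : E, σ x = τ x) : f σ = f τ := by
    have h1 : f (τ⁻¹ * σ) = 1 := hS _ fun x hx =>
      (τ.symm_apply_eq).mpr (h ⟨x, IntermediateField.subset_adjoin k _ hx⟩)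
    rw [← mul_inv_cancel_left τ σ, hf, h1, map_one, mul_one]
  choose lift hlift using exists_lift_algHom (E := E) (F := F)
  have f_lift_comp (σ : Gal(F/k)) (φ : E →ₐ[k] F) :
      f (lift (σ.toAlgHom.comp φ)) = f σ * σ (f (lift φ)) := by
    rw [← hf]
    exact f_congr fun x => by
      rw [hlift, AlgEquiv.mul_apply, hlift]
      rfl
  let resolvent (x : E) : F := ∑ φ : E →ₐ[k] F, f (lift φ) * φ x
  obtain ⟨x, hx⟩ : ∃ x, resolvent x ≠ 0 := by
    by_contra! h
    have hli := Fintype.linearIndependent_iff.mp (linearIndependent_toLinearMap k E F)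
      (fun φ => f (lift φ)) (LinearMap.ext fun x => by
        simpa only [LinearMap.sum_apply, LinearMap.smul_apply, smul_eq_mul] using! h x)
    exact hf0 _ (hli E.val)
  refine ⟨(resolvent x)⁻¹, inv_ne_zero hx, fun σ => ?_⟩
  have hσ : f σ * σ (resolvent x) = resolvent x := by
    rw [map_sum, Finset.mul_sum]
    refine Fintype.sum_equiv (AlgEquiv.arrowCongr AlgEquiv.refl σ) _ _ fun φ => ?_
    rw [map_mul, ← mul_assoc, ← f_lift_comp]
    rfl
  rw [map_inv₀, eq_mul_inv_iff_mul_eq₀ hx, inv_mul_eq_iff_eq_mul₀ (by simpa using hx), mul_comm, hσ]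

end Hilbert90

/-! ### Descent along `√-3` -/

section Descent

/-- The curve `D r³ + D² s³ = N t³`, which is the covering of `E_N` attached to the class of `D`
in `L* / L*³`, has an `L`-point; the points with `t = 0` exist exactly when `D` is a cube. -/
def CoveringHasPoint {L : Type*} [Field L] (D N : L) : Prop :=
  (∃ r s : L, D * r ^ 3 + D ^ 2 * s ^ 3 = N) ∨ ∃ g : L, D = g ^ 3

variable {n : ℚ} [NeZero n] {L F : Type*} [Field L] [Field F] [Algebra ℚ L] [Algebra ℚ F]
  [Algebra L F] [IsScalarTower ℚ L F] [DecidableEq F] {θ : F} {D : L}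

theorem CoveringHasPoint.exists_point (hθ : θ ≠ 0) (hD : algebraMap L F D = θ ^ 3)
    (h : CoveringHasPoint D (algebraMap ℚ L n)) :
    ∃ P : EPoint n F, ∀ σ : Gal(F/L), IsKummerPoint (σ • P - P) θ (σ θ) := by
  rcases h with ⟨r, s, h⟩ | ⟨g, rfl⟩
  · have e : (θ * algebraMap L F r) ^ 3 + (θ ^ 2 * algebraMap L F s) ^ 3 = algebraMap ℚ F n := by
      rw [IsScalarTower.algebraMap_apply ℚ L F n, ← h]
      simp only [map_add, map_mul, map_pow, hD]
      ring
    exact ⟨cubicPoint _ _ e, fun σ => isKummerPoint_smul_cubicPoint_sub hθ e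
      (by rw [← map_pow, ← hD, AlgEquiv.commutes]) (σ.commutes r) (σ.commutes s)⟩
  · rw [map_pow] at hD
    have hg : algebraMap L F g ≠ 0 := fun h => hθ (by simpa [h] using hD.symm)
    refine ⟨kernelPoint n (θ / algebraMap L F g), fun σ => ?_⟩
    have he : (θ / algebraMap L F g) ^ 3 = 1 := by
      rw [div_pow, ← hD, div_self (pow_ne_zero 3 hg)]
    simpa only [map_div₀, AlgEquiv.commutes, div_mul_cancel₀ _ hg] using
      (isKummerPoint_smul_kernelPoint_sub (n := n) he σ).mul_right (algebraMap L F g)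

theorem exists_eq_cubicPoint_or_eq_cube [IsGalois L F] {w : F} (hw : w ^ 2 + w + 1 = 0)
    (hθ : θ ≠ 0) (hD : algebraMap L F D = θ ^ 3) {P : EPoint n F}
    (h : ∀ σ : Gal(F/L), IsKummerPoint (σ • P - P) θ (σ θ)) :
    (∃ r s : L, D * r ^ 3 + D ^ 2 * s ^ 3 = algebraMap ℚ L n ∧
      ∃ e, P = cubicPoint (θ * algebraMap L F r) (θ ^ 2 * algebraMap L F s) e) ∨
    ∃ g : L, D = g ^ 3 := by
  have hinj := (algebraMap L F).injective
  rcases exists_kernelPoint_or_cubicPoint hw P with ⟨e, he, rfl⟩ | ⟨u, v, huv, rfl⟩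
  · have he0 := ne_zero_of_cube_eq_one he
    obtain ⟨g, hg⟩ := exists_algebraMap_of_fixed (k := L) (x := θ / e) fun σ => by
      rw [map_div₀, div_eq_div_iff ((map_ne_zero σ).mpr he0) he0, mul_comm θ]
      exact (h σ).mul_eq_mul (isKummerPoint_smul_kernelPoint_sub he σ)
    exact .inr ⟨g, hinj (by rw [map_pow, hg, div_pow, he, div_one, hD])⟩
  · have hfix σ := smul_div_eq_of_isKummerPoint hθ huv (h σ)
    obtain ⟨r, hr⟩ := exists_algebraMap_of_fixed fun σ => (hfix σ).1
    obtain ⟨s, hs⟩ := exists_algebraMap_of_fixed fun σ => (hfix σ).2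
    have hu : u = θ * algebraMap L F r := by rw [hr, mul_div_cancel₀ u hθ]
    have hv : v = θ ^ 2 * algebraMap L F s := by rw [hs, mul_div_cancel₀ v (pow_ne_zero 2 hθ)]
    subst hu hv
    refine .inl ⟨r, s, hinj ?_, huv, rfl⟩
    simp only [map_add, map_mul, map_pow, hD, ← IsScalarTower.algebraMap_apply, ← huv]
    ring

theorem coveringHasPoint_of_isKummerPoint [IsGalois L F] {w : F} (hw : w ^ 2 + w + 1 = 0)
    (hθ : θ ≠ 0) (hD : algebraMap L F D = θ ^ 3) {P : EPoint n F}
    (h : ∀ σ : Gal(F/L), IsKummerPoint (σ • P - P) θ (σ θ)) :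
    CoveringHasPoint D (algebraMap ℚ L n) :=
  (exists_eq_cubicPoint_or_eq_cube hw hθ hD h).imp_left fun ⟨r, s, hrs, _⟩ => ⟨r, s, hrs⟩

theorem cube_class_of_isKummerPoint_of_three_zsmul_eq_zero [IsGalois L F] {w : F}
    (hw : w ^ 2 + w + 1 = 0) (hθ : θ ≠ 0) (hD : algebraMap L F D = θ ^ 3) {T : EPoint n F}
    (hT : (3 : ℤ) • T = 0) (h : ∀ σ : Gal(F/L), IsKummerPoint (σ • T - T) θ (σ θ)) :
    (∃ r : L, D * r ^ 3 = algebraMap ℚ L n) ∨ (∃ s : L, D ^ 2 * s ^ 3 = algebraMap ℚ L n) ∨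
      ∃ g : L, D = g ^ 3 := by
  rcases exists_eq_cubicPoint_or_eq_cube hw hθ hD h with ⟨r, s, hrs, e, rfl⟩ | hg
  · have hθ2 : θ ^ 2 ≠ 0 := pow_ne_zero 2 hθ
    rw [three_zsmul_cubicPoint_eq_zero_iff, mul_eq_zero_iff_left hθ, mul_eq_zero_iff_left hθ2,
      FaithfulSMul.algebraMap_eq_zero_iff, FaithfulSMul.algebraMap_eq_zero_iff] at hT
    rcases hT with rfl | rfl
    · exact .inr (.inl ⟨s, by simpa using hrs⟩)
    · exact .inl ⟨r, by simpa using hrs⟩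
  · exact .inr (.inr hg)

end Descent

/-! ### Cubes in finite fields -/

section FiniteField

theorem cube_coset_trichotomy {G : Type*} [CommGroup G] [IsCyclic G] {a b : G}
    (ha : ∀ y, y ^ 3 ≠ a) (hb : ∀ y, y ^ 3 ≠ b) (hab : ∀ y, a * y ^ 3 ≠ b) (x : G) :
    ∃ y, x = y ^ 3 ∨ x = a * y ^ 3 ∨ x = b * y ^ 3 := by
  obtain ⟨g, hg⟩ := IsCyclic.exists_generator (α := G)
  have eq_mul_cube {i j : ℤ} (h : 3 ∣ i - j) : g ^ i = g ^ j * (g ^ ((i - j) / 3)) ^ 3 := by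
    rw [← zpow_natCast, ← zpow_mul, ← zpow_add, Nat.cast_ofNat, Int.ediv_mul_cancel h,
      add_sub_cancel]
  obtain ⟨i, rfl⟩ := Subgroup.mem_zpowers_iff.mp (hg a)
  obtain ⟨j, rfl⟩ := Subgroup.mem_zpowers_iff.mp (hg b)
  obtain ⟨m, rfl⟩ := Subgroup.mem_zpowers_iff.mp (hg x)
  have hi : ¬ 3 ∣ i - 0 := fun h => ha _ (by rw [eq_mul_cube h, zpow_zero, one_mul])
  have hj : ¬ 3 ∣ j - 0 := fun h => hb _ (by rw [eq_mul_cube h, zpow_zero, one_mul])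
  have hij : ¬ 3 ∣ j - i := fun h => hab _ (eq_mul_cube h).symm
  rcases (by omega : 3 ∣ m - 0 ∨ 3 ∣ m - i ∨ 3 ∣ m - j) with h | h | h
  · exact ⟨_, .inl (by rw [eq_mul_cube h, zpow_zero, one_mul])⟩
  · exact ⟨_, .inr (.inl (eq_mul_cube h))⟩
  · exact ⟨_, .inr (.inr (eq_mul_cube h))⟩

variable {k : Type*} [Field k]

theorem exists_eq_cube_or_mul_cube [Finite k] {A B x : k} (hA : A ≠ 0) (hB : B ≠ 0)
    (hA3 : ∀ y, y ^ 3 ≠ A) (hB3 : ∀ y, y ^ 3 ≠ B) (hAB : ∀ y, A * y ^ 3 ≠ B) (hx : x ≠ 0) :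
    ∃ y, x = y ^ 3 ∨ x = A * y ^ 3 ∨ x = B * y ^ 3 := by
  lift A to kˣ using hA.isUnit
  lift B to kˣ using hB.isUnit
  lift x to kˣ using hx.isUnit
  obtain ⟨y, h⟩ := cube_coset_trichotomy (a := A) (b := B)
    (fun y h => hA3 y (by exact_mod_cast congrArg Units.val h))
    (fun y h => hB3 y (by exact_mod_cast congrArg Units.val h))
    (fun y h => hAB y (by exact_mod_cast congrArg Units.val h)) x
  exact ⟨y, by exact_mod_cast h⟩

theorem exists_cube_mul_one_add_eq [Finite k] {A B x : k} (hA : A ≠ 0) (hB : B ≠ 0)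
    (hA3 : ∀ y, y ^ 3 ≠ A) (hno : ∀ r s : k, r ^ 3 + A * s ^ 3 ≠ B) (hx : x ≠ 0) :
    ∃ c ≠ 0, c ^ 3 * (1 + A * x ^ 3) = 1 ∨ c ^ 3 * (1 + A * x ^ 3) = A * x ^ 3 := by
  have h0 : 1 + A * x ^ 3 ≠ 0 := fun h => hA3 (-x⁻¹) (by field_simp; linear_combination -h)
  obtain ⟨y, h⟩ := exists_eq_cube_or_mul_cube hA hB hA3 (fun y h => hno y 0 (by simpa using h))
    (fun y h => hno 0 y (by simpa using h)) h0
  have hy : y ≠ 0 := by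
    rintro rfl
    simp [h0] at h
  rcases h with h | h | h
  · exact ⟨y⁻¹, inv_ne_zero hy, .inl (by rw [h]; field_simp)⟩
  · exact ⟨x / y, div_ne_zero hx hy, .inr (by rw [h]; field_simp)⟩
  · refine absurd ?_ (hno y⁻¹ (x / y))
    field_simp
    linear_combination h

/-- If `A` is no cube and `B` is not represented, every nonzero cube `b` yields a nonzero cube `c`
that is `1 / (1 + A b)` or `A b / (1 + A b)`. The class of `1 - c` modulo cubes tells the two cases
apart, so `b ↦ c` is injective; but it misses `c = 1`. -/
theorem exists_cube_or_cube_add_mul_cube_eq [Finite k] {A B : k} (hA : A ≠ 0) (hB : B ≠ 0) :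
    (∃ g : k, g ^ 3 = A) ∨ ∃ r s : k, r ^ 3 + A * s ^ 3 = B := by
  by_contra! ⟨hA3, hno⟩
  let C := {b : k // ∃ x ≠ 0, b = x ^ 3}
  have hC (b : C) : ∃ c : C, c.1 * (1 + A * b.1) = 1 ∨ c.1 * (1 + A * b.1) = A * b.1 := by
    obtain ⟨_, x, hx, rfl⟩ := b
    obtain ⟨c, hc, h⟩ := exists_cube_mul_one_add_eq hA hB hA3 hno hx
    exact ⟨⟨c ^ 3, c, hc, rfl⟩, h⟩
  have ne_zero (b : C) : b.1 ≠ 0 := by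
    obtain ⟨_, x, hx, rfl⟩ := b
    exact pow_ne_zero 3 hx
  choose f hf using hC
  have not_both {b b' c : C} (h : c.1 * (1 + A * b.1) = 1)
      (h' : c.1 * (1 + A * b'.1) = A * b'.1) : False := by
    have key : A ^ 2 * (b.1 * b'.1) = 1 := mul_left_cancel₀ (ne_zero c) (by
      linear_combination A * b'.1 * h - h')
    obtain ⟨x, -, hx⟩ := b.2
    obtain ⟨y, -, hy⟩ := b'.2
    rw [hx, hy] at key
    exact hA3 (A * x * y) (by linear_combination A * key)
  have f_inj : Function.Injective f := by
    intro b b' e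
    have hb := hf b
    rw [e] at hb
    refine Subtype.ext (mul_left_cancel₀ hA (mul_left_cancel₀ (ne_zero (f b')) ?_))
    rcases hb with h | h <;> rcases hf b' with h' | h'
    · linear_combination h - h'
    · exact (not_both h h').elim
    · exact (not_both h' h).elim
    · have hc : 1 - (f b').1 ≠ 0 := fun h1 => by
        have : (f b').1 = 1 := by linear_combination -h1
        rw [this] at h
        simp at h
      refine mul_left_cancel₀ hc ?_
      linear_combination (f b').1 * (h' - h)
  obtain ⟨b, hb⟩ := (Finite.injective_iff_surjective.mp f_inj) ⟨1, 1, one_ne_zero, by simp⟩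
  have := hf b
  simp [hb, hA, ne_zero b] at this

theorem orderOf_dvd_natCard_sub_one [Finite k] {z : k} (hz : z ≠ 0) :
    orderOf z ∣ Nat.card k - 1 := by
  lift z to kˣ using hz.isUnit
  rw [orderOf_units, ← Nat.card_units]
  exact orderOf_dvd_natCard z

theorem exists_sq_add_eq_zero [Finite k] (h : 3 ∣ Nat.card k - 1) : ∃ w : k, w ^ 2 + w + 1 = 0 := by
  obtain ⟨w, hw⟩ := exists_prime_orderOf_dvd_card' (G := kˣ) 3 (by rwa [Nat.card_units])
  refine ⟨w, sq_add_of_cube_eq_one ?_ ?_⟩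
  · rw [← hw, ← Units.val_pow_eq_pow_val, pow_orderOf_eq_one, Units.val_one]
  · rw [Ne, Units.val_eq_one, ← orderOf_eq_one_iff, hw]
    norm_num

theorem orderOf_eq_three_of_sq_add (h3 : (3 : k) ≠ 0) {w : k} (hw : w ^ 2 + w + 1 = 0) :
    orderOf w = 3 :=
  orderOf_eq_prime (cube_eq_one_of_sq_add hw) (ne_one_of_sq_add h3 hw)

theorem sq_add_ne_zero [Finite k] (h : ¬ 3 ∣ Nat.card k - 1) (h3 : (3 : k) ≠ 0) (w : k) :
    w ^ 2 + w + 1 ≠ 0 := fun hw => h <| by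
  rw [← orderOf_eq_three_of_sq_add h3 hw]
  exact orderOf_dvd_natCard_sub_one (ne_zero_of_cube_eq_one (cube_eq_one_of_sq_add hw))

theorem cube_ne_of_sq_add [Finite k] (h : ¬ 9 ∣ Nat.card k - 1) (h3 : (3 : k) ≠ 0) {w : k}
    (hw : w ^ 2 + w + 1 = 0) (z : k) : z ^ 3 ≠ w := by
  rintro rfl
  have hz : (z ^ 3) ^ 3 = 1 := cube_eq_one_of_sq_add hw
  have hz9 : orderOf z = 3 ^ (1 + 1) :=
    orderOf_eq_prime_pow (by simpa using ne_one_of_sq_add h3 hw) (by rw [← hz]; ring)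
  have hz0 : z ≠ 0 := by
    rintro rfl
    simp at hz
  have hdvd := orderOf_dvd_natCard_sub_one hz0
  rw [hz9] at hdvd
  exact h hdvd

theorem eq_zero_of_cube_add_mul_cube {w R S : k} (hw : ∀ z, z ^ 3 ≠ w)
    (h : R ^ 3 + w * S ^ 3 = 0) : R = 0 ∧ S = 0 := by
  obtain rfl : S = 0 := by
    by_contra hS
    exact hw (-R / S) (by field_simp; linear_combination -h)
  simpa using h

theorem eq_zero_of_add_mul_eq_zero {K : Type*} [Field K] [Algebra k K]
    (hk : ∀ t : k, t ^ 2 + t + 1 ≠ 0) {w : K} (hw : w ^ 2 + w + 1 = 0) {a b : k}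
    (h : algebraMap k K a + algebraMap k K b * w = 0) : a = 0 ∧ b = 0 := by
  obtain rfl : b = 0 := by
    by_contra hb
    have hw' : w = algebraMap k K (-a / b) := by
      rw [map_div₀, map_neg, eq_div_iff (by simpa using hb)]
      linear_combination h
    rw [hw'] at hw
    exact hk (-a / b) ((algebraMap k K).injective (by simpa using hw))
  simpa using h

end FiniteField

/-! ### The cubic form of the covering attached to a cube root of unity -/

section CubicForm

variable {R S : Type*} [CommRing R] [CommRing S]

/-- The first coordinate of `(v₀ + v₁ w) ^ 3 + w (v₂ + v₃ w) ^ 3` with respect to the basis `1, w`,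
where `w ^ 2 + w + 1 = 0`. -/
def cubicFormFst (v : Fin 4 → R) : R :=
  v 0 ^ 3 + v 1 ^ 3 - 3 * v 0 * v 1 ^ 2 - 3 * v 2 * v 3 * (v 2 - v 3)

/-- The second coordinate of `(v₀ + v₁ w) ^ 3 + w (v₂ + v₃ w) ^ 3` with respect to the basis `1, w`,
where `w ^ 2 + w + 1 = 0`. -/
def cubicFormSnd (v : Fin 4 → R) : R :=
  3 * v 0 * v 1 * (v 0 - v 1) + (v 2 ^ 3 + v 3 ^ 3 - 3 * v 2 * v 3 ^ 2) -
    3 * v 2 * v 3 * (v 2 - v 3)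

theorem cube_add_mul_cube_eq_cubicForm {w : R} (hw : w ^ 2 + w + 1 = 0) (v : Fin 4 → R) :
    (v 0 + v 1 * w) ^ 3 + w * (v 2 + v 3 * w) ^ 3 = cubicFormFst v + cubicFormSnd v * w := by
  unfold cubicFormFst cubicFormSnd
  grind

theorem map_cubicFormFst (f : R →+* S) (v : Fin 4 → R) :
    f (cubicFormFst v) = cubicFormFst fun i => f (v i) := by
  simp [cubicFormFst, map_ofNat]

theorem map_cubicFormSnd (f : R →+* S) (v : Fin 4 → R) :
    f (cubicFormSnd v) = cubicFormSnd fun i => f (v i) := by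
  simp [cubicFormSnd, map_ofNat]

theorem cubicFormFst_mul (x : R) (v : Fin 4 → R) :
    cubicFormFst (fun i => x * v i) = x ^ 3 * cubicFormFst v := by
  unfold cubicFormFst
  ring

theorem cubicFormSnd_mul (x : R) (v : Fin 4 → R) :
    cubicFormSnd (fun i => x * v i) = x ^ 3 * cubicFormSnd v := by
  unfold cubicFormSnd
  ring

theorem zmod_three_ne_zero {ℓ : ℕ} [Fact ℓ.Prime] (hℓ : ℓ ≠ 3) : (3 : ZMod ℓ) ≠ 0 := by
  rw [← Nat.cast_ofNat, Ne, ZMod.natCast_eq_zero_iff, Nat.prime_dvd_prime_iff_eq Fact.out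
    Nat.prime_three]
  exact hℓ

theorem eq_zero_of_cubicForm_eq_zero {p : ℕ} [Fact p.Prime] (hmod : p % 9 = 2 ∨ p % 9 = 5)
    {v : Fin 4 → ZMod p} (hfst : cubicFormFst v = 0) (hsnd : cubicFormSnd v = 0) : v = 0 := by
  have hp2 : p ^ 2 % 9 = 4 ∨ p ^ 2 % 9 = 7 := by
    rcases hmod with h | h <;> simp [Nat.pow_mod, h]
  let K := GaloisField p 2
  have hcard : Nat.card K = p ^ 2 := GaloisField.card p 2 two_ne_zero
  have : Finite K := Nat.finite_of_card_ne_zero (by omega)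
  have h3 : (3 : ZMod p) ≠ 0 := zmod_three_ne_zero (by rintro rfl; simp at hmod)
  have h3K : (3 : K) ≠ 0 := by
    rwa [← map_ofNat (algebraMap (ZMod p) K) 3, map_ne_zero]
  obtain ⟨w, hw⟩ := exists_sq_add_eq_zero (k := K) (by omega)
  have key := cube_add_mul_cube_eq_cubicForm hw fun i => algebraMap _ K (v i)
  rw [← map_cubicFormFst, ← map_cubicFormSnd, hfst, hsnd, map_zero, zero_mul, add_zero] at key
  obtain ⟨hR, hS⟩ := eq_zero_of_cube_add_mul_cube (cube_ne_of_sq_add (by omega) h3K hw) key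
  have hk := sq_add_ne_zero (k := ZMod p) (by rw [Nat.card_zmod]; omega) h3
  obtain ⟨h0, h1⟩ := eq_zero_of_add_mul_eq_zero hk hw hR
  obtain ⟨h2, h3⟩ := eq_zero_of_add_mul_eq_zero hk hw hS
  ext i
  fin_cases i <;> assumption

end CubicForm

/-! ### Coverings over the `p`-adic numbers -/

section Padic

variable {ℓ : ℕ} [Fact ℓ.Prime]

theorem toZMod_eq_zero_iff {x : ℤ_[ℓ]} : PadicInt.toZMod x = 0 ↔ ‖x‖ < 1 := by
  rw [← RingHom.mem_ker, PadicInt.ker_toZMod, IsLocalRing.mem_maximalIdeal, PadicInt.mem_nonunits]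

theorem exists_padicInt_eq_mul {ι : Type*} [Finite ι] {a : ι → ℚ_[ℓ]} (h : ∃ i, a i ≠ 0) :
    ∃ x ≠ 0, ∃ b : ι → ℤ_[ℓ], (∀ i, (b i : ℚ_[ℓ]) = x * a i) ∧ ∃ i, b i = 1 := by
  obtain ⟨j, hj⟩ := h
  have : Nonempty ι := ⟨j⟩
  obtain ⟨i, hi⟩ := Finite.exists_max fun i => ‖a i‖
  have h0 : a i ≠ 0 := norm_pos_iff.mp ((norm_pos_iff.mpr hj).trans_le (hi j))
  have hle (k : ι) : ‖(a i)⁻¹ * a k‖ ≤ 1 := by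
    rw [norm_mul, norm_inv, inv_mul_le_one₀ (norm_pos_iff.mpr h0)]
    exact hi k
  exact ⟨(a i)⁻¹, inv_ne_zero h0, fun k => ⟨_, hle k⟩, fun k => rfl, i,
    PadicInt.ext (inv_mul_cancel₀ h0)⟩

theorem padic_norm_eq_iff {x y : ℚ_[ℓ]} (hx : x ≠ 0) (hy : y ≠ 0) :
    ‖x‖ = ‖y‖ ↔ x.valuation = y.valuation := by
  have h1 : (1 : ℝ) < ℓ := by exact_mod_cast (Fact.out : ℓ.Prime).one_lt
  rw [Padic.norm_eq_zpow_neg_valuation hx, Padic.norm_eq_zpow_neg_valuation hy,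
    zpow_right_inj₀ (by positivity) h1.ne', neg_inj]

theorem padic_valuation_eq_or_of_add_eq {x y z : ℚ_[ℓ]} (hx : x ≠ 0) (hy : y ≠ 0) (hz : z ≠ 0)
    (h : x + y = z) :
    x.valuation = y.valuation ∨ x.valuation = z.valuation ∨ y.valuation = z.valuation := by
  rw [← padic_norm_eq_iff hx hy, ← padic_norm_eq_iff hx hz, ← padic_norm_eq_iff hy hz]
  by_cases hxy : ‖x‖ = ‖y‖
  · exact .inl hxy
  · rw [← h, Padic.add_eq_max_of_ne hxy]
    exact .inr ((max_choice ‖x‖ ‖y‖).imp Eq.symm Eq.symm)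

theorem padic_valuation_mul_cube {x y : ℚ_[ℓ]} (hx : x ≠ 0) (hy : y ≠ 0) :
    (x * y ^ 3).valuation = x.valuation + 3 * y.valuation := by
  rw [Padic.valuation_mul hx (pow_ne_zero 3 hy), Padic.valuation_pow, Nat.cast_ofNat]

theorem three_dvd_valuation_of_coveringHasPoint {D N : ℚ_[ℓ]} (hD : D ≠ 0) (hN : N ≠ 0)
    (hN3 : 3 ∣ N.valuation) (h : CoveringHasPoint D N) : 3 ∣ D.valuation := by
  have hD2 : (D ^ 2).valuation = 2 * D.valuation := by rw [Padic.valuation_pow, Nat.cast_ofNat]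
  obtain ⟨r, s, h⟩ | ⟨g, rfl⟩ := h
  · have hr_val (hr : r ≠ 0) := padic_valuation_mul_cube hD hr
    have hs_val (hs : s ≠ 0) := padic_valuation_mul_cube (pow_ne_zero 2 hD) hs
    rcases eq_or_ne r 0 with rfl | hr <;> rcases eq_or_ne s 0 with rfl | hs
    · simp [hN.symm] at h
    · replace h := congrArg Padic.valuation h
      rw [zero_pow three_ne_zero, mul_zero, zero_add, hs_val hs] at h
      omega
    · replace h := congrArg Padic.valuation h
      rw [zero_pow three_ne_zero, mul_zero, add_zero, hr_val hr] at h
      omega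
    · have := padic_valuation_eq_or_of_add_eq (mul_ne_zero hD (pow_ne_zero 3 hr))
        (mul_ne_zero (pow_ne_zero 2 hD) (pow_ne_zero 3 hs)) hN h
      rw [hr_val hr, hs_val hs] at this
      omega
  · rw [Padic.valuation_pow, Nat.cast_ofNat]
    exact dvd_mul_right _ _

theorem norm_cube_mul_ne_one {x M : ℚ_[ℓ]} (hx : x ≠ 0) (hM : M = 0 ∨ ¬ 3 ∣ M.valuation) :
    ‖x ^ 3 * M‖ ≠ 1 := by
  rcases eq_or_ne M 0 with rfl | hM0
  · simp
  · rw [← norm_one (α := ℚ_[ℓ]), Ne, padic_norm_eq_iff (mul_ne_zero (pow_ne_zero 3 hx) hM0)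
      one_ne_zero, mul_comm, padic_valuation_mul_cube hM0 hx, Padic.valuation_one]
    have := hM.resolve_left hM0
    omega

theorem cubicForm_ne {p : ℕ} [Fact p.Prime] (hmod : p % 9 = 2 ∨ p % 9 = 5) {v : Fin 4 → ℚ_[p]}
    (hv : v ≠ 0) {M : ℚ_[p]} (hM : M = 0 ∨ ¬ 3 ∣ M.valuation) (hfst : cubicFormFst v = M) :
    cubicFormSnd v ≠ M := by
  intro hsnd
  obtain ⟨x, hx, V, hV, i, hi⟩ := exists_padicInt_eq_mul (Function.ne_iff.mp hv)
  have reduction_eq_zero {y : ℤ_[p]} (hy : (y : ℚ_[p]) = x ^ 3 * M) : PadicInt.toZMod y = 0 := by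
    rw [toZMod_eq_zero_iff]
    refine lt_of_le_of_ne (PadicInt.norm_le_one y) ?_
    rw [PadicInt.norm_def, hy]
    exact norm_cube_mul_ne_one hx hM
  have hfst' : PadicInt.toZMod (cubicFormFst V) = 0 := reduction_eq_zero <| by
    rw [← hfst, ← cubicFormFst_mul, ← funext hV]
    exact map_cubicFormFst PadicInt.Coe.ringHom V
  have hsnd' : PadicInt.toZMod (cubicFormSnd V) = 0 := reduction_eq_zero <| by
    rw [← hsnd, ← cubicFormSnd_mul, ← funext hV]
    exact map_cubicFormSnd PadicInt.Coe.ringHom V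
  rw [map_cubicFormFst] at hfst'
  rw [map_cubicFormSnd] at hsnd'
  have := congrFun (eq_zero_of_cubicForm_eq_zero hmod hfst' hsnd') i
  simp [hi] at this

theorem padic_sq_add_ne_zero (hℓ : ℓ % 3 = 2) (t : ℚ_[ℓ]) : t ^ 2 + t + 1 ≠ 0 := by
  intro ht
  have ht1 : ‖t‖ ≤ 1 := by
    rw [← pow_le_one_iff_of_nonneg (norm_nonneg t) three_ne_zero, ← norm_pow,
      cube_eq_one_of_sq_add ht, norm_one]
  let T : ℤ_[ℓ] := ⟨t, ht1⟩
  have hT : T ^ 2 + T + 1 = 0 := PadicInt.ext ht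
  exact sq_add_ne_zero (by rw [Nat.card_zmod]; omega)
    (zmod_three_ne_zero (by rintro rfl; simp at hℓ)) _ (map_sq_add PadicInt.toZMod hT)

section Quadratic

variable {p : ℕ} [Fact p.Prime] {K : Type*} [Field K] [Algebra ℚ_[p] K] {η : K}

theorem cube_add_mul_cube_ne (hmod : p % 9 = 2 ∨ p % 9 = 5) (hη : η ^ 2 + η + 1 = 0)
    (hK : ∀ x : K, ∃ a b : ℚ_[p], x = algebraMap _ K a + algebraMap _ K b * η) {r s : K}
    (hrs : r ≠ 0 ∨ s ≠ 0) {M : ℚ_[p]} (hM : M = 0 ∨ ¬ 3 ∣ M.valuation) :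
    r ^ 3 + η * s ^ 3 ≠ algebraMap _ K M * (1 + η) := by
  intro h
  obtain ⟨a, b, rfl⟩ := hK r
  obtain ⟨c, d, rfl⟩ := hK s
  let v := ![a, b, c, d]
  have key : (algebraMap _ K a + algebraMap _ K b * η) ^ 3 +
      η * (algebraMap _ K c + algebraMap _ K d * η) ^ 3 =
        algebraMap _ K (cubicFormFst v) + algebraMap _ K (cubicFormSnd v) * η := by
    rw [map_cubicFormFst, map_cubicFormSnd, ← cube_add_mul_cube_eq_cubicForm hη]
    rfl
  obtain ⟨hfst, hsnd⟩ := eq_zero_of_add_mul_eq_zero (a := cubicFormFst v - M)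
    (b := cubicFormSnd v - M) (padic_sq_add_ne_zero (by omega)) hη (by
      rw [map_sub, map_sub]
      linear_combination h - key)
  have hv : v ≠ 0 := by
    intro h0
    obtain ⟨rfl, rfl, rfl, rfl⟩ : a = 0 ∧ b = 0 ∧ c = 0 ∧ d = 0 :=
      ⟨congrFun h0 0, congrFun h0 1, congrFun h0 2, congrFun h0 3⟩
    simp at hrs
  exact cubicForm_ne hmod hv hM (sub_eq_zero.mp hfst) (sub_eq_zero.mp hsnd)

theorem not_coveringHasPoint_of_sq_add (hmod : p % 9 = 2 ∨ p % 9 = 5) (hη : η ^ 2 + η + 1 = 0)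
    (hK : ∀ x : K, ∃ a b : ℚ_[p], x = algebraMap _ K a + algebraMap _ K b * η) {N : ℚ_[p]}
    (hN : ¬ 3 ∣ N.valuation) : ¬ CoveringHasPoint η (algebraMap _ K N) := by
  rintro (⟨r, s, h⟩ | ⟨g, hg⟩)
  · refine cube_add_mul_cube_ne hmod hη hK (r := -r) (s := -s) ?_ (.inr hN) ?_
    · by_contra! ⟨hr, hs⟩
      have : N = 0 := by simpa [neg_eq_zero.mp hr, neg_eq_zero.mp hs] using h.symm
      simp [this] at hN
    · have hη3 := cube_eq_one_of_sq_add hη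
      linear_combination -η ^ 2 * h + r ^ 3 * hη3 + η * s ^ 3 * hη3 - algebraMap _ K N * hη
  · refine cube_add_mul_cube_ne hmod hη hK (r := g) (s := -1) (M := 0) (by simp) (.inl rfl) ?_
    rw [map_zero]
    linear_combination -hg

end Quadratic

theorem cube_ne_mul_cube_zmod_nine {m x y : ZMod 9} (hm : m = 2 ∨ m = 4 ∨ m = 5 ∨ m = 7)
    (h : x ^ 3 = m * y ^ 3) : x ≠ 1 ∧ y ≠ 1 := by
  decide +revert

theorem zmod_nine_natCast {N : ℕ} (hN : N % 9 = 2 ∨ N % 9 = 4 ∨ N % 9 = 5 ∨ N % 9 = 7) :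
    (N : ZMod 9) = 2 ∨ (N : ZMod 9) = 4 ∨ (N : ZMod 9) = 5 ∨ (N : ZMod 9) = 7 := by
  rw [← ZMod.natCast_mod]
  rcases hN with h | h | h | h <;> simp [h]

theorem padicInt_coe_ofNat (n : ℕ) [n.AtLeastTwo] : ((ofNat(n) : ℤ_[ℓ]) : ℚ_[ℓ]) = ofNat(n) :=
  map_ofNat PadicInt.Coe.ringHom n

theorem ne_one_of_cube_add_three_mul_cube_eq {N : ℕ}
    (hN : N % 9 = 2 ∨ N % 9 = 4 ∨ N % 9 = 5 ∨ N % 9 = 7) {a b c : ℤ_[3]}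
    (h : a ^ 3 + 3 * b ^ 3 = 3 * N * c ^ 3) : a ≠ 1 ∧ b ≠ 1 ∧ c ≠ 1 := by
  have h3 : Prime (3 : ℤ_[3]) := mod_cast PadicInt.prime_p (p := 3)
  have ha : 3 ∣ a ^ 3 := ⟨N * c ^ 3 - b ^ 3, by linear_combination h⟩
  obtain ⟨a', rfl⟩ := h3.dvd_of_dvd_pow ha
  have hdiv : 9 * a' ^ 3 + b ^ 3 = N * c ^ 3 := mul_left_cancel₀ h3.ne_zero <| by
    linear_combination h
  have hmod9 : PadicInt.toZModPow 2 b ^ 3 = (N : ZMod 9) * PadicInt.toZModPow 2 c ^ 3 := by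
    have := congrArg (PadicInt.toZModPow 2) hdiv
    simp only [map_add, map_mul, map_pow, map_natCast, map_ofNat] at this
    rwa [show (9 : ZMod (3 ^ 2)) = 0 from rfl, zero_mul, zero_add] at this
  obtain ⟨hb, hc⟩ := cube_ne_mul_cube_zmod_nine (zmod_nine_natCast hN) hmod9
  refine ⟨fun h => h3.not_dvd_one ⟨a', h.symm⟩, ?_, ?_⟩
  · rintro rfl
    exact hb (map_one _)
  · rintro rfl
    exact hc (map_one _)

theorem not_coveringHasPoint_three_nine_mul {N : ℕ}
    (hN : N % 9 = 2 ∨ N % 9 = 4 ∨ N % 9 = 5 ∨ N % 9 = 7) :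
    ¬ CoveringHasPoint (3 : ℚ_[3]) (9 * N) := by
  rintro (⟨r, s, h⟩ | ⟨g, hg⟩)
  · obtain ⟨x, -, v, hv, i, hi⟩ := exists_padicInt_eq_mul (a := ![r, s, 1]) ⟨2, by simp⟩
    have hv0 : (v 0 : ℚ_[3]) = x * r := hv 0
    have hv1 : (v 1 : ℚ_[3]) = x * s := hv 1
    have hv2 : (v 2 : ℚ_[3]) = x := (hv 2).trans (mul_one x)
    have heq : v 0 ^ 3 + 3 * v 1 ^ 3 = 3 * N * v 2 ^ 3 := PadicInt.ext <| by
      push_cast [hv0, hv1, hv2, padicInt_coe_ofNat]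
      linear_combination x ^ 3 / 3 * h
    obtain ⟨h0, h1, h2⟩ := ne_one_of_cube_add_three_mul_cube_eq hN heq
    fin_cases i
    exacts [h0 hi, h1 hi, h2 hi]
  · have h3 : (3 : ℚ_[3]).valuation = 1 := mod_cast Padic.valuation_p (p := 3)
    rw [hg, Padic.valuation_pow] at h3
    omega

theorem exists_cube_eq_of_norm_sub_lt {a x : ℤ_[ℓ]} (h : ‖a ^ 3 - x‖ < ‖3 * a ^ 2‖ ^ 2) :
    ∃ z : ℤ_[ℓ], z ^ 3 = x ∧ ‖z - a‖ < ‖3 * a ^ 2‖ := by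
  let F : Polynomial ℤ_[ℓ] := Polynomial.X ^ 3 - Polynomial.C x
  have hF (b : ℤ_[ℓ]) : F.aeval b = b ^ 3 - x := by simp [F]
  have hF' : F.derivative.aeval a = 3 * a ^ 2 := by
    simp [F, show (2 : ℤ_[ℓ]) + 1 = 3 by norm_num]
  obtain ⟨z, hz, hza, -⟩ := hensels_lemma (F := F) (a := a) (by rwa [hF, hF'])
  exact ⟨z, sub_eq_zero.mp (by rw [← hF, hz]), by rwa [← hF']⟩

theorem norm_eq_one_of_toZMod_ne_zero {x : ℤ_[ℓ]} (hx : PadicInt.toZMod x ≠ 0) : ‖x‖ = 1 :=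
  (PadicInt.norm_le_one x).antisymm (not_lt.mp (mt toZMod_eq_zero_iff.mpr hx))

theorem exists_cube_eq_of_toZMod_eq (hℓ : ℓ ≠ 3) {x : ℤ_[ℓ]} {y : ZMod ℓ} (hy : y ≠ 0)
    (h : PadicInt.toZMod x = y ^ 3) : ∃ z : ℤ_[ℓ], z ^ 3 = x ∧ PadicInt.toZMod z = y := by
  obtain ⟨a, rfl⟩ := ZMod.ringHom_surjective (PadicInt.toZMod : ℤ_[ℓ] →+* ZMod ℓ) y
  have h3 : PadicInt.toZMod (3 : ℤ_[ℓ]) ≠ 0 := by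
    rw [map_ofNat]
    exact zmod_three_ne_zero hℓ
  have hnorm : ‖3 * a ^ 2‖ = 1 := by
    rw [norm_mul, norm_pow, norm_eq_one_of_toZMod_ne_zero h3, norm_eq_one_of_toZMod_ne_zero hy,
      one_pow, one_mul]
  obtain ⟨z, hz, hza⟩ := exists_cube_eq_of_norm_sub_lt (a := a) (x := x) <| by
    rw [hnorm, one_pow, ← toZMod_eq_zero_iff, map_sub, map_pow, h, sub_self]
  rw [hnorm, ← toZMod_eq_zero_iff, map_sub, sub_eq_zero] at hza
  exact ⟨z, hz, hza⟩

theorem exists_cube_eq_one_add_nine_mul (t : ℤ_[3]) : ∃ z : ℤ_[3], z ^ 3 = 1 + 9 * t := by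
  have h3 : ‖(3 : ℤ_[3])‖ = 3⁻¹ := mod_cast PadicInt.norm_p (p := 3)
  have ha : ‖1 + 3 * t‖ = 1 := norm_eq_one_of_toZMod_ne_zero <| by
    rw [map_add, map_one, map_mul, map_ofNat, show (3 : ZMod 3) = 0 from rfl, zero_mul, add_zero]
    exact one_ne_zero
  have hsub : (1 + 3 * t) ^ 3 - (1 + 9 * t) = 3 ^ 3 * (t ^ 2 + t ^ 3) := by ring
  obtain ⟨z, hz, -⟩ := exists_cube_eq_of_norm_sub_lt (a := 1 + 3 * t) (x := 1 + 9 * t) <| by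
    calc ‖(1 + 3 * t) ^ 3 - (1 + 9 * t)‖ ≤ 3⁻¹ ^ 3 * 1 := by
          rw [hsub, norm_mul, norm_pow, h3]
          gcongr
          exact PadicInt.norm_le_one _
      _ < ‖3 * (1 + 3 * t) ^ 2‖ ^ 2 := by
          rw [norm_mul, norm_pow, h3, ha]
          norm_num
  exact ⟨z, hz⟩

theorem exists_padic_sq_add_eq_zero (hℓ : ℓ % 3 = 1) : ∃ t : ℚ_[ℓ], t ^ 2 + t + 1 = 0 := by
  have hℓ3 : ℓ ≠ 3 := by
    rintro rfl
    simp at hℓ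
  obtain ⟨w, hw⟩ := exists_sq_add_eq_zero (k := ZMod ℓ) (by rw [Nat.card_zmod]; omega)
  have hw3 := cube_eq_one_of_sq_add hw
  obtain ⟨z, hz, rfl⟩ := exists_cube_eq_of_toZMod_eq hℓ3 (x := 1) (ne_zero_of_cube_eq_one hw3)
    (by rw [map_one, hw3])
  refine ⟨z, sq_add_of_cube_eq_one (by exact_mod_cast congrArg ((↑) : ℤ_[ℓ] → ℚ_[ℓ]) hz) ?_⟩
  intro hz1
  obtain rfl : z = 1 := PadicInt.ext hz1
  exact ne_one_of_sq_add (zmod_three_ne_zero hℓ3) hw (map_one _)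

theorem coveringHasPoint_mul_of_toZMod_ne_zero (hℓ : ℓ ≠ 3) {D N : ℤ_[ℓ]}
    (hD : PadicInt.toZMod D ≠ 0) (hN : PadicInt.toZMod N ≠ 0) :
    CoveringHasPoint (D : ℚ_[ℓ]) (D * N) := by
  have hD0 : (D : ℚ_[ℓ]) ≠ 0 := fun h => hD (by rw [PadicInt.ext (y := 0) h, map_zero])
  rcases exists_cube_or_cube_add_mul_cube_eq hD hN with ⟨g, hg⟩ | ⟨r, s, hrs⟩
  · obtain ⟨z, rfl, -⟩ := exists_cube_eq_of_toZMod_eq hℓ (y := g)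
      (by rintro rfl; simp [hg.symm] at hD) hg.symm
    exact .inr ⟨z, PadicInt.coe_pow z 3⟩
  obtain ⟨R, rfl⟩ := ZMod.ringHom_surjective (PadicInt.toZMod : ℤ_[ℓ] →+* ZMod ℓ) r
  obtain ⟨S, rfl⟩ := ZMod.ringHom_surjective (PadicInt.toZMod : ℤ_[ℓ] →+* ZMod ℓ) s
  left
  by_cases hR : PadicInt.toZMod R = 0
  · rw [hR] at hrs
    obtain ⟨z, hz, -⟩ := exists_cube_eq_of_toZMod_eq hℓ (x := N * D ^ 2)
      (y := PadicInt.toZMod (D * S)) (fun h0 => hN <| by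
        have hS := (mul_eq_zero.mp (map_mul PadicInt.toZMod D S ▸ h0)).resolve_left hD
        rw [← hrs, hS]
        ring) (by
        simp only [map_mul, map_pow, ← hrs]
        ring)
    refine ⟨0, z / D, ?_⟩
    have hz' : (z : ℚ_[ℓ]) ^ 3 = N * D ^ 2 := by exact_mod_cast congrArg ((↑) : ℤ_[ℓ] → ℚ_[ℓ]) hz
    field_simp
    linear_combination hz'
  · obtain ⟨z, hz, -⟩ := exists_cube_eq_of_toZMod_eq hℓ (x := N - D * S ^ 3) hR <| by
      rw [map_sub, map_mul, map_pow, ← hrs, add_sub_cancel_right]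
    refine ⟨z, S, ?_⟩
    have hz' : (z : ℚ_[ℓ]) ^ 3 = N - D * S ^ 3 := by
      exact_mod_cast congrArg ((↑) : ℤ_[ℓ] → ℚ_[ℓ]) hz
    linear_combination D * hz'

theorem exists_cube_eq_of_mod_three_eq_two (hℓ : ℓ % 3 = 2) (x : ZMod ℓ) : ∃ y, y ^ 3 = x := by
  refine ⟨x ^ ((2 * ℓ - 1) / 3), ?_⟩
  rw [← pow_mul, show (2 * ℓ - 1) / 3 * 3 = ℓ + (ℓ - 1) by omega, pow_add, ZMod.pow_card,
    ← pow_succ', Nat.sub_add_cancel (by omega), ZMod.pow_card]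

theorem coveringHasPoint_padic_three_three_mul {N : ℕ}
    (hN : N % 9 = 2 ∨ N % 9 = 4 ∨ N % 9 = 5 ∨ N % 9 = 7) :
    CoveringHasPoint (3 : ℚ_[3]) (3 * N) := by
  obtain ⟨s, u, t, hu, h⟩ : ∃ s u t : ℤ, u ^ 3 = u ∧ N - 3 * s ^ 3 = u * (1 + 9 * t) := by
    rcases hN with h | h | h | h
    · exact ⟨1, -1, -((N : ℤ) / 9), by norm_num, by omega⟩
    · exact ⟨1, 1, (N : ℤ) / 9, by norm_num, by omega⟩
    · exact ⟨-1, -1, -((N : ℤ) / 9 + 1), by norm_num, by omega⟩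
    · exact ⟨-1, 1, (N : ℤ) / 9 + 1, by norm_num, by omega⟩
  obtain ⟨z, hz⟩ := exists_cube_eq_one_add_nine_mul t
  have hz' : (z : ℚ_[3]) ^ 3 = 1 + 9 * t := by
    simpa [padicInt_coe_ofNat] using congrArg ((↑) : ℤ_[3] → ℚ_[3]) hz
  have hu' : (u : ℚ_[3]) ^ 3 = u := mod_cast hu
  have h' : (N : ℚ_[3]) - 3 * s ^ 3 = u * (1 + 9 * t) := mod_cast h
  exact .inl ⟨u * z, s, by linear_combination 3 * z ^ 3 * hu' + 3 * u * hz' - 3 * h'⟩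

theorem coveringHasPoint_three_three_mul {N : ℕ}
    (hN : N % 9 = 2 ∨ N % 9 = 4 ∨ N % 9 = 5 ∨ N % 9 = 7) (hNℓ : ℓ ∣ N → ℓ % 3 = 2) :
    CoveringHasPoint (3 : ℚ_[ℓ]) (3 * N) := by
  rcases eq_or_ne ℓ 3 with rfl | hℓ
  · exact coveringHasPoint_padic_three_three_mul hN
  have h3 : PadicInt.toZMod (3 : ℤ_[ℓ]) ≠ 0 := by
    rw [map_ofNat]
    exact zmod_three_ne_zero hℓ
  by_cases hℓN : ℓ ∣ N
  · obtain ⟨y, hy⟩ := exists_cube_eq_of_mod_three_eq_two (hNℓ hℓN) (PadicInt.toZMod 3)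
    obtain ⟨z, hz, -⟩ := exists_cube_eq_of_toZMod_eq hℓ
      (by rintro rfl; simp [hy.symm] at h3) hy.symm
    refine .inr ⟨z, ?_⟩
    rw [← PadicInt.coe_pow, hz, padicInt_coe_ofNat]
  · have := coveringHasPoint_mul_of_toZMod_ne_zero hℓ (D := 3) (N := N) h3
      (by rwa [map_natCast, Ne, ZMod.natCast_eq_zero_iff])
    rwa [padicInt_coe_ofNat, PadicInt.coe_natCast] at this

end Padic

/-! ### Cubes in the Eisenstein field -/

theorem exists_eq_unit_mul_pow {R : Type*} [CommMonoidWithZero R] [UniqueFactorizationMonoid R]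
    {k : ℕ} (hk : k ≠ 0) {x : R} (hx : x ≠ 0) (h : ∀ π : R, Prime π → k ∣ multiplicity π x) :
    ∃ (u : Rˣ) (y : R), x = u * y ^ k := by
  induction x using (wellFounded_dvdNotUnit (α := R)).induction with
  | _ x ih =>
    by_cases hu : IsUnit x
    · exact ⟨hu.unit, 1, by simp⟩
    obtain ⟨π, hirr, hπx⟩ := WfDvdMonoid.exists_irreducible_factor hu hx
    have hπ : Prime π := hirr.prime
    have hpos : 0 < multiplicity π x :=
      (FiniteMultiplicity.of_prime_left hπ hx).le_multiplicity_of_pow_dvd (by simpa using hπx)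
    obtain ⟨x', rfl⟩ := pow_dvd_of_le_multiplicity (Nat.le_of_dvd hpos (h π hπ))
    have hx' : x' ≠ 0 := right_ne_zero_of_mul hx
    have hmul (q : R) (hq : Prime q) : k ∣ multiplicity q x' := by
      have hdvd := h q hq
      rw [multiplicity_mul hq (FiniteMultiplicity.of_prime_left hq hx),
        (FiniteMultiplicity.of_prime_left hq hπ.ne_zero).multiplicity_pow hq] at hdvd
      exact (Nat.dvd_add_right (Nat.dvd_mul_right _ _)).mp hdvd
    obtain ⟨u, y, rfl⟩ := ih x' ⟨hx', π ^ k, mt (isUnit_pow_iff hk).mp hπ.not_isUnit,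
      mul_comm _ _⟩ hx' hmul
    exact ⟨u, π * y, by rw [mul_pow, mul_left_comm]⟩

theorem exists_prime_dvd_natCast {R : Type*} [CommSemiring R] {π : R} (hπ : Prime π) {m : ℕ}
    (hm : m ≠ 0) (h : π ∣ (m : R)) : ∃ ℓ : ℕ, ℓ.Prime ∧ π ∣ (ℓ : R) := by
  induction m using induction_on_primes with
  | zero => exact absurd rfl hm
  | one => exact absurd (isUnit_of_dvd_one (by simpa using h)) hπ.not_isUnit
  | prime_mul p a hp ih =>
    rw [Nat.cast_mul] at h
    exact (hπ.dvd_or_dvd h).elim (fun h => ⟨p, hp, h⟩) (ih (right_ne_zero_of_mul hm))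

section Eisenstein

variable {K : Type*} [Field K] {ζ : K}

theorem algebraMap_toInteger (hζ : IsPrimitiveRoot ζ 3) :
    algebraMap (𝓞 K) K hζ.toInteger = ζ :=
  rfl

theorem toInteger_sq_add (hζ : IsPrimitiveRoot ζ 3) :
    hζ.toInteger ^ 2 + hζ.toInteger + 1 = 0 :=
  sq_add_of_cube_eq_one hζ.toInteger_isPrimitiveRoot.pow_eq_one
    (hζ.toInteger_isPrimitiveRoot.ne_one (by norm_num))

/-- The map induced by an automorphism of a field on its ring of integers; for the nontrivial
automorphism of `ℚ(ζ₃)` this is complex conjugation on `ℤ[ζ₃]`. -/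
abbrev integerConj (τ : K ≃+* K) : 𝓞 K ≃+* 𝓞 K := RingOfIntegers.mapRingEquiv τ

variable {τ : K ≃+* K}

theorem integerConj_toInteger (hζ : IsPrimitiveRoot ζ 3) (hτ : τ ζ = ζ ^ 2) :
    integerConj τ hζ.toInteger = hζ.toInteger ^ 2 :=
  RingOfIntegers.ext hτ

theorem integerConj_add_mul (hζ : IsPrimitiveRoot ζ 3) (hτ : τ ζ = ζ ^ 2) (a b : ℤ) :
    integerConj τ (a + b * hζ.toInteger) = a + b * hζ.toInteger ^ 2 := by
  rw [map_add, map_mul, map_intCast, map_intCast, integerConj_toInteger hζ hτ]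

theorem add_mul_mul_integerConj (hζ : IsPrimitiveRoot ζ 3) (hτ : τ ζ = ζ ^ 2) (a b : ℤ) :
    (a + b * hζ.toInteger) * integerConj τ (a + b * hζ.toInteger) =
      ((a ^ 2 - a * b + b ^ 2 : ℤ) : 𝓞 K) := by
  rw [integerConj_add_mul hζ hτ]
  push_cast
  linear_combination (b ^ 2 * (hζ.toInteger - 1) + a * b : 𝓞 K) * toInteger_sq_add hζ

theorem prime_integerConj {π : 𝓞 K} (hπ : Prime π) : Prime (integerConj τ π) :=
  (MulEquiv.prime_iff (integerConj τ).toMulEquiv).mpr hπ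

variable [NumberField K] [IsCyclotomicExtension {3} ℚ K]

theorem exists_eq_add_mul_toInteger (hζ : IsPrimitiveRoot ζ 3) (x : 𝓞 K) :
    ∃ a b : ℤ, x = a + b * hζ.toInteger := by
  have hx : x ∈ Algebra.adjoin ℤ {hζ.toInteger} := by
    rw [← hζ.integralPowerBasis_gen, hζ.integralPowerBasis.adjoin_gen_eq_top]
    exact Algebra.mem_top
  induction hx using Algebra.adjoin_induction with
  | mem x hx => exact ⟨0, 1, by simp [Set.mem_singleton_iff.mp hx]⟩
  | algebraMap r => exact ⟨r, 0, by simp⟩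
  | add x y _ _ hx hy =>
    obtain ⟨a, b, rfl⟩ := hx
    obtain ⟨c, d, rfl⟩ := hy
    exact ⟨a + c, b + d, by push_cast; ring⟩
  | mul x y _ _ hx hy =>
    obtain ⟨a, b, rfl⟩ := hx
    obtain ⟨c, d, rfl⟩ := hy
    refine ⟨a * c - b * d, a * d + b * c - b * d, ?_⟩
    push_cast
    linear_combination (b * d : 𝓞 K) * toInteger_sq_add hζ

theorem integerConj_integerConj (hζ : IsPrimitiveRoot ζ 3) (hτ : τ ζ = ζ ^ 2) (x : 𝓞 K) :
    integerConj τ (integerConj τ x) = x := by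
  obtain ⟨a, b, rfl⟩ := exists_eq_add_mul_toInteger hζ x
  rw [integerConj_add_mul hζ hτ, map_add, map_mul, map_pow, map_intCast, map_intCast,
    integerConj_toInteger hζ hτ]
  linear_combination (b * hζ.toInteger : 𝓞 K) * hζ.toInteger_isPrimitiveRoot.pow_eq_one

theorem exists_mul_integerConj_eq (hζ : IsPrimitiveRoot ζ 3) (hτ : τ ζ = ζ ^ 2) (x : 𝓞 K) :
    ∃ m : ℕ, x * integerConj τ x = m ∧ m % 3 ≠ 2 := by
  obtain ⟨a, b, rfl⟩ := exists_eq_add_mul_toInteger hζ x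
  have hnonneg : 0 ≤ a ^ 2 - a * b + b ^ 2 := by
    nlinarith [sq_nonneg (a - b), sq_nonneg (a + b)]
  have hmod : (a ^ 2 - a * b + b ^ 2) % 3 ≠ 2 := by
    have ha : a % 3 = 0 ∨ a % 3 = 1 ∨ a % 3 = 2 := by lia
    have hb : b % 3 = 0 ∨ b % 3 = 1 ∨ b % 3 = 2 := by lia
    rcases ha with ha | ha | ha <;> rcases hb with hb | hb | hb <;>
      simp [Int.add_emod, Int.sub_emod, Int.mul_emod, pow_two, ha, hb]
  rw [add_mul_mul_integerConj hζ hτ]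
  obtain ⟨m, hm⟩ := Int.eq_ofNat_of_zero_le hnonneg
  rw [hm] at hmod ⊢
  exact ⟨m, Int.cast_natCast m, by lia⟩

theorem natCast_dvd_of_integer_dvd (hζ : IsPrimitiveRoot ζ 3) (hτ : τ ζ = ζ ^ 2) {m k : ℕ}
    (h : (m : 𝓞 K) ∣ (k : 𝓞 K)) : m ∣ k := by
  obtain ⟨y, hy⟩ := h
  obtain ⟨N, hN, -⟩ := exists_mul_integerConj_eq hζ hτ y
  have hconj : (k : 𝓞 K) = m * integerConj τ y := by
    simpa only [map_mul, map_natCast] using congrArg (integerConj τ) hy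
  have hsq : k ^ 2 = m ^ 2 * N := by
    rw [← Nat.cast_inj (R := 𝓞 K)]
    push_cast
    rw [← hN]
    linear_combination (k : 𝓞 K) * hy + (m * y : 𝓞 K) * hconj
  exact (Nat.pow_dvd_pow_iff two_ne_zero).mp ⟨N, hsq⟩

theorem exists_mul_integerConj_eq_prime (hζ : IsPrimitiveRoot ζ 3) (hτ : τ ζ = ζ ^ 2)
    {π : 𝓞 K} (hπ : Prime π) (hconj : ¬ π ∣ integerConj τ π) :
    ∃ ℓ : ℕ, ℓ.Prime ∧ π * integerConj τ π = ℓ := by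
  obtain ⟨m, hm, -⟩ := exists_mul_integerConj_eq hζ hτ π
  have hπ' : Prime (integerConj τ π) := prime_integerConj hπ
  have hm0 : m ≠ 0 := by
    rintro rfl
    exact mul_ne_zero hπ.ne_zero hπ'.ne_zero (by simpa using hm)
  obtain ⟨ℓ, hℓ, c, hc⟩ := exists_prime_dvd_natCast hπ hm0 ⟨_, hm.symm⟩
  have hndvd : ¬ integerConj τ π ∣ π := fun h => hconj <| by
    simpa only [integerConj_integerConj hζ hτ] using map_dvd (integerConj τ) h
  have hdvd : integerConj τ π ∣ π * c := by
    simpa only [← hc, map_natCast] using map_dvd (integerConj τ) (⟨c, hc⟩ : π ∣ (ℓ : 𝓞 K))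
  have hmℓ : m ∣ ℓ := natCast_dvd_of_integer_dvd hζ hτ <| by
    rw [← hm, hc]
    exact mul_dvd_mul_left π ((hπ'.dvd_or_dvd hdvd).resolve_left hndvd)
  rcases (Nat.dvd_prime hℓ).mp hmℓ with rfl | rfl
  · exact absurd (IsUnit.of_mul_eq_one _ (by simpa using hm)) hπ.not_isUnit
  · exact ⟨m, hℓ, hm⟩

theorem dvd_integerConj_of_dvd_three (hζ : IsPrimitiveRoot ζ 3) (hτ : τ ζ = ζ ^ 2)
    {π : 𝓞 K} (hπ : Prime π) (h : π ∣ 3) : π ∣ integerConj τ π := by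
  have hsq : (hζ.toInteger - hζ.toInteger ^ 2) ^ 2 = -3 := by
    linear_combination (hζ.toInteger ^ 2 - 3 * hζ.toInteger + 3) * toInteger_sq_add hζ
  have hdvd : π ∣ hζ.toInteger - hζ.toInteger ^ 2 :=
    hπ.dvd_of_dvd_pow (hsq ▸ (dvd_neg.mpr h))
  obtain ⟨a, b, hab⟩ := exists_eq_add_mul_toInteger hζ π
  have hsub : π - integerConj τ π = b * (hζ.toInteger - hζ.toInteger ^ 2) := by
    rw [hab, integerConj_add_mul hζ hτ]
    ring
  exact (dvd_sub_right dvd_rfl).mp (hsub ▸ hdvd.mul_left _)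

theorem exists_mul_integerConj_eq_prime_one_mod_three (hζ : IsPrimitiveRoot ζ 3)
    (hτ : τ ζ = ζ ^ 2) {π : 𝓞 K} (hπ : Prime π) (hconj : ¬ π ∣ integerConj τ π) :
    ∃ ℓ : ℕ, ℓ.Prime ∧ ℓ % 3 = 1 ∧ π * integerConj τ π = ℓ := by
  obtain ⟨ℓ, hℓ, hmul⟩ := exists_mul_integerConj_eq_prime hζ hτ hπ hconj
  refine ⟨ℓ, hℓ, ?_, hmul⟩
  have hndvd : ¬ 3 ∣ ℓ := fun h => by
    obtain rfl := (Nat.prime_dvd_prime_iff_eq Nat.prime_three hℓ).mp h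
    exact hconj (dvd_integerConj_of_dvd_three hζ hτ hπ ⟨_, by exact_mod_cast hmul.symm⟩)
  obtain ⟨m, hm, hmod⟩ := exists_mul_integerConj_eq hζ hτ π
  obtain rfl : m = ℓ := by exact_mod_cast hm.symm.trans hmul
  lia

section Embedding

variable {ℓ : ℕ} [Fact ℓ.Prime] (ι : K →+* ℚ_[ℓ])

theorem norm_embedding_le_one (hζ : IsPrimitiveRoot ζ 3) (x : 𝓞 K) : ‖ι x‖ ≤ 1 := by
  obtain ⟨a, b, rfl⟩ := exists_eq_add_mul_toInteger hζ x
  have hnorm : ‖ι ζ‖ = 1 :=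
    (pow_eq_one_iff_of_nonneg (norm_nonneg _) three_ne_zero).mp
      (by rw [← norm_pow, ← map_pow, hζ.pow_eq_one, map_one, norm_one])
  have hcoe : ι ((a + b * hζ.toInteger : 𝓞 K) : K) = a + b * ι ζ := by
    simp [algebraMap_toInteger]
  rw [hcoe]
  refine (Padic.nonarchimedean _ _).trans (max_le (Padic.norm_int_le_one a) ?_)
  rw [norm_mul, hnorm, mul_one]
  exact Padic.norm_int_le_one b

theorem norm_embedding_eq_one_of_not_dvd (hζ : IsPrimitiveRoot ζ 3) {π y : 𝓞 K} (hπ : Prime π)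
    (h : ‖ι π‖ < 1) (hy : ¬ π ∣ y) : ‖ι y‖ = 1 := by
  have : IsPrincipalIdealRing (𝓞 K) := IsCyclotomicExtension.Rat.three_pid K
  refine (norm_embedding_le_one ι hζ y).antisymm (not_lt.mp fun hlt => ?_)
  obtain ⟨c, d, hcd⟩ := hπ.irreducible.coprime_iff_not_dvd.mpr hy
  have hsum : ι c * ι π + ι d * ι y = 1 := by
    simpa using congrArg (fun z : 𝓞 K => ι z) hcd
  have hmul (e z : 𝓞 K) (hz : ‖ι z‖ < 1) : ‖ι e * ι z‖ < 1 := by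
    rw [norm_mul]
    exact mul_lt_one_of_nonneg_of_lt_one_right (norm_embedding_le_one ι hζ e) (norm_nonneg _) hz
  refine lt_irrefl (1 : ℝ) ?_
  calc 1 = ‖ι c * ι π + ι d * ι y‖ := by rw [hsum, norm_one]
    _ < 1 := (Padic.nonarchimedean _ _).trans_lt (max_lt (hmul c π h) (hmul d y hlt))

theorem valuation_embedding_eq_multiplicity (hζ : IsPrimitiveRoot ζ 3) {π : 𝓞 K} (hπ : Prime π)
    (h : (ι π).valuation = 1) {x : 𝓞 K} (hx : x ≠ 0) :
    (ι x).valuation = multiplicity π x := by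
  obtain ⟨y, hy, hndvd⟩ :=
    (FiniteMultiplicity.of_prime_left hπ hx).exists_eq_pow_mul_and_not_dvd
  have hne {z : 𝓞 K} (hz : z ≠ 0) : ι z ≠ 0 := by simpa using hz
  have hy0 : y ≠ 0 := fun e => hndvd (e ▸ dvd_zero π)
  have hπlt : ‖ι π‖ < 1 := by
    rw [Padic.norm_eq_zpow_neg_valuation (hne hπ.ne_zero), h, zpow_neg_one]
    exact inv_lt_one_of_one_lt₀ (by exact_mod_cast (Fact.out : ℓ.Prime).one_lt)
  have hval : (ι y).valuation = 0 := by
    rw [← Padic.valuation_one (p := ℓ), ← padic_norm_eq_iff (hne hy0) one_ne_zero, norm_one]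
    exact norm_embedding_eq_one_of_not_dvd ι hζ hπ hπlt hndvd
  have hmul : ι x = ι π ^ multiplicity π x * ι y := by
    simpa using congrArg (fun z : 𝓞 K => ι z) hy
  rw [hmul, Padic.valuation_mul (pow_ne_zero _ (hne hπ.ne_zero)) (hne hy0),
    Padic.valuation_pow, h, hval, mul_one, add_zero]

theorem valuation_embedding_eq_one_or (hζ : IsPrimitiveRoot ζ 3) {π π' : 𝓞 K}
    (h : π * π' = (ℓ : 𝓞 K)) : (ι π).valuation = 1 ∨ (ι π').valuation = 1 := by
  have hmul : ι π * ι π' = ℓ := by simpa using congrArg (fun z : 𝓞 K => ι z) h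
  have hℓ : (ℓ : ℚ_[ℓ]) ≠ 0 := by exact_mod_cast (Fact.out : ℓ.Prime).ne_zero
  have hsum : (ι π).valuation + (ι π').valuation = 1 := by
    rw [← Padic.valuation_mul (left_ne_zero_of_mul (hmul ▸ hℓ))
      (right_ne_zero_of_mul (hmul ▸ hℓ)), hmul, Padic.valuation_p]
  have hnonneg := (Padic.norm_le_one_iff_val_nonneg _).mp (norm_embedding_le_one ι hζ π)
  have hnonneg' := (Padic.norm_le_one_iff_val_nonneg _).mp (norm_embedding_le_one ι hζ π')
  lia

end Embedding

theorem three_dvd_multiplicity (hζ : IsPrimitiveRoot ζ 3) (hτ : τ ζ = ζ ^ 2) {x y : 𝓞 K}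
    (hx : x ≠ 0) (hxy : x * integerConj τ x = y ^ 3)
    (hloc : ∀ (ℓ : ℕ) [Fact ℓ.Prime], ℓ % 3 = 1 → ∃ ι : K →+* ℚ_[ℓ], 3 ∣ (ι x).valuation)
    {π : 𝓞 K} (hπ : Prime π) : 3 ∣ multiplicity π x := by
  have hx' : integerConj τ x ≠ 0 := by simpa using hx
  have hy : y ≠ 0 := by
    rintro rfl
    simp [hx] at hxy
  have hπ' : Prime (integerConj τ π) := prime_integerConj hπ
  have hsum : multiplicity π x + multiplicity (integerConj τ π) x = 3 * multiplicity π y := by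
    rw [← multiplicity_map_eq (integerConj τ) (a := integerConj τ π),
      integerConj_integerConj hζ hτ,
      ← multiplicity_mul hπ (FiniteMultiplicity.of_prime_left hπ (mul_ne_zero hx hx')), hxy,
      (FiniteMultiplicity.of_prime_left hπ hy).multiplicity_pow hπ]
  by_cases hdvd : π ∣ integerConj τ π
  · have hassoc : Associated π (integerConj τ π) := (hπ.dvd_prime_iff_associated hπ').mp hdvd
    have := multiplicity_eq_of_emultiplicity_eq
      (emultiplicity_eq_of_associated_left hassoc (c := x))
    lia
  · obtain ⟨ℓ, hℓ, hmod, hmul⟩ := exists_mul_integerConj_eq_prime_one_mod_three hζ hτ hπ hdvd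
    have : Fact ℓ.Prime := ⟨hℓ⟩
    obtain ⟨ι, hι⟩ := hloc ℓ hmod
    rcases valuation_embedding_eq_one_or ι hζ hmul with hval | hval
    · rw [valuation_embedding_eq_multiplicity ι hζ hπ hval hx] at hι
      exact_mod_cast hι
    · rw [valuation_embedding_eq_multiplicity ι hζ hπ' hval hx] at hι
      lia

theorem exists_integer_unit_eq_pow_mul_cube (hζ : IsPrimitiveRoot ζ 3) (u : (𝓞 K)ˣ) :
    ∃ (i : ℕ) (ε : 𝓞 K), (u : 𝓞 K) = hζ.toInteger ^ i * ε ^ 3 := by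
  have hmem := IsCyclotomicExtension.Rat.Three.Units.mem hζ u
  simp only [List.mem_cons, List.not_mem_nil, or_false] at hmem
  rcases hmem with h | h | h | h | h | h
  · exact ⟨0, 1, by simp [h]⟩
  · exact ⟨0, -1, by rw [h]; norm_num⟩
  · exact ⟨1, 1, by simp [h]⟩
  · exact ⟨1, -1, by rw [h]; norm_num⟩
  · exact ⟨2, 1, by simp [h]⟩
  · exact ⟨2, -1, by rw [h]; norm_num⟩

theorem exists_integer_eq_pow_mul_cube (hζ : IsPrimitiveRoot ζ 3) (hτ : τ ζ = ζ ^ 2) {x : 𝓞 K}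
    {b : K} (hx : x ≠ 0) (hxb : (x : K) * τ x = b ^ 3)
    (hloc : ∀ (ℓ : ℕ) [Fact ℓ.Prime], ℓ % 3 = 1 → ∃ ι : K →+* ℚ_[ℓ], 3 ∣ (ι x).valuation) :
    ∃ (i : ℕ) (y : 𝓞 K), x = hζ.toInteger ^ i * y ^ 3 := by
  have : IsPrincipalIdealRing (𝓞 K) := IsCyclotomicExtension.Rat.three_pid K
  have hconj : ((x * integerConj τ x : 𝓞 K) : K) = b ^ 3 := hxb
  have hb : IsIntegral ℤ b :=
    IsIntegral.of_pow three_pos (hconj ▸ RingOfIntegers.isIntegral_coe _)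
  have hcube : x * integerConj τ x = (⟨b, hb⟩ : 𝓞 K) ^ 3 := RingOfIntegers.ext hconj
  obtain ⟨u, y, hy⟩ := exists_eq_unit_mul_pow three_ne_zero hx
    fun π hπ => three_dvd_multiplicity hζ hτ hx hcube hloc hπ
  obtain ⟨i, ε, hu⟩ := exists_integer_unit_eq_pow_mul_cube hζ u
  exact ⟨i, ε * y, by rw [hy, hu, mul_pow, mul_assoc]⟩

theorem exists_zeta_pow_mul_cube (hζ : IsPrimitiveRoot ζ 3) (hτ : τ ζ = ζ ^ 2) {a b : K}
    (ha : a ≠ 0) (hab : a * τ a = b ^ 3)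
    (hloc : ∀ (ℓ : ℕ) [Fact ℓ.Prime], ℓ % 3 = 1 → ∃ ι : K →+* ℚ_[ℓ], 3 ∣ (ι a).valuation) :
    ∃ (i : ℕ) (c : K), a = ζ ^ i * c ^ 3 := by
  obtain ⟨x, y, hy, hxy⟩ := IsFractionRing.div_surjective (A := 𝓞 K) a
  have hy0 : (y : K) ≠ 0 := by simpa using nonZeroDivisors.ne_zero hy
  have hint : ((x * y ^ 2 : 𝓞 K) : K) = a * (y : K) ^ 3 := by
    rw [← hxy, RingOfIntegers.coe_eq_algebraMap, map_mul, map_pow]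
    field_simp
  have hint0 : x * y ^ 2 ≠ 0 := by
    rw [← RingOfIntegers.coe_ne_zero_iff (K := K), ← RingOfIntegers.coe_eq_algebraMap, hint]
    exact mul_ne_zero ha (pow_ne_zero 3 hy0)
  obtain ⟨i, z, hz⟩ := exists_integer_eq_pow_mul_cube hζ hτ (b := b * y * τ y) hint0
    (by rw [hint, map_mul, map_pow, mul_pow, mul_pow, ← hab]; ring) fun ℓ _ hℓ => by
      obtain ⟨ι, hι⟩ := hloc ℓ hℓ
      refine ⟨ι, ?_⟩
      rw [hint, map_mul, map_pow, padic_valuation_mul_cube (by simpa using ha)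
        (by simpa using hy0)]
      exact dvd_add hι (dvd_mul_right _ _)
  refine ⟨i, z / y, ?_⟩
  rw [div_pow, mul_div_assoc', eq_div_iff (pow_ne_zero 3 hy0), ← hint, hz]
  simp [algebraMap_toInteger]

end Eisenstein

/-! ### Cochains that become trivial locally -/

section Trivialized

variable {n : ℚ} {Q : Type*} [Field Q] [Algebra ℚ Q] [DecidableEq Q]
  {c : Gal(Q/ℚ) → EPoint n Q} {L F : Type*} [Field L] [Field F] [Algebra ℚ L] [Algebra L F]
  [Algebra ℚ F] [IsScalarTower ℚ L F] [DecidableEq F] {ι : Q →ₐ[ℚ] F} {P : EPoint n F}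

variable (c L F ι P) in
/-- The restriction of the cochain `c` to `Gal(F/L)`, along the embedding `ι` of `Q` into `F`, is
the coboundary of `P`. The restriction of automorphisms is encoded as a relation, so that `Q` need
not be a subfield of `F`. -/
def TrivializedBy : Prop :=
  ∀ σ : Gal(F/L), ∃ ρ : Gal(Q/ℚ), (∀ x, ι (ρ x) = σ (ι x)) ∧
    Point.map (W' := cubeSumCurve n) ι (c ρ) = σ • P - P

theorem TrivializedBy.tower {M : Type*} [Field M] [Algebra ℚ M] [Algebra L M] [Algebra M F]
    [IsScalarTower L M F] [IsScalarTower ℚ M F] (h : TrivializedBy c L F ι P) :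
    TrivializedBy c M F ι P := fun σ => by
  obtain ⟨ρ, hρ, hP⟩ := h (σ.restrictScalars L)
  exact ⟨ρ, hρ, hP.trans (by rw [smul_eq_map, smul_eq_map]; rfl)⟩

variable [NeZero n]

theorem TrivializedBy.sqrtNegThree {w : Q} (hw : w ^ 2 + w + 1 = 0)
    (hι : ι w ∈ Set.range (algebraMap L F)) (h : TrivializedBy c L F ι P) :
    TrivializedBy (fun ρ => sqrtNegThree w hw (c ρ)) L F ι
      (sqrtNegThree (ι w) (map_sq_add ι hw) P) := fun σ => by
  obtain ⟨ρ, hρ, hP⟩ := h σ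
  obtain ⟨t, ht⟩ := hι
  have hσ : σ (ι w) = ι w := by rw [← ht, σ.commutes]
  refine ⟨ρ, hρ, ?_⟩
  rw [map_sqrtNegThree ι hw (map_sq_add ι hw) rfl, hP, map_sub,
    smul_sqrtNegThree (map_sq_add ι hw) hσ]

theorem TrivializedBy.coveringHasPoint [IsGalois L F] (h : TrivializedBy c L F ι P) {w : Q}
    (hw : w ^ 2 + w + 1 = 0) {θ : Q} (hθ : θ ≠ 0) {D : L} (hD : algebraMap L F D = ι (θ ^ 3))
    (hc : ∀ (ρ : Gal(Q/ℚ)) (σ : Gal(F/L)), (∀ x, ι (ρ x) = σ (ι x)) →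
      IsKummerPoint (c ρ) θ (ρ θ)) : CoveringHasPoint D (algebraMap ℚ L n) := by
  refine coveringHasPoint_of_isKummerPoint (map_sq_add ι hw) ((map_ne_zero ι).mpr hθ)
    (hD.trans (map_pow ι θ 3)) (P := P) fun σ => ?_
  obtain ⟨ρ, hρ, hP⟩ := h σ
  rw [← hP, ← hρ]
  exact (hc ρ σ hρ).map ι

theorem CoveringHasPoint.exists_trivializedBy {θ : Q} (hθ : θ ≠ 0) {D : L}
    (hD : algebraMap L F D = ι (θ ^ 3)) (h : CoveringHasPoint D (algebraMap ℚ L n))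
    (hres : ∀ σ : Gal(F/L), ∃ ρ : Gal(Q/ℚ), ∀ x, ι (ρ x) = σ (ι x))
    (hc : ∀ ρ : Gal(Q/ℚ), IsKummerPoint (c ρ) θ (ρ θ)) :
    ∃ P : EPoint n F, TrivializedBy c L F ι P := by
  have hθ' : ι θ ≠ 0 := (map_ne_zero ι).mpr hθ
  obtain ⟨P, hP⟩ := h.exists_point hθ' (hD.trans (map_pow ι θ 3))
  refine ⟨P, fun σ => ?_⟩
  obtain ⟨ρ, hρ⟩ := hres σ
  exact ⟨ρ, hρ, ((hc ρ).map ι).eq hθ' (by simpa only [hρ] using hP σ)⟩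

/-- The restriction of the cochain `c` to `Gal(Q/ℚ(w))` is the Kummer cocycle of the class of `θ³`,
under the identification of `μ₃` with `ker √-3`. -/
def IsKummerOver (w : Q) (c : Gal(Q/ℚ) → EPoint n Q) (θ : Q) : Prop :=
  ∀ ρ : Gal(Q/ℚ), ρ w = w → IsKummerPoint (c ρ) θ (ρ θ)

theorem TrivializedBy.coveringHasPoint_of_isKummerOver [IsGalois L F]
    (h : TrivializedBy c L F ι P) {w : Q} (hw : w ^ 2 + w + 1 = 0)
    (hι : ι w ∈ Set.range (algebraMap L F)) {α : Q} (hα : α ≠ 0) {D : L}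
    (hD : algebraMap L F D = ι (α ^ 3))
    (hc : IsKummerOver w (fun ρ => CubeSum.sqrtNegThree w hw (c ρ)) α) :
    CoveringHasPoint D (algebraMap ℚ L n) := by
  refine (h.sqrtNegThree hw hι).coveringHasPoint hw hα hD fun ρ σ hρσ => hc ρ ?_
  obtain ⟨t, ht⟩ := hι
  exact ι.toRingHom.injective ((hρσ w).trans (by rw [← ht, σ.commutes]; exact ht))

end Trivialized

theorem exists_algHom_adjoin_simple {k Q L F : Type*} [Field k] [Field Q] [Field L] [Field F]
    [Algebra k Q] [Algebra k L] [Algebra L F] [Algebra k F] [IsScalarTower k L F] (ι : Q →ₐ[k] F)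
    {w : Q} (hw : ι w ∈ Set.range (algebraMap L F)) :
    ∃ κ : k⟮w⟯ →ₐ[k] L, ∀ x, algebraMap L F (κ x) = ι x := by
  let j : L →ₐ[k] F := IsScalarTower.toAlgHom k L F
  have hmem (x : k⟮w⟯) : ι.comp k⟮w⟯.val x ∈ j.range :=
    adjoin_simple_le_iff.mpr (show w ∈ j.fieldRange.comap ι from hw) x.2
  refine ⟨(AlgEquiv.ofInjectiveField j).symm.toAlgHom.comp (AlgHom.codRestrict _ j.range hmem),
    fun x => ?_⟩
  exact congrArg Subtype.val ((AlgEquiv.ofInjectiveField j).apply_symm_apply ⟨_, hmem x⟩)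

section LocallyTrivial

variable {n : ℚ} {Q : Type*} [Field Q] [Algebra ℚ Q] [DecidableEq Q]
  {c : Gal(Q/ℚ) → EPoint n Q}

variable (c) in
/-- The cochain `c` becomes a coboundary over some Galois extension of `L` into which `Q` embeds;
in the application to Selmer groups, over the algebraic closure of the completion `L`. -/
def LocallyTrivialAt (L : Type) [Field L] [Algebra ℚ L] : Prop :=
  ∃ (F : Type) (_ : Field F) (_ : Algebra ℚ F) (_ : Algebra L F) (_ : IsScalarTower ℚ L F)
    (_ : IsGalois L F) (_ : DecidableEq F) (ι : Q →ₐ[ℚ] F) (P : EPoint n F),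
    TrivializedBy c L F ι P

variable [NeZero n]

theorem LocallyTrivialAt.coveringHasPoint {w : Q} (hw : w ^ 2 + w + 1 = 0) {L : Type} [Field L]
    [Algebra ℚ L] (h : LocallyTrivialAt c L) {θ : Q} (hθ : θ ≠ 0) {d : ℚ}
    (hd : algebraMap ℚ Q d = θ ^ 3) (hc : ∀ ρ : Gal(Q/ℚ), IsKummerPoint (c ρ) θ (ρ θ)) :
    CoveringHasPoint (algebraMap ℚ L d) (algebraMap ℚ L n) := by
  obtain ⟨F, _, _, _, _, _, _, ι, P, h⟩ := h
  refine h.coveringHasPoint hw hθ ?_ fun ρ _ _ => hc ρ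
  rw [← IsScalarTower.algebraMap_apply, ← hd, ι.commutes]

variable {w : Q} (hw : w ^ 2 + w + 1 = 0) {α : Q}

theorem LocallyTrivialAt.exists_three_dvd_valuation {ℓ : ℕ} [Fact ℓ.Prime] (hℓ : ℓ % 3 = 1)
    (hn : 3 ∣ (algebraMap ℚ ℚ_[ℓ] n).valuation) (h : LocallyTrivialAt c ℚ_[ℓ]) (hα : α ≠ 0)
    (hc : IsKummerOver w (fun ρ => sqrtNegThree w hw (c ρ)) α) (hαw : α ^ 3 ∈ ℚ⟮w⟯) :
    ∃ κ : ℚ⟮w⟯ →+* ℚ_[ℓ], 3 ∣ (κ ⟨α ^ 3, hαw⟩).valuation := by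
  obtain ⟨F, _, _, _, _, _, _, ι, P, h⟩ := h
  obtain ⟨t, ht⟩ := exists_padic_sq_add_eq_zero hℓ
  have hι : ι w ∈ Set.range (algebraMap ℚ_[ℓ] F) := by
    rcases eq_of_cube_eq_one (map_sq_add (algebraMap ℚ_[ℓ] F) ht)
      (map_cube_eq_one ι (cube_eq_one_of_sq_add hw)) with e | e | e <;> rw [e]
    exacts [⟨1, map_one _⟩, ⟨t, rfl⟩, ⟨t ^ 2, map_pow _ t 2⟩]
  obtain ⟨κ, hκ⟩ := exists_algHom_adjoin_simple ι hι
  have hne : (⟨α ^ 3, hαw⟩ : ℚ⟮w⟯) ≠ 0 := fun e => pow_ne_zero 3 hα (congrArg Subtype.val e)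
  exact ⟨κ, three_dvd_valuation_of_coveringHasPoint ((map_ne_zero κ).mpr hne)
    algebraMap_rat_ne_zero hn (h.coveringHasPoint_of_isKummerOver hw hι hα (hκ _) hc)⟩

theorem LocallyTrivialAt.cube_sq_add_ne_zero {p : ℕ} [Fact p.Prime]
    (hmod : p % 9 = 2 ∨ p % 9 = 5) (hn : ¬ 3 ∣ (algebraMap ℚ ℚ_[p] n).valuation)
    (h : LocallyTrivialAt c ℚ_[p]) (hα : α ≠ 0)
    (hc : IsKummerOver w (fun ρ => sqrtNegThree w hw (c ρ)) α) :
    (α ^ 3) ^ 2 + α ^ 3 + 1 ≠ 0 := by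
  intro hη
  obtain ⟨F, _, _, _, _, _, _, ι, P, h⟩ := h
  let η : ℚ_[p]⟮ι (α ^ 3)⟯ := AdjoinSimple.gen ℚ_[p] (ι (α ^ 3))
  have : IsScalarTower ℚ ℚ_[p]⟮ι (α ^ 3)⟯ F :=
    .of_algebraMap_eq fun x => (RingHom.map_rat_algebraMap (algebraMap _ F) x).symm
  have hη' : η ^ 2 + η + 1 = 0 := Subtype.ext (map_sq_add ι hη)
  have hι : ι w ∈ Set.range (algebraMap ℚ_[p]⟮ι (α ^ 3)⟯ F) := by
    rcases eq_of_cube_eq_one hη (cube_eq_one_of_sq_add hw) with e | e | e <;> rw [e]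
    exacts [⟨1, by rw [map_one, map_one]⟩, ⟨η, rfl⟩, ⟨η ^ 2, (map_pow ι _ 2).symm⟩]
  refine not_coveringHasPoint_of_sq_add hmod hη' (fun x => ?_) hn (N := algebraMap ℚ ℚ_[p] n) ?_
  · obtain ⟨a, b, hab⟩ := exists_eq_add_mul_of_mem_adjoin (map_sq_add ι hη) x.2
    exact ⟨a, b, Subtype.ext hab⟩
  · rw [RingHom.map_rat_algebraMap]
    exact h.tower.coveringHasPoint_of_isKummerOver hw hι hα (D := η) rfl hc

end LocallyTrivial

/-! ### The image of a Selmer cocycle under `√-3` -/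

section Cocycle

variable {n : ℚ} {k F : Type*} [Field k] [Field F] [Algebra ℚ k] [Algebra ℚ F] [Algebra k F]
  [IsScalarTower ℚ k F] [DecidableEq F]

/-- Continuous cocycles of `Gal(F/k)` with values in the points of the curve. For a cocycle with
values in a discrete module continuity means that it vanishes on the automorphisms that fix a
suitable finite set. -/
structure IsContinuousCocycle (c : Gal(F/k) → EPoint n F) : Prop where
  apply_mul : ∀ σ τ, c (σ * τ) = c σ + σ • c τ
  exists_finset : ∃ S : Finset F, ∀ σ : Gal(F/k), (∀ x ∈ S, σ x = x) → c σ = 0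

variable [NeZero n]

theorem smul_kernelPoint_of_fixed {w : F} (hw : w ^ 2 + w + 1 = 0) {σ : Gal(F/k)} (hσ : σ w = w)
    {z : F} (hz : z ^ 3 = 1) : σ • kernelPoint n z = kernelPoint n z := by
  rw [smul_kernelPoint σ hz]
  rcases eq_of_cube_eq_one hw hz with rfl | rfl | rfl <;> simp only [map_one, map_pow, hσ]

theorem smul_kernelPoint_of_conj {w : F} (hw : w ^ 2 + w + 1 = 0) {σ : Gal(F/k)}
    (hσ : σ w = w ^ 2) {z : F} (hz : z ^ 3 = 1) : σ • kernelPoint n z = -kernelPoint n z := by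
  rw [smul_kernelPoint σ hz, ← kernelPoint_sq hz]
  rcases eq_of_cube_eq_one hw hz with rfl | rfl | rfl <;> simp only [map_one, map_pow, hσ, one_pow]

theorem exists_kernelPoint_sqrtNegThree {w : F} (hw : w ^ 2 + w + 1 = 0) {T : EPoint n F}
    (hT : (3 : ℤ) • T = 0) : ∃ z : F, z ^ 3 = 1 ∧ sqrtNegThree w hw T = kernelPoint n z :=
  exists_kernelPoint_of_sqrtNegThree_eq_zero hw (by rw [sqrtNegThree_sqrtNegThree, hT, neg_zero])

theorem sqrtNegThree_smul_eq {w : F} (hw : w ^ 2 + w + 1 = 0) {T : EPoint n F}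
    (hT : (3 : ℤ) • T = 0) (σ : Gal(F/k)) :
    sqrtNegThree w hw (σ • T) = sqrtNegThree w hw T := by
  obtain ⟨z, hz, hTz⟩ := exists_kernelPoint_sqrtNegThree hw hT
  rcases apply_eq_or_of_sq_add hw σ with hσ | hσ
  · rw [← smul_sqrtNegThree hw hσ, hTz, smul_kernelPoint_of_fixed hw hσ hz]
  · rw [← neg_neg (sqrtNegThree w hw (σ • T)), ← smul_sqrtNegThree_of_conj hw hσ, hTz,
      smul_kernelPoint_of_conj hw hσ hz, neg_neg]

namespace IsContinuousCocycle

variable {c : Gal(F/k) → EPoint n F}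

theorem exists_isKummerPoint [IsGalois k F] (hc : IsContinuousCocycle c)
    (hker : ∀ σ, ∃ z : F, z ^ 3 = 1 ∧ c σ = kernelPoint n z) :
    ∃ θ : F, θ ≠ 0 ∧ ∀ σ : Gal(F/k), IsKummerPoint (c σ) θ (σ θ) := by
  choose z hz hcz using hker
  obtain ⟨S, hS⟩ := hc.exists_finset
  have z_mul (σ τ : Gal(F/k)) : z (σ * τ) = z σ * σ (z τ) := by
    have hστ : σ (z τ) ^ 3 = 1 := map_cube_eq_one σ (hz τ)
    refine kernelPoint_injective (n := n) (hz _) (by rw [mul_pow, hz, hστ, one_mul]) ?_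
    rw [← hcz, hc.apply_mul, hcz, hcz, kernelPoint_mul (hz σ) hστ, smul_kernelPoint σ (hz τ)]
  have z_eq_one (σ : Gal(F/k)) (hσ : ∀ x ∈ S, σ x = x) : z σ = 1 :=
    kernelPoint_injective (n := n) (hz σ) (one_pow 3) (by rw [← hcz, hS σ hσ, kernelPoint_one])
  obtain ⟨θ, hθ, h⟩ := hilbert90 z z_mul (fun σ => ne_zero_of_cube_eq_one (hz σ)) S z_eq_one
  exact ⟨θ, hθ, fun σ => ⟨z σ, hz σ, hcz σ, h σ⟩⟩

theorem exists_isKummerPoint_algebraMap [IsGalois k F] (hc : IsContinuousCocycle c) {w : F}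
    (hw : w ^ 2 + w + 1 = 0) (h0 : ∀ σ, sqrtNegThree w hw (c σ) = 0) :
    ∃ θ : F, θ ≠ 0 ∧ (∃ d : k, algebraMap k F d = θ ^ 3) ∧
      ∀ σ : Gal(F/k), IsKummerPoint (c σ) θ (σ θ) := by
  obtain ⟨θ, hθ, h⟩ := hc.exists_isKummerPoint fun σ =>
    exists_kernelPoint_of_sqrtNegThree_eq_zero hw (h0 σ)
  exact ⟨θ, hθ, exists_algebraMap_of_fixed fun σ => (map_pow σ θ 3).trans (h σ).cube_eq, h⟩

theorem sqrtNegThree_apply_mul (hc : IsContinuousCocycle c) (h3 : ∀ σ, (3 : ℤ) • c σ = 0) {w : F}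
    (hw : w ^ 2 + w + 1 = 0) (σ τ : Gal(F/k)) :
    sqrtNegThree w hw (c (σ * τ)) = sqrtNegThree w hw (c σ) + sqrtNegThree w hw (c τ) := by
  rw [hc.apply_mul, map_add, sqrtNegThree_smul_eq hw (h3 τ)]

theorem sqrtNegThree_apply_conj (hc : IsContinuousCocycle c) (h3 : ∀ σ, (3 : ℤ) • c σ = 0) {w : F}
    (hw : w ^ 2 + w + 1 = 0) (σ τ : Gal(F/k)) :
    sqrtNegThree w hw (c (τ⁻¹ * σ * τ)) = sqrtNegThree w hw (c σ) := by
  let f : Gal(F/k) →* Multiplicative (EPoint n F) :=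
    MonoidHom.mk' (fun σ => .ofAdd (sqrtNegThree w hw (c σ))) (hc.sqrtNegThree_apply_mul h3 hw)
  have hf : f (τ⁻¹ * σ * τ) = f σ := by rw [map_mul, map_mul, map_inv, mul_right_comm,
    inv_mul_cancel, one_mul]
  exact hf

theorem sqrtNegThree_restrictScalars {K : Type*} [Field K] [Algebra ℚ K] [Algebra k K]
    [Algebra K F] [IsScalarTower k K F] [IsScalarTower ℚ K F] (hc : IsContinuousCocycle c) {w : F}
    (hw : w ^ 2 + w + 1 = 0) (hwK : w ∈ Set.range (algebraMap K F)) :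
    IsContinuousCocycle fun σ : Gal(F/K) => sqrtNegThree w hw (c (σ.restrictScalars k)) where
  apply_mul σ τ := by
    obtain ⟨t, rfl⟩ := hwK
    rw [smul_sqrtNegThree hw (σ.commutes t), ← map_add]
    exact congrArg _ (hc.apply_mul (σ.restrictScalars k) (τ.restrictScalars k))
  exists_finset := by
    obtain ⟨S, hS⟩ := hc.exists_finset
    exact ⟨S, fun σ hσ => by rw [hS (σ.restrictScalars k) hσ, map_zero]⟩

end IsContinuousCocycle

end Cocycle

theorem exists_conj {Q : Type*} [Field Q] [Algebra ℚ Q] [IsGalois ℚ Q] {w : Q}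
    (hw : w ^ 2 + w + 1 = 0) : ∃ τ : Gal(Q/ℚ), τ w = w ^ 2 := by
  by_contra! h
  obtain ⟨t, rfl⟩ := exists_algebraMap_of_fixed (k := ℚ) fun σ =>
    (apply_eq_or_of_sq_add hw σ).resolve_right (h σ)
  have ht : t ^ 2 + t + 1 = 0 := (algebraMap ℚ Q).injective
    (by simpa only [map_add, map_pow, map_one, map_zero] using hw)
  nlinarith [sq_nonneg (t + 1 / 2)]

section KummerOver

variable {n : ℚ} {Q : Type*} [Field Q] [Algebra ℚ Q] [DecidableEq Q] [NeZero n]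
  {c : Gal(Q/ℚ) → EPoint n Q} {w : Q} {α : Q}

theorem IsContinuousCocycle.exists_isKummerOver [IsGalois ℚ Q] (hc : IsContinuousCocycle c)
    (h3 : ∀ σ, (3 : ℤ) • c σ = 0) (hw : w ^ 2 + w + 1 = 0) :
    ∃ α : Q, α ≠ 0 ∧ IsKummerOver w (fun ρ => sqrtNegThree w hw (c ρ)) α := by
  have : IsScalarTower ℚ ℚ⟮w⟯ Q :=
    .of_algebraMap_eq fun x => (RingHom.map_rat_algebraMap (algebraMap _ Q) x).symm
  obtain ⟨α, hα, h⟩ := (hc.sqrtNegThree_restrictScalars (K := ℚ⟮w⟯) hw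
    ⟨AdjoinSimple.gen ℚ w, rfl⟩).exists_isKummerPoint fun σ =>
      exists_kernelPoint_sqrtNegThree hw (h3 _)
  refine ⟨α, hα, fun ρ hρ => ?_⟩
  have hρw : ρ ∈ ℚ⟮w⟯.fixingSubgroup := (mem_fixingSubgroup_iff _ _).mpr fun _ hx =>
    apply_eq_self_of_mem_adjoin (fun _ hy => (Set.mem_singleton_iff.mp hy) ▸ hρ) hx
  exact h (fixingSubgroupEquiv ℚ⟮w⟯ ⟨ρ, hρw⟩)

namespace IsKummerOver

theorem cube_mem_adjoin [IsGalois ℚ Q] (h : IsKummerOver w c α) : α ^ 3 ∈ ℚ⟮w⟯ :=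
  mem_adjoin_of_fixed fun ρ hρ => (map_pow ρ α 3).trans (h ρ hρ).cube_eq

theorem mul_conj_mem_adjoin [IsGalois ℚ Q] (hw : w ^ 2 + w + 1 = 0) (h : IsKummerOver w c α)
    {τ : Gal(Q/ℚ)} (hτ : τ w = w ^ 2) (hτc : ∀ ρ, c (τ⁻¹ * ρ * τ) = c ρ) :
    α * τ α ∈ ℚ⟮w⟯ := by
  refine mem_adjoin_of_fixed fun ρ hρ => ?_
  have hconj : (τ⁻¹ * ρ * τ) w = w := by
    rw [AlgEquiv.mul_apply, AlgEquiv.mul_apply, hτ, map_pow, hρ, ← hτ]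
    exact τ.symm_apply_apply w
  have hτα : IsKummerPoint (-c ρ) (τ α) (ρ (τ α)) := by
    obtain ⟨z, hz, hcz, hρα⟩ := h _ hconj
    rw [hτc] at hcz
    refine ⟨τ z, map_cube_eq_one τ hz, ?_, ?_⟩
    · rw [← smul_kernelPoint τ hz, smul_kernelPoint_of_conj hw hτ hz, hcz]
    · rw [← map_mul, ← hρα]
      exact (τ.apply_symm_apply _).symm
  have hsum := (h ρ hρ).add hτα
  rw [add_neg_cancel] at hsum
  simpa only [map_mul, mul_one, one_mul] using hsum.mul_eq_mul (isKummerPoint_zero 1)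

theorem exists_cube_eq_pow_mul_cube [IsGalois ℚ Q] (hw : w ^ 2 + w + 1 = 0)
    (h : IsKummerOver w c α) (hα : α ≠ 0) (hconj : ∀ ρ τ, c (τ⁻¹ * ρ * τ) = c ρ)
    (hloc : ∀ (ℓ : ℕ) [Fact ℓ.Prime], ℓ % 3 = 1 →
      ∃ κ : ℚ⟮w⟯ →+* ℚ_[ℓ], 3 ∣ (κ ⟨α ^ 3, h.cube_mem_adjoin⟩).valuation) :
    ∃ (i : ℕ) (b : Q), b ∈ ℚ⟮w⟯ ∧ α ^ 3 = w ^ i * b ^ 3 := by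
  have : CharZero Q := algebraRat.charZero Q
  have hprim : IsPrimitiveRoot w 3 := IsPrimitiveRoot.iff_orderOf.mpr
    (orderOf_eq_prime (cube_eq_one_of_sq_add hw) (ne_one_of_sq_add three_ne_zero hw))
  have : IsCyclotomicExtension {3} ℚ ℚ⟮w⟯ := by
    convert hprim.intermediateField_adjoin_isCyclotomicExtension ℚ
    · rfl
    · exact Subsingleton.elim _ _
  have : NumberField ℚ⟮w⟯ := IsCyclotomicExtension.numberField {3} ℚ _
  have : IsGalois ℚ ℚ⟮w⟯ := IsCyclotomicExtension.isGalois {3} ℚ _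
  obtain ⟨τ, hτ⟩ := exists_conj hw
  have hβ := h.mul_conj_mem_adjoin hw hτ fun ρ => hconj ρ τ
  have hτK (x : ℚ⟮w⟯) : ((τ.restrictNormal ℚ⟮w⟯ x : ℚ⟮w⟯) : Q) = τ x :=
    τ.restrictNormal_commutes ℚ⟮w⟯ x
  have hgen : IsPrimitiveRoot (AdjoinSimple.gen ℚ w) 3 :=
    IsPrimitiveRoot.coe_submonoidClass_iff.mp hprim
  have hnorm : (⟨α ^ 3, h.cube_mem_adjoin⟩ : ℚ⟮w⟯) *
      τ.restrictNormal ℚ⟮w⟯ ⟨α ^ 3, h.cube_mem_adjoin⟩ = ⟨α * τ α, hβ⟩ ^ 3 := Subtype.ext <| by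
    rw [MulMemClass.coe_mul, hτK, SubmonoidClass.coe_pow, mul_pow, map_pow]
  obtain ⟨i, b, hib⟩ := exists_zeta_pow_mul_cube hgen
    (τ := (τ.restrictNormal ℚ⟮w⟯).toRingEquiv) (Subtype.ext ((hτK _).trans hτ))
    (fun e => pow_ne_zero 3 hα (congrArg Subtype.val e)) hnorm hloc
  exact ⟨i, b, b.2, congrArg Subtype.val hib⟩

end IsKummerOver

theorem IsContinuousCocycle.sqrtNegThree_eq_zero_of_fixing (hc : IsContinuousCocycle c)
    (h3 : ∀ σ, (3 : ℤ) • c σ = 0) (hw : w ^ 2 + w + 1 = 0)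
    (hzero : ∀ ρ : Gal(Q/ℚ), ρ w = w → sqrtNegThree w hw (c ρ) = 0) (σ : Gal(Q/ℚ)) :
    sqrtNegThree w hw (c σ) = 0 := by
  have hw3 := cube_eq_one_of_sq_add hw
  have hσσ : (σ * σ) w = w := by
    rw [AlgEquiv.mul_apply]
    rcases apply_eq_or_of_sq_add hw σ with e | e
    · rw [e, e]
    · rw [e, map_pow, e]
      linear_combination w * hw3
  have htwo := hzero _ hσσ
  rw [hc.sqrtNegThree_apply_mul h3 hw] at htwo
  have hthree := congrArg (sqrtNegThree w hw) (h3 σ)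
  rw [map_zsmul, map_zero] at hthree
  calc sqrtNegThree w hw (c σ)
      = (3 : ℤ) • sqrtNegThree w hw (c σ) -
        (sqrtNegThree w hw (c σ) + sqrtNegThree w hw (c σ)) := by abel
    _ = 0 := by rw [hthree, htwo, sub_zero]

theorem IsContinuousCocycle.sqrtNegThree_eq_zero [IsGalois ℚ Q] (hc : IsContinuousCocycle c)
    (h3 : ∀ σ, (3 : ℤ) • c σ = 0) (hloc : ∀ (ℓ : ℕ) [Fact ℓ.Prime], LocallyTrivialAt c ℚ_[ℓ])
    {p : ℕ} [Fact p.Prime] (hp : p % 9 = 2 ∨ p % 9 = 5)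
    (hnp : ¬ 3 ∣ (algebraMap ℚ ℚ_[p] n).valuation)
    (hn : ∀ (ℓ : ℕ) [Fact ℓ.Prime], ℓ % 3 = 1 → 3 ∣ (algebraMap ℚ ℚ_[ℓ] n).valuation)
    (hw : w ^ 2 + w + 1 = 0) (σ : Gal(Q/ℚ)) : sqrtNegThree w hw (c σ) = 0 := by
  have hw3 := cube_eq_one_of_sq_add hw
  obtain ⟨α, hα, h⟩ := hc.exists_isKummerOver h3 hw
  obtain ⟨i, b, hb, hib⟩ := h.exists_cube_eq_pow_mul_cube hw hα
    (fun ρ τ => hc.sqrtNegThree_apply_conj h3 hw ρ τ) fun ℓ _ hℓ =>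
      (hloc ℓ).exists_three_dvd_valuation hw hℓ (hn ℓ hℓ) hα h h.cube_mem_adjoin
  have hb0 : b ≠ 0 := by
    rintro rfl
    exact pow_ne_zero 3 hα (by rw [hib, zero_pow three_ne_zero, mul_zero])
  have hfix (ρ : Gal(Q/ℚ)) (hρ : ρ w = w) : ρ b⁻¹ = b⁻¹ :=
    apply_eq_self_of_mem_adjoin (fun _ hy => (Set.mem_singleton_iff.mp hy) ▸ hρ) (inv_mem hb)
  have hdiv : IsKummerOver w (fun ρ => sqrtNegThree w hw (c ρ)) (α * b⁻¹) := fun ρ hρ => by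
    simpa only [map_mul, hfix ρ hρ] using (h ρ hρ).mul_right b⁻¹
  have hcube : (α * b⁻¹) ^ 3 = w ^ i := by
    rw [mul_pow, hib, inv_pow, mul_inv_cancel_right₀ (pow_ne_zero 3 hb0)]
  have hone : (α * b⁻¹) ^ 3 = 1 := by
    by_contra hne
    refine (hloc p).cube_sq_add_ne_zero hw hp hnp (mul_ne_zero hα (inv_ne_zero hb0)) hdiv
      (sq_add_of_cube_eq_one ?_ hne)
    rw [hcube, pow_right_comm, hw3, one_pow]
  refine hc.sqrtNegThree_eq_zero_of_fixing h3 hw (fun ρ hρ => ?_) σ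
  have hρα : ρ (α * b⁻¹) = α * b⁻¹ := by
    rcases eq_of_cube_eq_one hw hone with e | e | e <;> simp only [e, map_one, map_pow, hρ]
  refine IsKummerPoint.eq (hdiv ρ hρ) (mul_ne_zero hα (inv_ne_zero hb0)) ?_
  rw [hρα]
  exact isKummerPoint_zero _

end KummerOver

/-! ### Rational numbers modulo cubes -/

theorem rat_eq_pow_of_dvd_padicValRat {k : ℕ} (hk : Odd k) {d : ℚ} (hd : d ≠ 0)
    (h : ∀ (ℓ : ℕ) [Fact ℓ.Prime], (k : ℤ) ∣ padicValRat ℓ d) : ∃ q : ℚ, d = q ^ k := by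
  have hden : (d.den : ℚ) ≠ 0 := by exact_mod_cast d.den_ne_zero
  have hden' := pow_ne_zero (k - 1) d.den_ne_zero
  have hnum : d.num.natAbs ≠ 0 := Int.natAbs_ne_zero.mpr (Rat.num_ne_zero.mpr hd)
  have hk' : k - 1 + 1 = k := Nat.sub_add_cancel hk.pos
  obtain ⟨u, y, hy⟩ := exists_eq_unit_mul_pow hk.pos.ne' (mul_ne_zero hnum hden') fun ℓ hℓ => by
    have : Fact ℓ.Prime := ⟨Nat.prime_iff.mpr hℓ⟩
    have hval : (multiplicity ℓ (d.num.natAbs * d.den ^ (k - 1)) : ℤ) =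
        padicValRat ℓ d + k * padicValNat ℓ d.den := by
      rw [← padicValNat_def' (Nat.prime_iff.mpr hℓ).ne_one (mul_ne_zero hnum hden'),
        padicValNat.mul hnum hden', padicValNat.pow, padicValRat_def, padicValInt]
      conv_rhs => rw [← hk']
      push_cast
      ring
    exact Int.natCast_dvd_natCast.mp (hval ▸ dvd_add (h ℓ) (dvd_mul_right _ _))
  rw [Nat.units_eq_one u, Units.val_one, one_mul] at hy
  have habs : |d| = (y / d.den : ℚ) ^ k := by
    have hden_pow : (d.den : ℚ) ^ k = d.den * d.den ^ (k - 1) := by rw [← pow_succ', hk']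
    have hy' : (d.num.natAbs : ℚ) * d.den ^ (k - 1) = y ^ k := by exact_mod_cast hy
    have hmul : |d| * d.den = d.num.natAbs := by
      rw [← Nat.abs_cast d.den, ← abs_mul, Rat.mul_den_eq_num, Nat.cast_natAbs, Int.cast_abs]
    rw [div_pow, eq_div_iff (pow_ne_zero k hden), ← hy', hden_pow, ← mul_assoc, hmul]
  rcases abs_choice d with e | e <;> rw [e] at habs
  exacts [⟨_, habs⟩, ⟨-(y / d.den), by rw [hk.neg_pow, ← habs, neg_neg]⟩]

theorem padicValRat_three_pow_mul {p ℓ : ℕ} [Fact p.Prime] [Fact ℓ.Prime] (A B : ℕ) :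
    padicValRat ℓ (3 ^ A * (p : ℚ) ^ B) =
      A * (if ℓ = 3 then 1 else 0) + B * (if ℓ = p then 1 else 0) := by
  have padicValRat_prime (q : ℕ) [hq : Fact q.Prime] :
      padicValRat ℓ q = if ℓ = q then 1 else 0 := by
    rw [padicValRat.of_nat]
    split_ifs with e
    · rw [e, padicValNat.self hq.out.one_lt, Nat.cast_one]
    · rw [padicValNat_primes e, Nat.cast_zero]
  have h3 : ((3 : ℕ) : ℚ) ^ A ≠ 0 := by positivity
  have hp : (p : ℚ) ^ B ≠ 0 := pow_ne_zero B (Nat.cast_ne_zero.mpr (Fact.out : p.Prime).ne_zero)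
  rw [← Nat.cast_ofNat (R := ℚ), padicValRat.mul h3 hp, padicValRat.pow, padicValRat.pow,
    padicValRat_prime, padicValRat_prime]

theorem rat_eq_three_pow_mul_pow_mul_cube {p : ℕ} [Fact p.Prime] (hp3 : p ≠ 3) (A : ℕ) {B : ℕ}
    (hB : ¬ 3 ∣ B) {d : ℚ} (hd : d ≠ 0)
    (h : ∀ (ℓ : ℕ) [Fact ℓ.Prime], ℓ ≠ 3 → ℓ ≠ p → 3 ∣ padicValRat ℓ d) :
    ∃ (m k : ℕ) (q : ℚ), d = 3 ^ m * (3 ^ A * (p : ℚ) ^ B) ^ k * q ^ 3 := by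
  have hB' : (B : ZMod 3) ≠ 0 := mt (ZMod.natCast_eq_zero_iff B 3).mp hB
  obtain ⟨k, hk⟩ : ∃ k : ℕ, (3 : ℤ) ∣ padicValRat p d - B * k :=
    ⟨(padicValRat p d * (B : ZMod 3)⁻¹ : ZMod 3).val, by
      rw [← Nat.cast_ofNat, ← ZMod.intCast_zmod_eq_zero_iff_dvd]
      push_cast
      rw [ZMod.natCast_zmod_val, mul_left_comm, mul_inv_cancel₀ hB', mul_one, sub_self]⟩
  obtain ⟨m, hm⟩ : ∃ m : ℕ, (3 : ℤ) ∣ padicValRat 3 d - (m + A * k) :=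
    ⟨(padicValRat 3 d - A * k : ZMod 3).val, by
      rw [← Nat.cast_ofNat, ← ZMod.intCast_zmod_eq_zero_iff_dvd]
      push_cast
      rw [ZMod.natCast_zmod_val, sub_add_cancel, sub_self]⟩
  have hp : (p : ℚ) ≠ 0 := Nat.cast_ne_zero.mpr (Fact.out : p.Prime).ne_zero
  have hprod : (3 : ℚ) ^ m * (3 ^ A * (p : ℚ) ^ B) ^ k = 3 ^ (m + A * k) * (p : ℚ) ^ (B * k) := by
    ring
  have hne : (3 : ℚ) ^ (m + A * k) * (p : ℚ) ^ (B * k) ≠ 0 := by positivity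
  obtain ⟨q, hq⟩ := rat_eq_pow_of_dvd_padicValRat (k := 3) (by decide) (div_ne_zero hd hne)
    fun ℓ _ => by
      rw [padicValRat.div hd hne, padicValRat_three_pow_mul]
      push_cast
      by_cases e3 : ℓ = 3
      · subst e3
        simpa [hp3.symm] using hm
      by_cases ep : ℓ = p
      · subst ep
        simpa [hp3] using hk
      · simpa [e3, ep] using h ℓ e3 ep
  exact ⟨m, k, q, by rw [hprod, ← hq, mul_div_cancel₀ d hne]⟩

theorem padic_valuation_algebraMap {ℓ : ℕ} [Fact ℓ.Prime] (q : ℚ) :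
    (algebraMap ℚ ℚ_[ℓ] q).valuation = padicValRat ℓ q := by
  rw [eq_ratCast, Padic.valuation_ratCast]

theorem padicValRat_mul_cube {ℓ : ℕ} [Fact ℓ.Prime] {a s N : ℚ} (hN : N ≠ 0) (h : a * s ^ 3 = N) :
    padicValRat ℓ N = padicValRat ℓ a + 3 * padicValRat ℓ s := by
  subst h
  rw [padicValRat.mul (left_ne_zero_of_mul hN) (right_ne_zero_of_mul hN), padicValRat.pow,
    Nat.cast_ofNat]

/-! ### Kummer cocycles -/

section Kummer

theorem apply_cube_eq {L F : Type*} [Field L] [Field F] [Algebra L F] {θ : F} {d : L}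
    (hd : algebraMap L F d = θ ^ 3) (σ : Gal(F/L)) : σ θ ^ 3 = θ ^ 3 := by
  rw [← map_pow, ← hd, AlgEquiv.commutes]

variable {n : ℚ} [NeZero n] {L F : Type*} [Field L] [Field F] [Algebra ℚ L] [Algebra ℚ F]
  [Algebra L F] [IsScalarTower ℚ L F] [DecidableEq F]

theorem three_zsmul_kernelPoint {z : F} (hz : z ^ 3 = 1) : (3 : ℤ) • kernelPoint n z = 0 := by
  rw [← two_add_one_eq_three, add_smul, two_smul, one_smul, ← kernelPoint_mul hz hz, ← sq,
    kernelPoint_sq hz, neg_add_cancel]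

theorem kernelPoint_apply_mul {θ : F} (hθ : θ ≠ 0) {d : L} (hd : algebraMap L F d = θ ^ 3)
    (σ τ : Gal(F/L)) :
    kernelPoint n ((σ * τ) θ / θ) = kernelPoint n (σ θ / θ) + σ • kernelPoint n (τ θ / θ) := by
  have hdiv (ρ : Gal(F/L)) : (ρ θ / θ) ^ 3 = 1 := by
    rw [div_pow, apply_cube_eq hd, div_self (pow_ne_zero 3 hθ)]
  rw [smul_kernelPoint σ (hdiv τ), ← kernelPoint_mul (hdiv σ) (map_cube_eq_one σ (hdiv τ)),
    map_div₀, AlgEquiv.mul_apply, mul_comm, div_mul_div_cancel₀ ((map_ne_zero σ).mpr hθ)]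

theorem exists_three_zsmul_eq_zero_and_eq_nsmul_add {c κ : Gal(F/L) → EPoint n F} {θ θ' t : F}
    (hc : ∀ σ, IsKummerPoint (c σ) θ (σ θ)) (hκ : ∀ σ, IsKummerPoint (κ σ) θ' (σ θ'))
    (hθ : θ ≠ 0) (ht : t ^ 3 = algebraMap ℚ F n) {m k : ℕ} {q : L}
    (h : θ ^ 3 = (θ' ^ m * t ^ k * algebraMap L F q) ^ 3) :
    ∃ T : EPoint n F, (3 : ℤ) • T = 0 ∧ ∀ σ, c σ = m • κ σ + (σ • T - T) := by
  set φ := θ' ^ m * t ^ k * algebraMap L F q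
  have hφ : φ ≠ 0 := pow_ne_zero_iff three_ne_zero |>.mp (h ▸ pow_ne_zero 3 hθ)
  have he : (θ / φ) ^ 3 = 1 := by rw [div_pow, h, div_self (pow_ne_zero 3 hφ)]
  have ht0 : t ≠ 0 :=
    pow_ne_zero_iff three_ne_zero |>.mp (ht ▸ algebraMap_rat_ne_zero)
  have htn : algebraMap L F (algebraMap ℚ L n) = t ^ 3 := by
    rw [ht, ← IsScalarTower.algebraMap_apply]
  have hcubic : (t * 1) ^ 3 + (t ^ 2 * 0) ^ 3 = algebraMap ℚ F n := by rw [← ht]; ring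
  refine ⟨k • cubicPoint _ _ hcubic + kernelPoint n (θ / φ), ?_, fun σ => ?_⟩
  · rw [smul_add, smul_comm, (three_zsmul_cubicPoint_eq_zero_iff hcubic).mpr (.inr (mul_zero _)),
      three_zsmul_kernelPoint he, smul_zero, add_zero]
  have hcubicPoint := isKummerPoint_smul_cubicPoint_sub ht0 hcubic (apply_cube_eq htn σ)
    (map_one σ) (map_zero σ)
  have hsum := ((((hκ σ).nsmul m).add (hcubicPoint.nsmul k)).mul_right (algebraMap L F q)).add
    (isKummerPoint_smul_kernelPoint_sub he σ)
  have hθφ : θ = φ * (θ / φ) := (mul_div_cancel₀ θ hφ).symm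
  have hσφ : (σ θ') ^ m * (σ t) ^ k * algebraMap L F q = σ φ := by
    simp only [φ, map_mul, map_pow, AlgEquiv.commutes]
  rw [hσφ, ← map_mul, ← hθφ] at hsum
  rw [(hc σ).eq hθ hsum, smul_add, smul_comm σ k, smul_sub]
  abel

end Kummer

section Local

variable {n : ℚ} [NeZero n] {Q : Type*} [Field Q] [Algebra ℚ Q] [DecidableEq Q]
  {c : Gal(Q/ℚ) → EPoint n Q}

theorem LocallyTrivialAt.three_dvd_padicValRat {w : Q} (hw : w ^ 2 + w + 1 = 0) {ℓ : ℕ}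
    [Fact ℓ.Prime] (h : LocallyTrivialAt c ℚ_[ℓ]) (hn : 3 ∣ padicValRat ℓ n) {θ : Q} (hθ : θ ≠ 0)
    {d : ℚ} (hd : algebraMap ℚ Q d = θ ^ 3) (hc : ∀ σ, IsKummerPoint (c σ) θ (σ θ)) :
    3 ∣ padicValRat ℓ d := by
  have hd0 : d ≠ 0 := (map_ne_zero (algebraMap ℚ Q)).mp (hd ▸ pow_ne_zero 3 hθ)
  rw [← padic_valuation_algebraMap] at hn ⊢
  exact three_dvd_valuation_of_coveringHasPoint ((map_ne_zero _).mpr hd0) algebraMap_rat_ne_zero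
    hn (h.coveringHasPoint hw hθ hd hc)

end Local

/-! ### Selmer classes -/

theorem H1_torsionBy_mk_eq_zero_iff {G M : Type*} [Group G] [TopologicalSpace G] [AddCommGroup M]
    [DistribMulAction G M] {m : ℤ} (c : cocycles G (AddSubgroup.torsionBy M m)) :
    (QuotientAddGroup.mk c : H1 G (AddSubgroup.torsionBy M m)) = 0 ↔
      ∃ T : M, m • T = 0 ∧ ∀ σ, (c.1 σ : M) = σ • T - T := by
  rw [QuotientAddGroup.eq_zero_iff, AddSubgroup.mem_addSubgroupOf]
  constructor
  · rintro ⟨⟨T, hT⟩, h⟩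
    exact ⟨T, hT, fun σ => congrArg Subtype.val (h σ)⟩
  · rintro ⟨T, hT, h⟩
    exact ⟨⟨T, hT⟩, fun σ => Subtype.ext (h σ)⟩

theorem isLocallyConstant_apply {k F : Type*} [Field k] [Field F] [Algebra k F]
    [Algebra.IsIntegral k F] (x : F) : IsLocallyConstant fun σ : Gal(F/k) => σ x := by
  refine (IsLocallyConstant.iff_exists_open _).mpr fun σ =>
    ⟨(fun τ => σ⁻¹ * τ) ⁻¹' (MulAction.stabilizer Gal(F/k) x : Set Gal(F/k)),
      (stabilizer_isOpen_of_isIntegral x).preimage (continuous_const_mul _), ?_, fun τ hτ => ?_⟩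
  · rw [Set.mem_preimage, inv_mul_cancel]
    exact one_mem _
  · rw [Set.mem_preimage, SetLike.mem_coe, MulAction.mem_stabilizer_iff, mul_smul] at hτ
    exact inv_smul_eq_iff.mp hτ

section Selmer

open scoped Classical

theorem localization_mk_eq_zero_iff {K : Type*} [Field K] (W : WeierstrassCurve K) (m : ℕ)
    (L : Type*) [Field L] [Algebra K L]
    (c : cocycles Gal(AlgebraicClosure K/K)
      (AddSubgroup.torsionBy (W.baseChange (AlgebraicClosure K)).toAffine.Point (m : ℤ))) :
    localization W m L (QuotientAddGroup.mk c) = 0 ↔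
      ∃ P : (W.baseChange (AlgebraicClosure L)).toAffine.Point,
        ∀ σ : Gal(AlgebraicClosure L/L),
          Point.map (W' := W) (closureEmbedding K L) (c.1 (galoisRestrictionHom K L σ)).1 =
            σ • P - P := by
  change QuotientAddGroup.mk (cocyclesMap _ _ _ c) = _ ↔ _
  rw [QuotientAddGroup.eq_zero_iff, AddSubgroup.mem_addSubgroupOf]
  rfl

/-- The `ℚ`-algebra structure on `AlgebraicClosure L` that comes from the one on `L`; as a local
instance it takes precedence over the one that comes from characteristic zero. -/
abbrev ratAlgebraAlgebraicClosure (L : Type*) [Field L] [Algebra ℚ L] :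
    Algebra ℚ (AlgebraicClosure L) :=
  AlgebraicClosure.instAlgebra L

attribute [local instance] ratAlgebraAlgebraicClosure

/-- The continuous cocycles of `Gal(ℚ̄/ℚ)` with values in the `3`-torsion of `Eₙ`. -/
abbrev torsionCocycles (n : ℚ) : AddSubgroup (Gal(AlgebraicClosure ℚ/ℚ) →
    AddSubgroup.torsionBy (EPoint n (AlgebraicClosure ℚ)) ((3 : ℕ) : ℤ)) :=
  cocycles Gal(AlgebraicClosure ℚ/ℚ)
    (AddSubgroup.torsionBy (EPoint n (AlgebraicClosure ℚ)) ((3 : ℕ) : ℤ))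

/-- The class in `H¹(ℚ, Eₙ[3])` of a cocycle. -/
abbrev toH1 {n : ℚ} (c : torsionCocycles n) : torsionH1 (cubeSumCurve n) 3 := QuotientAddGroup.mk c

/-- The function with values in `Eₙ(ℚ̄)` underlying a cocycle with values in `Eₙ[3]`. -/
abbrev cochain {n : ℚ} (c : torsionCocycles n) :
    Gal(AlgebraicClosure ℚ/ℚ) → EPoint n (AlgebraicClosure ℚ) :=
  fun σ => (c.1 σ).1

theorem isContinuousCocycle_cochain {n : ℚ} (c : torsionCocycles n) :
    IsContinuousCocycle (cochain c) where
  apply_mul σ τ := congrArg Subtype.val (c.2.2 σ τ)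
  exists_finset := by
    have apply_one : c.1 1 = 0 := by simpa using c.2.2 1 1
    obtain ⟨S, hS⟩ := exists_finset_of_mem_nhds_one
      ((c.2.1.isOpen_fiber (c.1 1)).mem_nhds rfl)
    exact ⟨S, fun σ hσ => congrArg Subtype.val ((hS σ hσ).trans apply_one)⟩

theorem locallyTrivialAt_of_localization_eq_zero {n : ℚ} {c : torsionCocycles n} {L : Type}
    [Field L] [Algebra ℚ L] [CharZero L] (h : localization (cubeSumCurve n) 3 L (toH1 c) = 0) :
    LocallyTrivialAt (cochain c) L := by
  obtain ⟨P, hP⟩ := (localization_mk_eq_zero_iff _ _ _ _).mp h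
  exact ⟨AlgebraicClosure L, inferInstance, inferInstance, inferInstance, inferInstance,
    inferInstance, inferInstance, closureEmbedding ℚ L, P, fun σ => ⟨galoisRestrictionHom ℚ L σ,
      closureEmbedding_restriction ℚ L σ, hP σ⟩⟩

theorem locallyTrivialAt_of_mem_selmerGroup {n : ℚ} {c : torsionCocycles n}
    (hc : toH1 c ∈ selmerGroup (cubeSumCurve n) 3) (ℓ : ℕ) [hℓ : Fact ℓ.Prime] :
    LocallyTrivialAt (cochain c) ℚ_[ℓ] :=
  locallyTrivialAt_of_localization_eq_zero (AddSubgroup.mem_iInf.mp (AddSubgroup.mem_iInf.mp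
    (AddSubgroup.mem_inf.mp hc).1 ℓ) hℓ)

variable {n : ℚ} [NeZero n] {θ : AlgebraicClosure ℚ} (hθ : θ ≠ 0)

section Kummer

variable {d : ℚ} (hd : algebraMap ℚ (AlgebraicClosure ℚ) d = θ ^ 3)

/-- The cocycle with values in `ker √-3 ≅ μ₃` that corresponds to `σ ↦ σ θ / θ` for a cube root `θ`
of a rational number; its class is the image of that number under
`ℚˣ/ℚˣ³ ≅ H¹(ℚ, μ₃) → H¹(ℚ, Eₙ[3])`. -/
def kummerCocycle : torsionCocycles n :=
  ⟨fun σ => ⟨kernelPoint n (σ θ / θ), three_zsmul_kernelPoint (by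
      rw [div_pow, apply_cube_eq hd, div_self (pow_ne_zero 3 hθ)])⟩,
    .desc _ Subtype.val ((isLocallyConstant_apply (k := ℚ) θ).comp fun x => kernelPoint n (x / θ))
      Subtype.val_injective,
    fun σ τ => Subtype.ext (kernelPoint_apply_mul hθ hd σ τ)⟩

theorem isKummerPoint_kummerCocycle (σ : Gal(AlgebraicClosure ℚ/ℚ)) :
    IsKummerPoint (cochain (kummerCocycle (n := n) hθ hd) σ) θ (σ θ) :=
  isKummerPoint_kernelPoint hθ (apply_cube_eq hd σ)

theorem localization_kummerCocycle_eq_zero {L : Type*} [Field L] [Algebra ℚ L]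
    (h : CoveringHasPoint (algebraMap ℚ L d) (algebraMap ℚ L n)) :
    localization (cubeSumCurve n) 3 L (toH1 (kummerCocycle hθ hd)) = 0 := by
  obtain ⟨P, hP⟩ := h.exists_trivializedBy (ι := closureEmbedding ℚ L) hθ
    (by rw [← hd, AlgHom.commutes, ← IsScalarTower.algebraMap_apply])
    (fun σ => ⟨_, closureEmbedding_restriction ℚ L σ⟩) (isKummerPoint_kummerCocycle hθ hd)
  refine (localization_mk_eq_zero_iff _ _ _ _).mpr ⟨P, fun σ => ?_⟩
  obtain ⟨ρ, hρ, hPρ⟩ := hP σ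
  have hρσ : ρ = galoisRestrictionHom ℚ L σ := AlgEquiv.ext fun x =>
    (closureEmbedding ℚ L).injective
      ((hρ x).trans (closureEmbedding_restriction ℚ L σ x).symm)
  exact hρσ ▸ hPρ

end Kummer

theorem exists_sq_add_add_one_eq_zero (F : Type*) [Field F] [IsAlgClosed F] :
    ∃ w : F, w ^ 2 + w + 1 = 0 := by
  open Polynomial in
  have hdeg : (X ^ 2 + X + 1 : F[X]).degree = 2 := by compute_degree!
  obtain ⟨w, hw⟩ := IsAlgClosed.exists_root _ (hdeg.trans_ne two_ne_zero)
  exact ⟨w, by simpa using hw⟩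

theorem exists_eq_nsmul_kummerCocycle_of_mem_selmerGroup {p A B : ℕ} [Fact p.Prime]
    (hp : p % 9 = 2 ∨ p % 9 = 5) (hB : ¬ 3 ∣ B) (hn : n = 3 ^ A * (p : ℚ) ^ B)
    (hd : algebraMap ℚ (AlgebraicClosure ℚ) 3 = θ ^ 3) {x : torsionH1 (cubeSumCurve n) 3}
    (hx : x ∈ selmerGroup (cubeSumCurve n) 3) :
    ∃ m : ℕ, x = m • toH1 (kummerCocycle hθ hd) := by
  have hp3 : p ≠ 3 := by rintro rfl; omega
  obtain ⟨c, rfl⟩ := QuotientAddGroup.mk_surjective x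
  have hloc := locallyTrivialAt_of_mem_selmerGroup hx
  have hval (ℓ : ℕ) [Fact ℓ.Prime] (h3 : ℓ ≠ 3) (hℓp : ℓ ≠ p) : 3 ∣ padicValRat ℓ n := by
    simp [hn, padicValRat_three_pow_mul, h3, hℓp]
  have hvalp : ¬ 3 ∣ padicValRat p n := by
    rw [hn, padicValRat_three_pow_mul, if_neg hp3, if_pos rfl]
    omega
  obtain ⟨w, hw⟩ := exists_sq_add_add_one_eq_zero (AlgebraicClosure ℚ)
  have hc := isContinuousCocycle_cochain c
  have sqrtNegThree_eq_zero := hc.sqrtNegThree_eq_zero (fun σ => (c.1 σ).2) hloc hp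
    (by rwa [padic_valuation_algebraMap])
    (fun ℓ _ hℓ => by
      rw [padic_valuation_algebraMap]
      exact hval ℓ (by omega) (by omega)) hw
  obtain ⟨η, hη, ⟨d, hdη⟩, hcη⟩ := hc.exists_isKummerPoint_algebraMap hw sqrtNegThree_eq_zero
  have hd0 : d ≠ 0 := (map_ne_zero (algebraMap ℚ _)).mp (hdη ▸ pow_ne_zero 3 hη)
  obtain ⟨m, k, q, hdq⟩ := rat_eq_three_pow_mul_pow_mul_cube hp3 A hB hd0 fun ℓ _ h3 hℓp =>
    (hloc ℓ).three_dvd_padicValRat hw (hval ℓ h3 hℓp) hη hdη hcη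
  obtain ⟨t, ht⟩ := IsAlgClosed.exists_pow_nat_eq (algebraMap ℚ (AlgebraicClosure ℚ) n) three_pos
  obtain ⟨T, hT, h⟩ := exists_three_zsmul_eq_zero_and_eq_nsmul_add (m := m) (k := k) (q := q) hcη
    (isKummerPoint_kummerCocycle hθ hd) hη ht (by
      rw [← hdη, hdq, ← hn]
      simp only [map_mul, map_pow, hd, ← ht]
      ring)
  exact ⟨m, sub_eq_zero.mp ((H1_torsionBy_mk_eq_zero_iff (c - m • kummerCocycle hθ hd)).mpr
    ⟨T, hT, fun σ => sub_eq_iff_eq_add'.mpr (h σ)⟩)⟩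

section KummerThree

variable (hd : algebraMap ℚ (AlgebraicClosure ℚ) 3 = θ ^ 3)

theorem kummerCocycle_three_mem_selmerGroup {N : ℕ}
    (hN : N % 9 = 2 ∨ N % 9 = 4 ∨ N % 9 = 5 ∨ N % 9 = 7)
    (hNℓ : ∀ ℓ : ℕ, ℓ.Prime → ℓ ∣ N → ℓ % 3 = 2) (hn : n = 3 * N) :
    toH1 (kummerCocycle (n := n) hθ hd) ∈ selmerGroup (cubeSumCurve n) 3 := by
  refine AddSubgroup.mem_inf.mpr ⟨AddSubgroup.mem_iInf.mpr fun ℓ => AddSubgroup.mem_iInf.mpr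
    fun hℓ => ?_, ?_⟩ <;> refine localization_kummerCocycle_eq_zero hθ hd ?_
  · simpa [hn] using coveringHasPoint_three_three_mul hN (hNℓ ℓ hℓ.out)
  · refine .inr ⟨(3 : ℝ) ^ (3⁻¹ : ℝ), ?_⟩
    rw [map_ofNat, ← Nat.cast_ofNat (n := 3), Real.rpow_inv_natCast_pow (by positivity) (by decide)]

theorem kummerCocycle_three_notMem_selmerGroup {N : ℕ}
    (hN : N % 9 = 2 ∨ N % 9 = 4 ∨ N % 9 = 5 ∨ N % 9 = 7) (hn : n = 9 * N) :
    toH1 (kummerCocycle (n := n) hθ hd) ∉ selmerGroup (cubeSumCurve n) 3 := fun hx => by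
  obtain ⟨w, hw⟩ := exists_sq_add_add_one_eq_zero (AlgebraicClosure ℚ)
  have h := (locallyTrivialAt_of_mem_selmerGroup hx 3).coveringHasPoint hw hθ hd
    (isKummerPoint_kummerCocycle hθ hd)
  exact not_coveringHasPoint_three_nine_mul hN (by simpa [hn] using h)

theorem toH1_kummerCocycle_three_ne_zero (h3 : padicValRat 3 n = 1) {p : ℕ} [Fact p.Prime]
    (hp3 : p ≠ 3) (hp : ¬ 3 ∣ padicValRat p n) : toH1 (kummerCocycle (n := n) hθ hd) ≠ 0 := by
  intro h
  obtain ⟨w, hw⟩ := exists_sq_add_add_one_eq_zero (AlgebraicClosure ℚ)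
  obtain ⟨T, hT, hσ⟩ := (H1_torsionBy_mk_eq_zero_iff _).mp h
  have val_three : padicValRat 3 (3 : ℚ) = 1 := padicValRat.self (p := 3) (by decide)
  have val_p : padicValRat p (3 : ℚ) = 0 := by
    simpa [padicValNat_primes hp3] using padicValRat.of_nat (p := p) (n := 3)
  rcases cube_class_of_isKummerPoint_of_three_zsmul_eq_zero hw hθ hd hT fun σ =>
    hσ σ ▸ isKummerPoint_kummerCocycle (n := n) hθ hd σ with ⟨r, hr⟩ | ⟨s, hs⟩ | ⟨g, hg⟩
  · exact hp ⟨_, by rw [padicValRat_mul_cube (ℓ := p) (NeZero.ne n) hr, val_p, zero_add]⟩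
  · have := padicValRat_mul_cube (ℓ := 3) (NeZero.ne n) hs
    rw [h3, padicValRat.pow, val_three] at this
    omega
  · have := congrArg (padicValRat 3) hg
    rw [val_three, padicValRat.pow] at this
    omega

end KummerThree

theorem exists_cube_eq_three :
    ∃ θ : AlgebraicClosure ℚ, θ ≠ 0 ∧ algebraMap ℚ (AlgebraicClosure ℚ) 3 = θ ^ 3 := by
  obtain ⟨θ, h⟩ := IsAlgClosed.exists_pow_nat_eq (algebraMap ℚ (AlgebraicClosure ℚ) 3) three_pos
  exact ⟨θ, pow_ne_zero_iff three_ne_zero |>.mp (h ▸ (map_ne_zero _).mpr three_ne_zero), h.symm⟩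

theorem pow_mod_nine {p B : ℕ} (hp : p % 9 = 2 ∨ p % 9 = 5) (hB : ¬ 3 ∣ B) :
    p ^ B % 9 = 2 ∨ p ^ B % 9 = 4 ∨ p ^ B % 9 = 5 ∨ p ^ B % 9 = 7 := by
  have pow_six : p ^ 6 % 9 = 1 := by rcases hp with h | h <;> simp [Nat.pow_mod, h]
  have pow_eq : p ^ B % 9 = p ^ (B % 6) % 9 := by
    conv_lhs => rw [← Nat.div_add_mod B 6, pow_add, pow_mul, Nat.mul_mod, Nat.pow_mod, pow_six]
    simp
  have hB6 : B % 6 = 1 ∨ B % 6 = 2 ∨ B % 6 = 4 ∨ B % 6 = 5 := by omega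
  rw [pow_eq, Nat.pow_mod]
  rcases hp with h | h <;> rcases hB6 with e | e | e | e <;> simp [h, e]

theorem nsmul_eq_zero_of_mem_of_notMem {M : Type*} [AddCommGroup M] {S : AddSubgroup M} {q m : ℕ}
    (hq : q.Prime) {x : M} (hqx : q • x = 0) (hx : x ∉ S) (hmx : m • x ∈ S) : m • x = 0 := by
  by_cases hm : q ∣ m
  · obtain ⟨k, rfl⟩ := hm
    rw [mul_comm, mul_smul, hqx, smul_zero]
  refine absurd ?_ hx
  have bezout : (1 : ℤ) = m * m.gcdA q + q * m.gcdB q := by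
    rw [← Nat.gcd_eq_gcd_ab, ((Nat.Prime.coprime_iff_not_dvd hq).mpr hm).symm, Nat.cast_one]
  have hx_eq : x = m.gcdA q • m • x := by
    nth_rw 1 [← one_zsmul x, bezout, add_smul, mul_comm, mul_comm (q : ℤ), mul_smul, mul_smul,
      natCast_zsmul, natCast_zsmul, hqx, smul_zero, add_zero]
  exact hx_eq ▸ zsmul_mem hmx _

section Rank

variable {p B : ℕ} [Fact p.Prime]

theorem rank_selmerGroup_eq_one (hp : p % 9 = 2 ∨ p % 9 = 5) (hB : ¬ 3 ∣ B)
    (hn : n = 3 * (p : ℚ) ^ B) :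
    Module.rank (ZMod 3) (selmerGroup (cubeSumCurve n) 3) = 1 := by
  have hp3 : p ≠ 3 := by rintro rfl; omega
  have hpN (ℓ : ℕ) (hℓ : ℓ.Prime) (h : ℓ ∣ p ^ B) : ℓ % 3 = 2 := by
    rw [(Nat.prime_dvd_prime_iff_eq hℓ Fact.out).mp (hℓ.dvd_of_dvd_pow h)]
    omega
  have hval (ℓ : ℕ) [Fact ℓ.Prime] :
      padicValRat ℓ n = (if ℓ = 3 then 1 else 0) + B * (if ℓ = p then 1 else 0) := by
    simpa [hn] using padicValRat_three_pow_mul (p := p) (ℓ := ℓ) 1 B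
  obtain ⟨θ, hθ, hd⟩ := exists_cube_eq_three
  have hmem := kummerCocycle_three_mem_selmerGroup (n := n) hθ hd (pow_mod_nine hp hB) hpN
    (by rw [hn, Nat.cast_pow])
  have hne : toH1 (kummerCocycle (n := n) hθ hd) ≠ 0 :=
    toH1_kummerCocycle_three_ne_zero hθ hd (by simp [hval, hp3.symm]) hp3 (by
      rw [hval, if_neg hp3, if_pos rfl]
      omega)
  refine rank_eq_one (⟨_, hmem⟩ : selmerGroup (cubeSumCurve n) 3)
    (fun e => hne (congrArg Subtype.val e)) ?_
  rintro ⟨x, hx⟩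
  obtain ⟨m, hm⟩ := exists_eq_nsmul_kummerCocycle_of_mem_selmerGroup (A := 1) hθ hp hB
    (by rw [hn, pow_one]) hd hx
  exact ⟨m, by rw [Nat.cast_smul_eq_nsmul]; exact Subtype.ext hm.symm⟩

theorem rank_selmerGroup_eq_zero (hp : p % 9 = 2 ∨ p % 9 = 5) (hB : ¬ 3 ∣ B)
    (hn : n = 9 * (p : ℚ) ^ B) :
    Module.rank (ZMod 3) (selmerGroup (cubeSumCurve n) 3) = 0 := by
  obtain ⟨θ, hθ, hd⟩ := exists_cube_eq_three
  have hnotMem := kummerCocycle_three_notMem_selmerGroup (n := n) hθ hd (pow_mod_nine hp hB)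
    (by rw [hn, Nat.cast_pow])
  have eq_zero (x) (hx : x ∈ selmerGroup (cubeSumCurve n) 3) : x = 0 := by
    obtain ⟨m, rfl⟩ := exists_eq_nsmul_kummerCocycle_of_mem_selmerGroup (A := 2) hθ hp hB
      (by rw [hn]; norm_num) hd hx
    exact nsmul_eq_zero_of_mem_of_notMem Nat.prime_three
      (H1.nsmul_eq_zero (fun y => AddSubgroup.torsionBy.nsmul y) _) hnotMem hx
  have : Subsingleton (selmerGroup (cubeSumCurve n) 3) :=
    ⟨fun x y => Subtype.ext ((eq_zero x x.2).trans (eq_zero y y.2).symm)⟩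
  exact rank_subsingleton' _ _

end Rank

end Selmer

end CubeSum

end

theorem mainTheorem7_general (p : ℕ) (hp : p.Prime) (hmod : p % 9 = 2 ∨ p % 9 = 5) {B : ℕ}
    (hB : ¬ 3 ∣ B) :
    Module.rank (ZMod 3) (CubeSum.selmerGroup (CubeSum.cubeSumCurve (3 * (p : ℚ) ^ B)) 3) = 1 ∧
    Module.rank (ZMod 3) (CubeSum.selmerGroup (CubeSum.cubeSumCurve (9 * (p : ℚ) ^ B)) 3) = 0 := by
  have : Fact p.Prime := ⟨hp⟩
  have hpB : (p : ℚ) ^ B ≠ 0 := pow_ne_zero B (Nat.cast_ne_zero.mpr hp.ne_zero)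
  have : NeZero (3 * (p : ℚ) ^ B) := ⟨mul_ne_zero (by norm_num) hpB⟩
  have : NeZero (9 * (p : ℚ) ^ B) := ⟨mul_ne_zero (by norm_num) hpB⟩
  exact ⟨CubeSum.rank_selmerGroup_eq_one hmod hB rfl,
    CubeSum.rank_selmerGroup_eq_zero hmod hB rfl⟩

theorem mainTheorem7 (p : ℕ) (hp : p.Prime) (hodd : Odd p) (hmod : p % 9 = 2 ∨ p % 9 = 5) :
    Module.rank (ZMod 3) (CubeSum.selmerGroup (CubeSum.cubeSumCurve (3 * (p : ℚ))) 3) = 1 ∧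
    Module.rank (ZMod 3) (CubeSum.selmerGroup (CubeSum.cubeSumCurve (9 * (p : ℚ) ^ 2)) 3) = 0 ∧
    Module.rank (ZMod 3) (CubeSum.selmerGroup (CubeSum.cubeSumCurve (3 * (p : ℚ) ^ 2)) 3) = 1 ∧
    Module.rank (ZMod 3) (CubeSum.selmerGroup (CubeSum.cubeSumCurve (9 * (p : ℚ))) 3) = 0 := by
  obtain ⟨h3, h9⟩ := mainTheorem7_general p hp hmod (B := 1) (by decide)
  obtain ⟨h3', h9'⟩ := mainTheorem7_general p hp hmod (B := 2) (by decide)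
  rw [pow_one] at h3 h9
  exact ⟨h3, h9', h3', h9⟩
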